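/- Let $\mathbb T=\mathbb R/2\pi\mathbb Z$, $\langle z\rangle=(1+|z|^2)^{1/2}$, and $d_\tau(\sigma)=\frac{e^{i\tau\sigma}-1}{\tau}$ for $\tau\in(0,1]$. For a sequence of functions $u=(u^n)_{n\in\mathbb Z}$, $u^n:\mathbb T\to\mathbb C$, with $\tau\sum_n\|u^n\|_{L^2(\mathbb T)}^2<\infty$ (we write $u\in l^2_\tau L^2$), set $$\widehat{u^m}(k)=\frac1{2\pi}\int_{-\pi}^{\pi}u^m(x)e^{-ikx}\,dx,\qquad \widetilde u(\sigma,k)=\tau\sum_{m\in\mathbb Z}\widehat{u^m}(k)\,e^{im\tau\sigma},\qquad k\in\mathbb Z,\ \sigma\in[-\pi/\tau,\pi/\tau],$$ where the series converges in $L^2(d\sigma)$. For $s\ge 0$ and $b\in\mathbb R$ let $$\|u\|_{X^{s,b}_\tau}=\big\|\langle k\rangle^s\langle d_\tau(\sigma+k^3)\rangle^b\,\widetilde u(\sigma,k)\big\|_{L^2(\sigma)l^2(k)},$$ $$\|u\|_{X^s_\tau}=\|u\|_{X^{s,1/2}_\tau}+\big\|\langle k\rangle^s\widetilde u(\sigma,k)\big\|_{l^2(k)L^1(\sigma)},\qquad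 \|u\|_{Y^s_\tau}=\|u\|_{X^{s,-1/2}_\tau}+\Big\|\tfrac{\langle k\rangle^s}{\langle d_\tau(\sigma+k^3)\rangle}\widetilde u(\sigma,k)\Big\|_{l^2(k)L^1(\sigma)},$$ and let $X^s_\tau$ (resp. $Y^s_\tau$) be the space of all $u\in l^2_\tau L^2$ such that $\int_{\mathbb T}u^n\,dx=0$ for every $n$ and $\|u\|_{X^s_\tau}<\infty$ (resp. $\|u\|_{Y^s_\tau}<\infty$). Let $\Pi_\tau$ be the filter $$\Pi_\tau f(x)=\sum_{k\in\mathbb Z,\ |k|\tau^{1/3}\le 1}\widehat f(k)\,e^{ikx}.$$ **Lemma 3.3.** For every $s\ge 0$ there exists $C>0$ such that for every $\tau\in(0,1]$ and all $u=(u^n)_n$, $v=(v^n)_n$ in $X^s_\tau$, the sequence $\big(\partial_x\Pi_\tau(\Pi_\tau u^n\,\Pi_\tau v^n)\big)_n$ belongs to $Y^s_\tau$ and $$\big\|\partial_x\Pi_\tau\big(\Pi_\tau u^n\,\Pi_\tau v^n\big)\big\|_{Y^s_\tau}\le C\Big(\|u\|_{X^{s,1/2}_\tau}\|v\|_{X^{s,1/3}_\tau}+\|v\|_{X^{s,1/2}_\tau}\|u\|_{X^{s,1/3}_\tau}\Big).$$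 -/

import Mathlib

open MeasureTheory AddCircle
open scoped ENNReal Real

noncomputable section

namespace DiscreteKdV

instance factTwoPi : Fact (0 < 2 * π) := ⟨Real.two_pi_pos⟩

instance factDualPeriod (τ : ℝ) [hτ : Fact (0 < τ)] : Fact (0 < 2 * π / τ) :=
  ⟨div_pos Real.two_pi_pos hτ.out⟩

/-- The torus `ℝ / 2πℤ` of the space variable; its `volume` has total mass `2π`. -/
abbrev Torus : Type := AddCircle (2 * π)

/-- The circle `ℝ / (2π/τ)ℤ` of the time frequency `σ`, that is `[-π/τ, π/τ]` with its end points
identified; its `volume` is Lebesgue measure, of total mass `2π/τ`. On it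
`fourier m σ = exp (i m τ σ)`. -/
abbrev FreqCircle (τ : ℝ) : Type := AddCircle (2 * π / τ)

/-- `⟨z⟩ = (1 + |z|²)^(1/2)`. -/
def jap (z : ℂ) : ℝ := Real.sqrt (1 + ‖z‖ ^ 2)

/-- `d_τ(σ) = (exp (i τ σ) - 1) / τ`, a `2π/τ`-periodic function of `σ`. -/
def dTau (τ : ℝ) (σ : FreqCircle τ) : ℂ := (fourier 1 σ - 1) / (τ : ℂ)

/-- The function `σ ↦ ũ(σ, k) = τ ∑ₘ ûᵐ(k) exp (i m τ σ)`, where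
`ûᵐ(k) = (2π)⁻¹ ∫ uᵐ(x) exp (-i k x) dx`; the series is summed in `L²`. -/
def spaceTimeFourier (τ : ℝ) [Fact (0 < τ)] (u : ℤ → Torus → ℂ) (k : ℤ) :
    Lp ℂ 2 (haarAddCircle (T := 2 * π / τ)) :=
  ∑' m : ℤ, ((τ : ℂ) * fourierCoeff (u m) k) • fourierLp 2 m

/-- The weight `⟨k⟩^s ⟨d_τ(σ + k³)⟩^b`. -/
def weight (τ s b : ℝ) (k : ℤ) (σ : FreqCircle τ) : ℝ :=
  jap (k : ℂ) ^ s * jap (dTau τ (σ + (((k : ℝ) ^ 3 : ℝ) : FreqCircle τ))) ^ b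

/-- The norm of `X^{s,b}_τ`, with values in `[0, ∞]`:
the `L²(σ) l²(k)` norm of `⟨k⟩^s ⟨d_τ(σ + k³)⟩^b ũ(σ, k)`. -/
def normXsb (τ : ℝ) [Fact (0 < τ)] (s b : ℝ) (u : ℤ → Torus → ℂ) : ℝ≥0∞ :=
  (∑' k : ℤ, ∫⁻ σ : FreqCircle τ,
    (ENNReal.ofReal (weight τ s b k σ) * ‖spaceTimeFourier τ u k σ‖ₑ) ^ 2) ^ (1 / 2 : ℝ)

/-- The `l²(k) L¹(σ)` norm of `⟨k⟩^s ⟨d_τ(σ + k³)⟩^b ũ(σ, k)`, with values in `[0, ∞]`. -/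
def normL2L1 (τ : ℝ) [Fact (0 < τ)] (s b : ℝ) (u : ℤ → Torus → ℂ) : ℝ≥0∞ :=
  (∑' k : ℤ, (∫⁻ σ : FreqCircle τ,
    ENNReal.ofReal (weight τ s b k σ) * ‖spaceTimeFourier τ u k σ‖ₑ) ^ 2) ^ (1 / 2 : ℝ)

/-- The norm of `X^s_τ`. -/
def normX (τ : ℝ) [Fact (0 < τ)] (s : ℝ) (u : ℤ → Torus → ℂ) : ℝ≥0∞ :=
  normXsb τ s (1 / 2) u + normL2L1 τ s 0 u

/-- The norm of `Y^s_τ`. -/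
def normY (τ : ℝ) [Fact (0 < τ)] (s : ℝ) (u : ℤ → Torus → ℂ) : ℝ≥0∞ :=
  normXsb τ s (-(1 / 2)) u + normL2L1 τ s (-1) u

/-- The sequences in `l²_τ L²` all of whose terms have mean zero. -/
structure IsL2MeanZero (τ : ℝ) (u : ℤ → Torus → ℂ) : Prop where
  aestronglyMeasurable : ∀ n, AEStronglyMeasurable (u n) volume
  l2_finite : ENNReal.ofReal τ * ∑' n : ℤ, ∫⁻ x : Torus, ‖u n x‖ₑ ^ 2 < ∞
  mean_zero : ∀ n, ∫ x : Torus, u n x = 0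

/-- Membership in `X^s_τ`. -/
def MemX (τ : ℝ) [Fact (0 < τ)] (s : ℝ) (u : ℤ → Torus → ℂ) : Prop :=
  IsL2MeanZero τ u ∧ normX τ s u < ∞

/-- Membership in `Y^s_τ`. -/
def MemY (τ : ℝ) [Fact (0 < τ)] (s : ℝ) (u : ℤ → Torus → ℂ) : Prop :=
  IsL2MeanZero τ u ∧ normY τ s u < ∞

open Classical in
/-- The filter `Π_τ = χ(-i ∂ₓ τ^{1/3})` with `χ` the indicator function of `[-1, 1]`: the Fourier
multiplier that keeps the frequencies `k` with `|k| τ^{1/3} ≤ 1` (finitely many when `τ > 0`). -/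
def filterPi (τ : ℝ) (f : Torus → ℂ) (x : Torus) : ℂ :=
  ∑' k : ℤ, if |(k : ℝ) * τ ^ (1 / 3 : ℝ)| ≤ 1 then fourierCoeff f k * fourier k x else 0

/-- The derivative `∂ₓ` of a function on the torus. -/
def dx (f : Torus → ℂ) (x : Torus) : ℂ :=
  deriv (fun t : ℝ => f (x + (t : Torus))) 0

/-- The sequence `∂ₓ Π_τ (Π_τ uⁿ · Π_τ vⁿ)`. -/
def bilin (τ : ℝ) (u v : ℤ → Torus → ℂ) (n : ℤ) : Torus → ℂ :=
  dx (filterPi τ (fun x => filterPi τ (u n) x * filterPi τ (v n) x))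

end DiscreteKdV

end

open MeasureTheory AddCircle
open scoped ENNReal Real

namespace DiscreteKdV

/-! Only the size of ũ matters, so the estimate reduces to convolutions of nonnegative functions on
the dual group ℤ × (ℝ/(2π/τ)ℤ). The filtered product is a trigonometric polynomial, and the
transform of its derivative is at most |k| times a convolution of the two amplitudes
(`IsL2MeanZero.enorm_spaceTimeFourier_bilin_le`). The weight ⟨k⟩^s passes to the inputs at the price
of 2^s, and evaluating at -z puts the three phase points on the symmetric footing x + y + z = 0.
Write L for the modulation ⟨d_τ(σ + k³)⟩ of a point.

Resonance: the three quantities σ + k³ add up to 3k₁k₂k₃ modulo 2π/τ (`resonance_identity`). The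
filter forces τ|3k₁k₂k₃| ≤ 3 < π, so this number does not wrap around the circle and the largest L
is at least |k₁k₂k₃|/2 (`resonance_product_le`). Mean zero excludes zero input frequencies, hence
|k₁k₂k₃| ≥ k₃²/2, and the square root of the largest L pays for the derivative
(`derivSymbol_cases`).

Strichartz: the kernel L_x^(-1/3) L_y^(-1/3) is bounded from L² × L² to L², and so are its
permutations (`exists_strichartz`). By Cauchy-Schwarz it suffices to integrate the squared kernel
with one variable frozen. Where |k_z|³ dominates L_x and L_y, z is frozen and the integers near the
roots of a quadratic are counted; where L_x dominates, x is frozen and the count is elementary.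

The X^{s,-1/2} part (`exists_bilinear_l2_le`): if the largest L belongs to an input, its square root
turns that input into its X^{s,1/2} amplitude and the dual Strichartz estimate applies; if it
belongs to the output, it cancels the weight and Strichartz applies directly.

The l²L¹ part (`exists_bilinear_l1_le`): when an input dominates, L_z^(-1) = L_z^(-2/3) L_z^(-1/3),
and L_z^(-2/3) is square integrable in σ. When the output dominates, only L_z^(-1/2) would remain
after paying for the derivative, which just fails to be uniformly square integrable. There L_z^(-1)
is instead shared between the two inputs, and Cauchy-Schwarz in σ and then in the frequency gains a
summable |n|^(-4/3). -/

/-- The Cauchy-Schwarz inequality for the Lebesgue integral of nonnegative functions. -/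
theorem lintegral_mul_sq_le {α : Type*} [MeasurableSpace α] {μ : Measure α} {f g : α → ℝ≥0∞}
    (hf : AEMeasurable f μ) (hg : AEMeasurable g μ) :
    (∫⁻ x, f x * g x ∂μ) ^ 2 ≤ (∫⁻ x, f x ^ 2 ∂μ) * ∫⁻ x, g x ^ 2 ∂μ := by
  have h := ENNReal.lintegral_mul_le_Lp_mul_Lq μ Real.HolderConjugate.two_two hf hg
  have h2 := pow_le_pow_left₀ (zero_le) h 2
  have e : ∀ a : ℝ≥0∞, (a ^ (1 / (2 : ℝ))) ^ 2 = a := fun a => by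
    rw [← ENNReal.rpow_natCast, ← ENNReal.rpow_mul]; norm_num
  simp only [Pi.mul_apply, ENNReal.rpow_ofNat] at h2
  rwa [mul_pow, e, e] at h2

theorem tsum_mul_sq_le {ι : Type*} (f g : ι → ℝ≥0∞) :
    (∑' i, f i * g i) ^ 2 ≤ (∑' i, f i ^ 2) * ∑' i, g i ^ 2 := by
  let _ : MeasurableSpace ι := ⊤
  have h := lintegral_mul_sq_le (μ := Measure.count) (f := f) (g := g)
    (measurable_from_top).aemeasurable (measurable_from_top).aemeasurable
  simpa only [lintegral_count] using h

/-! ### Bilinear operators on triples of sum zero. -/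

section Schur

variable {G : Type*} [AddCommGroup G] [MeasurableSpace G] [MeasurableAdd₂ G] [MeasurableNeg G]
  {μ : Measure G} [SFinite μ] [μ.IsAddLeftInvariant] [μ.IsNegInvariant]

omit [SFinite μ] in
theorem lintegral_neg_sub (f : G → ℝ≥0∞) (z : G) :
    ∫⁻ x, f (-x - z) ∂μ = ∫⁻ x, f x ∂μ := by
  have : ∀ x, -x - z = -z - x := fun x => by abel
  simp_rw [this]
  exact lintegral_sub_left_eq_self f (-z)

variable (μ) in
/-- The bilinear operator with kernel `K x y z` on the triples with `x + y + z = 0`. -/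
noncomputable def trilinearOp (K : G → G → G → ℝ≥0∞) (F H : G → ℝ≥0∞) (z : G) : ℝ≥0∞ :=
  ∫⁻ x, F x * H (-x - z) * K x (-x - z) z ∂μ

variable (μ) in
/-- The square of the kernel `K`, integrated over the triples `x + y + z = 0` in which one
(fixed choice) of the three variables is frozen, is at most `C`. -/
def IsSchurKernel (K : G → G → G → ℝ≥0∞) (C : ℝ≥0∞) : Prop :=
  (Measurable fun p : G × G × G => K p.1 p.2.1 p.2.2) ∧
    ((∀ z, ∫⁻ x, K x (-x - z) z ^ 2 ∂μ ≤ C) ∨ (∀ x, ∫⁻ z, K x (-z - x) z ^ 2 ∂μ ≤ C) ∨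
      (∀ y, ∫⁻ z, K (-z - y) y z ^ 2 ∂μ ≤ C))

-- The condition is a disjunction over the frozen variable, so it survives permutations of the three
-- variables. This transposition and the next generate them all, which gives the dual Strichartz
-- estimate from the direct one.
omit [SFinite μ] in
theorem IsSchurKernel.swap_left {K : G → G → G → ℝ≥0∞} {C : ℝ≥0∞} (h : IsSchurKernel μ K C) :
    IsSchurKernel μ (fun x y z => K y x z) C := by
  obtain ⟨hm, h⟩ := h
  refine ⟨hm.comp (f := fun p : G × G × G => (p.2.1, p.1, p.2.2)) (by fun_prop), ?_⟩
  rcases h with h | h | h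
  · refine Or.inl fun z => ?_
    refine le_of_eq_of_le ?_ (h z)
    rw [← lintegral_neg_sub _ z]
    simp
  · exact Or.inr (Or.inr h)
  · exact Or.inr (Or.inl h)

omit [SFinite μ] in
theorem IsSchurKernel.swap_right {K : G → G → G → ℝ≥0∞} {C : ℝ≥0∞} (h : IsSchurKernel μ K C) :
    IsSchurKernel μ (fun x y z => K x z y) C := by
  obtain ⟨hm, h⟩ := h
  refine ⟨hm.comp (f := fun p : G × G × G => (p.1, p.2.2, p.2.1)) (by fun_prop), ?_⟩
  rcases h with h | h | h
  · refine Or.inr (Or.inr fun y => ?_)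
    refine le_of_eq_of_le ?_ (h y)
    rw [← lintegral_neg_sub (fun x => K x (-x - y) y ^ 2) y]
    simp
  · refine Or.inr (Or.inl fun x => ?_)
    refine le_of_eq_of_le ?_ (h x)
    rw [← lintegral_neg_sub (fun z => K x (-z - x) z ^ 2) x]
    simp
  · refine Or.inl fun z => ?_
    refine le_of_eq_of_le ?_ (h z)
    rw [← lintegral_neg_sub _ z]
    simp

theorem measurable_mul_shift {F H : G → ℝ≥0∞} (hF : Measurable F) (hH : Measurable H) :
    Measurable fun p : G × G => F p.1 * H (-p.1 - p.2) := by
  have : Measurable fun p : G × G => -p.1 - p.2 := by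
    simp only [sub_eq_add_neg]; fun_prop
  exact (hF.comp measurable_fst).mul (hH.comp this)

theorem measurable_kernel_shift {K : G → G → G → ℝ≥0∞}
    (hm : Measurable fun p : G × G × G => K p.1 p.2.1 p.2.2) :
    Measurable fun p : G × G => K p.1 (-p.1 - p.2) p.2 :=
  hm.comp (f := fun p : G × G => (p.1, -p.1 - p.2, p.2))
    (by simp only [sub_eq_add_neg]; fun_prop)

theorem lintegral_lintegral_mul_shift {F H : G → ℝ≥0∞} (hF : Measurable F) (hH : Measurable H) :
    ∫⁻ z, ∫⁻ x, F x * H (-x - z) ∂μ ∂μ = (∫⁻ x, F x ∂μ) * ∫⁻ x, H x ∂μ := by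
  rw [lintegral_lintegral_swap]
  · have : ∀ x, ∫⁻ z, F x * H (-x - z) ∂μ = F x * ∫⁻ z, H z ∂μ := fun x => by
      have hm : Measurable fun z => H (-x - z) :=
        hH.comp (f := fun z => -x - z) (by simp only [sub_eq_add_neg]; fun_prop)
      rw [lintegral_const_mul _ hm]
      congr 1; exact lintegral_sub_left_eq_self H (-x)
    simp_rw [this]
    exact lintegral_mul_const _ hF
  · exact ((measurable_mul_shift hF hH).comp measurable_swap).aemeasurable

omit [SFinite μ] in
theorem trilinearOp_swap (K : G → G → G → ℝ≥0∞) (F H : G → ℝ≥0∞) (z : G) :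
    trilinearOp μ (fun x y z => K y x z) H F z = trilinearOp μ K F H z := by
  unfold trilinearOp
  rw [← lintegral_neg_sub _ z]
  simp [mul_comm]

omit [μ.IsAddLeftInvariant] [μ.IsNegInvariant] in
theorem measurable_trilinearOp {K : G → G → G → ℝ≥0∞} {F H : G → ℝ≥0∞}
    (hm : Measurable fun p : G × G × G => K p.1 p.2.1 p.2.2)
    (hF : Measurable F) (hH : Measurable H) : Measurable (trilinearOp μ K F H) :=
  ((measurable_mul_shift hF hH).mul (measurable_kernel_shift hm)).lintegral_prod_left'

/-- Cauchy-Schwarz pairs F·K against H; the integral of H² no longer depends on z, and Tonelli then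
integrates K² in z at fixed x. -/
theorem lintegral_trilinearOp_sq_le_of_snd {K : G → G → G → ℝ≥0∞} {C : ℝ≥0∞}
    (hm : Measurable fun p : G × G × G => K p.1 p.2.1 p.2.2)
    (h : ∀ x, ∫⁻ z, K x (-z - x) z ^ 2 ∂μ ≤ C)
    {F H : G → ℝ≥0∞} (hF : Measurable F) (hH : Measurable H) :
    ∫⁻ z, trilinearOp μ K F H z ^ 2 ∂μ ≤ C * ((∫⁻ x, F x ^ 2 ∂μ) * ∫⁻ x, H x ^ 2 ∂μ) := by
  have hK := measurable_kernel_shift hm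
  calc ∫⁻ z, trilinearOp μ K F H z ^ 2 ∂μ
      ≤ ∫⁻ z, (∫⁻ x, F x ^ 2 * K x (-x - z) z ^ 2 ∂μ) * ∫⁻ x, H x ^ 2 ∂μ ∂μ := by
        refine lintegral_mono fun z => ?_
        have e : trilinearOp μ K F H z = ∫⁻ x, (F x * K x (-x - z) z) * H (-x - z) ∂μ :=
          lintegral_congr fun x => by ring
        have h1 : Measurable fun x => K x (-x - z) z := hK.comp (measurable_id.prodMk measurable_const)
        have h2 : Measurable fun x => H (-x - z) := hH.comp (f := fun x => -x - z) (by simp only [sub_eq_add_neg]; fun_prop)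
        rw [e]
        refine (lintegral_mul_sq_le (hF.mul h1).aemeasurable h2.aemeasurable).trans_eq ?_
        simp only [Pi.mul_apply, mul_pow]
        rw [lintegral_neg_sub (fun x => H x ^ 2) z]
    _ = (∫⁻ x, F x ^ 2 * ∫⁻ z, K x (-x - z) z ^ 2 ∂μ ∂μ) * ∫⁻ x, H x ^ 2 ∂μ := by
        have hj : Measurable fun p : G × G => F p.1 ^ 2 * K p.1 (-p.1 - p.2) p.2 ^ 2 :=
          ((hF.comp measurable_fst).pow_const 2).mul (hK.pow_const 2)
        rw [lintegral_mul_const _ hj.lintegral_prod_left', lintegral_lintegral_swap]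
        · congr 1
          refine lintegral_congr fun x => ?_
          dsimp only
          rw [lintegral_const_mul]
          exact (hK.comp (measurable_const.prodMk measurable_id)).pow_const 2
        · exact (hj.comp measurable_swap).aemeasurable
    _ ≤ (∫⁻ x, F x ^ 2 * C ∂μ) * ∫⁻ x, H x ^ 2 ∂μ := by
        gcongr with x
        refine (lintegral_congr fun z => ?_).trans_le (h x)
        rw [show -x - z = -z - x by abel]
    _ = _ := by rw [lintegral_mul_const _ (hF.pow_const 2)]; ring

/-- With z frozen, Cauchy-Schwarz pairs F·H against K. The other two cases attach the kernel to the
input whose variable is frozen, and they exchange under swapping the inputs. -/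
theorem IsSchurKernel.lintegral_trilinearOp_sq_le {K : G → G → G → ℝ≥0∞} {C : ℝ≥0∞}
    (h : IsSchurKernel μ K C) {F H : G → ℝ≥0∞} (hF : Measurable F) (hH : Measurable H) :
    ∫⁻ z, trilinearOp μ K F H z ^ 2 ∂μ ≤ C * ((∫⁻ x, F x ^ 2 ∂μ) * ∫⁻ x, H x ^ 2 ∂μ) := by
  obtain ⟨hm, h | h | h⟩ := h
  · have hK := measurable_kernel_shift hm
    calc ∫⁻ z, trilinearOp μ K F H z ^ 2 ∂μ
        ≤ ∫⁻ z, (∫⁻ x, F x ^ 2 * H (-x - z) ^ 2 ∂μ) * C ∂μ := by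
          refine lintegral_mono fun z => ?_
          have h1 : Measurable fun x => K x (-x - z) z :=
            hK.comp (measurable_id.prodMk measurable_const)
          have h2 : Measurable fun x => F x * H (-x - z) :=
            (measurable_mul_shift hF hH).comp (measurable_id.prodMk measurable_const)
          refine (lintegral_mul_sq_le h2.aemeasurable h1.aemeasurable).trans ?_
          simp only [mul_pow]
          gcongr
          exact h z
      _ = _ := by
          rw [lintegral_mul_const, lintegral_lintegral_mul_shift (hF.pow_const 2) (hH.pow_const 2),
            mul_comm]
          exact (measurable_mul_shift (hF.pow_const 2) (hH.pow_const 2)).lintegral_prod_left'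
  · exact lintegral_trilinearOp_sq_le_of_snd hm h hF hH
  · have := lintegral_trilinearOp_sq_le_of_snd (μ := μ) (K := fun x y z => K y x z) (C := C)
      (hm.comp (f := fun p : G × G × G => (p.2.1, p.1, p.2.2)) (by fun_prop)) h hH hF
    simp_rw [trilinearOp_swap] at this
    rwa [mul_comm (∫⁻ x, H x ^ 2 ∂μ)] at this

end Schur


/-! ### One-variable power integrals. -/

/-- The function `t^(-a) * max(t, R)^(-b)`. -/
noncomputable def doublePower (a b : ℝ) (R t : ℝ≥0∞) : ℝ≥0∞ := t ^ (-a) * (max t R) ^ (-b)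

theorem ennreal_rpow_neg_antitone {a : ℝ} (ha : 0 ≤ a) : Antitone fun t : ℝ≥0∞ => t ^ (-a) :=
  fun s t h => by
    simp only [ENNReal.rpow_neg]
    exact ENNReal.inv_le_inv.2 (ENNReal.rpow_le_rpow h ha)

theorem doublePower_antitone {a b : ℝ} (ha : 0 ≤ a) (hb : 0 ≤ b) (R : ℝ≥0∞) :
    Antitone (doublePower a b R) := fun _ _ h =>
  mul_le_mul' (ennreal_rpow_neg_antitone ha h)
    (ennreal_rpow_neg_antitone hb (max_le_max_right R h))

theorem doublePower_mul {a b : ℝ} {R : ℝ≥0∞} (hR : R ≠ 0) (hR' : R ≠ ∞) (t : ℝ≥0∞) :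
    doublePower a b R (R * t) = R ^ (-a - b) * doublePower a b 1 t := by
  unfold doublePower
  have e : max (R * t) R = R * max t 1 := by
    rw [mul_max, mul_one]
  have h1 : max t 1 ≠ 0 := (lt_of_lt_of_le zero_lt_one (le_max_right t 1)).ne'
  rw [e, ENNReal.mul_rpow_of_ne_zero hR h1, sub_eq_add_neg, ENNReal.rpow_add _ _ hR hR']
  -- At t = 0 the power 0^(-a) is 0, 1 or ∞ according to the sign of a, so each sign is treated by
  -- hand.
  rcases eq_or_ne t 0 with rfl | ht
  · rcases lt_trichotomy a 0 with ha | rfl | ha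
    · simp [ENNReal.zero_rpow_of_pos (neg_pos.2 ha)]
    · simp
    · have : (R ^ (-a) * R ^ (-b)) ≠ 0 := by
        rw [← ENNReal.rpow_add _ _ hR hR']
        exact (ENNReal.rpow_pos (pos_iff_ne_zero.2 hR) hR').ne'
      have h2 : R ^ (-b) ≠ 0 := (ENNReal.rpow_pos (pos_iff_ne_zero.2 hR) hR').ne'
      simp [ENNReal.zero_rpow_of_neg (neg_lt_zero.2 ha), ENNReal.top_mul, ENNReal.mul_top, h2, this]
  · rw [ENNReal.mul_rpow_of_ne_zero hR ht]; ring

theorem lintegral_abs_le (g : ℝ → ℝ≥0∞) (hg : Measurable g) :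
    ∫⁻ y, g |y| ≤ 2 * ∫⁻ y in Set.Ioi 0, g y := by
  set u : ℝ → ℝ≥0∞ := (Set.Ici 0).indicator g with hu
  have hum : Measurable u := hg.indicator measurableSet_Ici
  calc ∫⁻ y, g |y| ≤ ∫⁻ y, (u y + u (-y)) := by
        refine lintegral_mono fun y => ?_
        rcases le_total 0 y with h | h
        · simp [hu, abs_of_nonneg h, Set.indicator_of_mem (Set.mem_Ici.2 h)]
        · simp [hu, abs_of_nonpos h, Set.indicator_of_mem (Set.mem_Ici.2 (neg_nonneg.2 h))]
    _ = 2 * ∫⁻ y, u y := by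
        rw [lintegral_add_left hum, lintegral_neg_eq_self, two_mul]
    _ = 2 * ∫⁻ y in Set.Ioi 0, g y := by
        rw [hu, lintegral_indicator measurableSet_Ici, setLIntegral_congr Ioi_ae_eq_Ici.symm]

/-- Near 0 the integrand is t^(-a), integrable as a < 1; beyond 1 it is t^(-a-b), integrable as a +
b > 1. -/
theorem lintegral_doublePower_lt_top {a b : ℝ} (ha : a < 1) (hab : 1 < a + b) :
    ∫⁻ y : ℝ, doublePower a b 1 (ENNReal.ofReal |y|) < ∞ := by
  have hm : Measurable fun y : ℝ => doublePower a b 1 (ENNReal.ofReal y) := by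
    unfold doublePower; fun_prop
  refine (lintegral_abs_le _ hm).trans_lt (ENNReal.mul_lt_top (by simp) ?_)
  rw [← Set.Ioc_union_Ioi_eq_Ioi (zero_le_one' ℝ),
    lintegral_union measurableSet_Ioi (Set.Ioc_disjoint_Ioi le_rfl)]
  refine ENNReal.add_lt_top.2 ⟨?_, ?_⟩
  · have h := intervalIntegral.intervalIntegrable_rpow' (a := 0) (b := 1) (r := -a) (by linarith)
    rw [intervalIntegrable_iff_integrableOn_Ioc_of_le zero_le_one] at h
    refine lt_of_le_of_lt ?_ h.lintegral_lt_top
    refine setLIntegral_mono_ae (by fun_prop) (Filter.Eventually.of_forall fun y hy => ?_)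
    unfold doublePower
    rw [max_eq_right (by simpa using hy.2), ENNReal.one_rpow, mul_one,
      ENNReal.ofReal_rpow_of_pos hy.1]
  · have h := integrableOn_Ioi_rpow_of_lt (a := -(a + b)) (c := 1) (by linarith) one_pos
    refine lt_of_le_of_lt ?_ h.lintegral_lt_top
    refine setLIntegral_mono_ae (by fun_prop) (Filter.Eventually.of_forall fun y hy => ?_)
    have hy0 : 0 < y := one_pos.trans hy
    unfold doublePower
    rw [max_eq_left (by simpa using (le_of_lt hy)), ← ENNReal.rpow_add _ _ (by simpa using hy0)
      ENNReal.ofReal_ne_top, ENNReal.ofReal_rpow_of_pos hy0, neg_add]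

/-- Substituting y ↦ (R/c)y and using homogeneity of degree -a-b reduces every R to R = 1; the
Jacobian supplies the extra power of R. -/
theorem lintegral_doublePower_scale (a b : ℝ) {c R : ℝ} (hc : 0 < c) (hR : 0 < R) :
    ∫⁻ y : ℝ, doublePower a b (ENNReal.ofReal R) (ENNReal.ofReal (c * |y|)) =
      ENNReal.ofReal c⁻¹ * ENNReal.ofReal R ^ (1 - a - b) *
        ∫⁻ y : ℝ, doublePower a b 1 (ENNReal.ofReal |y|) := by
  have hq : 0 < R / c := div_pos hR hc
  have hR0 : ENNReal.ofReal R ≠ 0 := by simpa using hR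
  have hm : Measurable fun y : ℝ => doublePower a b (ENNReal.ofReal R) (ENNReal.ofReal (c * |y|)) := by
    unfold doublePower; fun_prop
  conv_lhs => rw [← Real.smul_map_volume_mul_left hq.ne']
  rw [lintegral_smul_measure, lintegral_map hm (by fun_prop), abs_of_pos hq]
  have : ∀ y : ℝ, doublePower a b (ENNReal.ofReal R) (ENNReal.ofReal (c * |R / c * y|)) =
      ENNReal.ofReal R ^ (-a - b) * doublePower a b 1 (ENNReal.ofReal |y|) := fun y => by
    rw [← doublePower_mul hR0 ENNReal.ofReal_ne_top, ← ENNReal.ofReal_mul hR.le, abs_mul,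
      abs_of_pos hq]
    congr 2; field_simp
  simp_rw [this]
  rw [lintegral_const_mul _ (by unfold doublePower; fun_prop), smul_eq_mul, ← mul_assoc]
  congr 1
  rw [show 1 - a - b = 1 + (-a - b) by ring, ENNReal.rpow_add _ _ hR0 ENNReal.ofReal_ne_top,
    ENNReal.rpow_one, div_eq_mul_inv, mul_comm R, ENNReal.ofReal_mul (inv_nonneg.2 hc.le), mul_assoc]

theorem one_le_jap (z : ℂ) : 1 ≤ jap z := by
  unfold jap; rw [Real.one_le_sqrt]; nlinarith [sq_nonneg ‖z‖]

theorem jap_pos (z : ℂ) : 0 < jap z := one_pos.trans_le (one_le_jap z)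

theorem norm_le_jap (z : ℂ) : ‖z‖ ≤ jap z :=
  Real.le_sqrt_of_sq_le (by linarith)

theorem jap_le_add {x y z : ℂ} (h : ‖z‖ ≤ ‖x‖ + ‖y‖) : jap z ≤ jap x + jap y := by
  have hx := norm_le_jap x
  have hy := norm_le_jap y
  have hx1 := jap_pos x
  have hy1 := jap_pos y
  have ex : jap x ^ 2 = 1 + ‖x‖ ^ 2 := Real.sq_sqrt (by positivity)
  have ey : jap y ^ 2 = 1 + ‖y‖ ^ 2 := Real.sq_sqrt (by positivity)
  refine Real.sqrt_le_iff.2 ⟨by positivity, ?_⟩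
  have h2 := pow_le_pow_left₀ (norm_nonneg z) h 2
  have h3 : ‖x‖ * ‖y‖ ≤ jap x * jap y := by gcongr
  nlinarith

/-! ### The discrete symbol `dTau` and its modulation on the frequency circle. -/

section Circle

variable {τ : ℝ} [hτ : Fact (0 < τ)]

omit hτ in
@[fun_prop]
theorem continuous_dTau : Continuous (dTau τ) := by
  unfold dTau; fun_prop

@[fun_prop]
theorem continuous_jap : Continuous jap := by
  unfold jap; fun_prop

theorem norm_fourier_apply {T : ℝ} [Fact (0 < T)] (n : ℤ) (x : AddCircle T) : ‖fourier n x‖ = 1 := by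
  rw [fourier_apply, Circle.norm_coe]

/-- From e^{i(a+b)} - 1 = e^{ia}(e^{ib} - 1) + (e^{ia} - 1). This subadditivity lets |d_τ| play the
role of an absolute value on the circle. -/
theorem norm_dTau_add_le (σ ρ : FreqCircle τ) : ‖dTau τ (σ + ρ)‖ ≤ ‖dTau τ σ‖ + ‖dTau τ ρ‖ := by
  unfold dTau
  simp only [norm_div]
  rw [← add_div]
  gcongr
  have h1 : fourier 1 (σ + ρ) = fourier 1 σ * fourier 1 ρ := by
    simp [AddCircle.toCircle_add]
  rw [h1]
  calc ‖fourier 1 σ * fourier 1 ρ - 1‖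
      = ‖fourier 1 σ * (fourier 1 ρ - 1) + (fourier 1 σ - 1)‖ := by ring_nf
    _ ≤ ‖fourier 1 σ * (fourier 1 ρ - 1)‖ + ‖fourier 1 σ - 1‖ := norm_add_le _ _
    _ = _ := by rw [norm_mul, norm_fourier_apply, one_mul, add_comm]

omit hτ in
theorem norm_dTau_neg (σ : FreqCircle τ) : ‖dTau τ (-σ)‖ = ‖dTau τ σ‖ := by
  unfold dTau
  simp only [norm_div]
  congr 1
  have h1 : fourier 1 (-σ) = (starRingEnd ℂ) (fourier 1 σ) := by
    rw [← fourier_neg]; simp [fourier_apply]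
  rw [h1, ← Complex.norm_conj]
  simp

/-- |e^{iθ} - 1| = 2|sin(θ/2)|, and Jordan's inequality |sin t| ≥ 2|t|/π applies since |τσ/2| ≤ π/2
on the fundamental domain. -/
theorem norm_le_norm_dTau (σ : FreqCircle τ) : 2 / π * ‖σ‖ ≤ ‖dTau τ σ‖ := by
  have h0 := hτ.out
  have hπ := Real.pi_pos
  obtain ⟨x, hx, rfl⟩ := AddCircle.coe_image_Icc_eq (2 * π / τ) (-(π / τ)) ▸ Set.mem_univ σ
  have hxa : |x| ≤ π / τ := by
    rw [abs_le]; refine ⟨hx.1, hx.2.trans_eq ?_⟩; field_simp; ring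
  have hn : ‖(x : FreqCircle τ)‖ = |x| := by
    have hT : 0 < 2 * π / τ := by positivity
    rw [AddCircle.norm_coe_eq_abs_iff _ hT.ne', abs_of_pos hT]
    refine hxa.trans_eq ?_; field_simp
  have h2 : |τ * x / 2| ≤ π / 2 := by
    rw [abs_div, abs_mul, abs_of_pos h0, abs_two]
    rw [le_div_iff₀ h0] at hxa
    linarith
  have h3 := Real.mul_abs_le_abs_sin h2
  have e : (fourier 1 (x : FreqCircle τ)) = Complex.exp (Complex.I * ((τ * x : ℝ) : ℂ)) := by
    rw [fourier_coe_apply]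
    congr 1
    push_cast
    have : (τ : ℂ) ≠ 0 := by exact_mod_cast h0.ne'
    have : (π : ℂ) ≠ 0 := by exact_mod_cast hπ.ne'
    field_simp
  rw [hn]
  unfold dTau
  rw [e, norm_div, Complex.norm_exp_I_mul_ofReal_sub_one, Complex.norm_real, Real.norm_of_nonneg h0.le,
    le_div_iff₀ h0, norm_mul, Real.norm_two, Real.norm_eq_abs]
  rw [abs_div, abs_mul, abs_of_pos h0, abs_two] at h3
  calc 2 / π * |x| * τ = 2 * (2 / π * (τ * |x| / 2)) := by ring
    _ ≤ _ := by gcongr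

/-- The modulation weight `⟨d_τ(σ)⟩`, with values in `[0, ∞]`. -/
noncomputable def modulation (τ : ℝ) (σ : FreqCircle τ) : ℝ≥0∞ := ENNReal.ofReal (jap (dTau τ σ))

omit hτ in
@[fun_prop]
theorem continuous_modulation : Continuous (modulation τ) := by
  exact ENNReal.continuous_ofReal.comp (by fun_prop)

omit hτ in
theorem one_le_modulation (σ : FreqCircle τ) : 1 ≤ modulation τ σ := by
  simpa [modulation] using one_le_jap _

omit hτ in
theorem modulation_ne_top (σ : FreqCircle τ) : modulation τ σ ≠ ∞ := ENNReal.ofReal_ne_top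

omit hτ in
theorem modulation_ne_zero (σ : FreqCircle τ) : modulation τ σ ≠ 0 :=
  (zero_lt_one.trans_le (one_le_modulation σ)).ne'

omit hτ in
theorem modulation_neg (σ : FreqCircle τ) : modulation τ (-σ) = modulation τ σ := by
  unfold modulation jap; rw [norm_dTau_neg]

theorem modulation_add_le (σ ρ : FreqCircle τ) :
    modulation τ (σ + ρ) ≤ modulation τ σ + modulation τ ρ := by
  unfold modulation
  rw [← ENNReal.ofReal_add (jap_pos _).le (jap_pos _).le]
  exact ENNReal.ofReal_le_ofReal (jap_le_add (norm_dTau_add_le σ ρ))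

theorem ofReal_norm_le_modulation (σ : FreqCircle τ) :
    ENNReal.ofReal (2 / π * ‖σ‖) ≤ modulation τ σ :=
  ENNReal.ofReal_le_ofReal ((norm_le_norm_dTau σ).trans (norm_le_jap _))

/-- Unfolding the circle to (-π/τ, π/τ] and then enlarging to the whole line is what makes the later
integrals uniform in τ. -/
theorem lintegral_circle_norm_le (g : ℝ → ℝ≥0∞) :
    ∫⁻ σ : FreqCircle τ, g ‖σ‖ ≤ ∫⁻ x : ℝ, g |x| := by
  have h0 := hτ.out
  rw [← AddCircle.lintegral_preimage (2 * π / τ) (-(π / τ))]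
  refine le_trans (le_of_eq (setLIntegral_congr_fun measurableSet_Ioc fun x hx => ?_))
    (setLIntegral_le_lintegral _ _)
  have hxa : |x| ≤ π / τ := by
    rw [abs_le]; refine ⟨hx.1.le, hx.2.trans_eq ?_⟩; field_simp; ring
  have hn : ‖(x : FreqCircle τ)‖ = |x| := by
    have hT : 0 < 2 * π / τ := by positivity
    rw [AddCircle.norm_coe_eq_abs_iff _ hT.ne', abs_of_pos hT]
    refine hxa.trans_eq ?_; field_simp
  simp only [hn]

/-- `∫ ⟨d_τ(σ)⟩^(-a) max(⟨d_τ(σ)⟩, R)^(-b) dσ ≤ C R^(1-a-b)`, uniformly in `τ`. -/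
theorem exists_lintegral_modulation_le {a b : ℝ} (ha0 : 0 ≤ a) (hb0 : 0 ≤ b) (ha : a < 1)
    (hab : 1 < a + b) : ∃ C : ℝ≥0∞, C ≠ ∞ ∧ ∀ (τ : ℝ) [Fact (0 < τ)] (R : ℝ≥0∞), R ≠ 0 → R ≠ ∞ →
      ∫⁻ σ : FreqCircle τ, doublePower a b R (modulation τ σ) ≤ C * R ^ (1 - a - b) := by
  refine ⟨ENNReal.ofReal (2 / π)⁻¹ * ∫⁻ y : ℝ, doublePower a b 1 (ENNReal.ofReal |y|),
    ENNReal.mul_ne_top ENNReal.ofReal_ne_top (lintegral_doublePower_lt_top ha hab).ne, ?_⟩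
  intro τ _ R hR hR'
  lift R to NNReal using hR'
  have hRpos : (0 : ℝ) < R := by simpa [pos_iff_ne_zero] using hR
  have hc : (0 : ℝ) < 2 / π := by positivity
  have hRR : ((R : NNReal) : ℝ≥0∞) = ENNReal.ofReal (R : ℝ) := by simp
  rw [hRR]
  calc ∫⁻ σ : FreqCircle τ, doublePower a b (ENNReal.ofReal R) (modulation τ σ)
      ≤ ∫⁻ σ : FreqCircle τ, doublePower a b (ENNReal.ofReal R) (ENNReal.ofReal (2 / π * ‖σ‖)) :=
        lintegral_mono fun σ => doublePower_antitone ha0 hb0 _ (ofReal_norm_le_modulation σ)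
    _ ≤ ∫⁻ x : ℝ, doublePower a b (ENNReal.ofReal R) (ENNReal.ofReal (2 / π * |x|)) :=
        lintegral_circle_norm_le
          fun r => doublePower a b (ENNReal.ofReal R) (ENNReal.ofReal (2 / π * r))
    _ = _ := by rw [lintegral_doublePower_scale a b hc hRpos]; ring

end Circle


/-! ### Counting integers near the roots of the resonance function. -/

theorem sum_rpow_neg_two_thirds_le (N : ℕ) :
    ∑ n ∈ Finset.range N, ((n : ℝ) + 1) ^ (-(2 / 3) : ℝ) ≤ 3 * (N : ℝ) ^ (1 / 3 : ℝ) := by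
  induction N with
  | zero => simp [Real.zero_rpow]
  | succ N ih =>
    rw [Finset.sum_range_succ]
    set a : ℝ := ((N : ℝ) + 1) ^ (1 / 3 : ℝ) with ha
    set b : ℝ := (N : ℝ) ^ (1 / 3 : ℝ) with hb
    have hN : (0 : ℝ) < (N : ℝ) + 1 := by positivity
    have ha0 : 0 < a := by positivity
    have hb0 : 0 ≤ b := by positivity
    have ha3 : a ^ 3 = N + 1 := by
      rw [ha, ← Real.rpow_natCast, ← Real.rpow_mul hN.le]; norm_num
    have hb3 : b ^ 3 = N := by
      rw [hb, ← Real.rpow_natCast, ← Real.rpow_mul (by positivity)]; norm_num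
    have hab : b ≤ a := by
      rw [ha, hb]; exact Real.rpow_le_rpow (by positivity) (by linarith) (by norm_num)
    have e : ((N : ℝ) + 1) ^ (-(2 / 3) : ℝ) = (a ^ 2)⁻¹ := by
      rw [ha, ← Real.rpow_natCast, ← Real.rpow_mul hN.le, ← Real.rpow_neg hN.le]; norm_num
    rw [e]
    push_cast
    -- The sum telescopes in cube roots: 1 = a³ - b³ = (a - b)(a² + ab + b²) ≤ 3(a - b)a².
    have h1 : 1 ≤ 3 * (a - b) * a ^ 2 := by
      have : a ^ 3 - b ^ 3 = 1 := by rw [ha3, hb3]; ring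
      nlinarith [mul_nonneg (sub_nonneg.2 hab) hb0, mul_nonneg (sub_nonneg.2 hab) ha0.le,
        mul_nonneg (mul_nonneg (sub_nonneg.2 hab) hb0) (sub_nonneg.2 hab),
        mul_nonneg (mul_nonneg (sub_nonneg.2 hab) ha0.le) (sub_nonneg.2 hab)]
    have h2 : (a ^ 2)⁻¹ ≤ 3 * (a - b) := by
      rw [inv_le_iff_one_le_mul₀ (by positivity)]; exact h1
    linarith

theorem tsum_int_natAbs (g : ℕ → ℝ≥0∞) :
    ∑' j : ℤ, g j.natAbs = ∑' n : ℕ, g n + ∑' n : ℕ, g (n + 1) := by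
  have e : ∀ n : ℕ, (-(n + 1 : ℤ)).natAbs = n + 1 := fun n => by omega
  have h1 : HasSum (fun n : ℕ => g ((n : ℤ).natAbs)) (∑' n : ℕ, g n) := by
    simp only [Int.natAbs_natCast]
    exact ENNReal.summable.hasSum
  have h2 : HasSum (fun n : ℕ => g ((-(n + 1 : ℤ)).natAbs)) (∑' n : ℕ, g (n + 1)) := by
    simp only [e]
    exact ENNReal.summable.hasSum
  exact (HasSum.of_nat_of_neg_add_one (f := fun j : ℤ => g j.natAbs) h1 h2).tsum_eq

theorem tsum_int_natAbs_le (g : ℕ → ℝ≥0∞) :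
    ∑' j : ℤ, g j.natAbs ≤ g 0 + 2 * ∑' n : ℕ, g (n + 1) := by
  rw [tsum_int_natAbs, tsum_eq_zero_add' (f := g) ENNReal.summable, two_mul, add_assoc]

/-- A truncated sum of `max(1, 3K(n-ρ)²)^(-1/3)` is bounded uniformly in `K` and `ρ`. -/
theorem tsum_quadratic_le {K : ℕ} (hK : 1 ≤ K) (ρ : ℝ) :
    ∑' n : ℤ, (if 3 * K * ((n : ℝ) - ρ) ^ 2 ≤ 4 * (K : ℝ) ^ 3 then
      ENNReal.ofReal ((max 1 (3 * K * ((n : ℝ) - ρ) ^ 2)) ^ (-(1 / 3) : ℝ)) else 0) ≤ 13 := by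
  have hK' : (1 : ℝ) ≤ K := by exact_mod_cast hK
  have hK0 : (0 : ℝ) < K := by linarith
  -- Recentring at the integer nearest to ρ, n = round ρ + j satisfies |j| ≤ 2|n - ρ|, which turns
  -- 3K into 3K/4. The cutoff (3/4)Kj² ≤ 4K³ then implies |j| ≤ 4K.
  set g : ℕ → ℝ≥0∞ := fun j => if j ≤ 4 * K then
    ENNReal.ofReal ((max 1 (3 / 4 * K * (j : ℝ) ^ 2)) ^ (-(1 / 3) : ℝ)) else 0 with hg
  calc _ ≤ ∑' j : ℤ, g j.natAbs := by
        set F : ℤ → ℝ≥0∞ := fun n => if 3 * K * ((n : ℝ) - ρ) ^ 2 ≤ 4 * (K : ℝ) ^ 3 then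
          ENNReal.ofReal ((max 1 (3 * K * ((n : ℝ) - ρ) ^ 2)) ^ (-(1 / 3) : ℝ)) else 0 with hF
        rw [← (Equiv.addLeft (round ρ)).tsum_eq F]
        refine ENNReal.tsum_le_tsum fun j => ?_
        have hj : (3 / 4 * K * ((j.natAbs : ℕ) : ℝ) ^ 2) ≤
            3 * K * (((round ρ + j : ℤ) : ℝ) - ρ) ^ 2 := by
          have e : ((j.natAbs : ℕ) : ℝ) = |(j : ℝ)| := by simp
          rw [e, sq_abs]
          have h1 : |ρ - round ρ| ≤ 1 / 2 := abs_sub_round ρ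
          have h2 : (j : ℝ) ^ 2 ≤ 4 * ((j : ℝ) - (ρ - round ρ)) ^ 2 := by
            rcases eq_or_ne j 0 with rfl | hj
            · simp; positivity
            · have h3 : (1 : ℝ) ≤ |(j : ℝ)| := by exact_mod_cast Int.one_le_abs hj
              have h4 : |(j : ℝ)| ≤ 2 * |(j : ℝ) - (ρ - round ρ)| := by
                have := abs_sub_abs_le_abs_sub (j : ℝ) (ρ - round ρ)
                linarith
              have := pow_le_pow_left₀ (abs_nonneg _) h4 2
              rw [mul_pow, sq_abs, sq_abs] at this
              linarith
          push_cast
          nlinarith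
        change F (round ρ + j) ≤ _
        by_cases h1 : 3 * K * (((round ρ + j : ℤ) : ℝ) - ρ) ^ 2 ≤ 4 * (K : ℝ) ^ 3
        · have h2 : j.natAbs ≤ 4 * K := by
            have h4 : (j.natAbs : ℝ) ^ 2 ≤ (4 * K) ^ 2 := by
              have : (j.natAbs : ℝ) ^ 2 * K ≤ (4 * K) ^ 2 * K := by
                nlinarith [pow_pos hK0 3, hj.trans h1]
              exact le_of_mul_le_mul_right this hK0
            exact_mod_cast (abs_le_of_sq_le_sq' h4 (by positivity)).2
          simp only [hF, hg, if_pos h1, if_pos h2]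
          refine ENNReal.ofReal_le_ofReal ?_
          exact Real.rpow_le_rpow_of_nonpos (by positivity) (max_le_max_left 1 hj) (by norm_num)
        · simp only [hF, if_neg h1]; exact zero_le
    _ ≤ g 0 + 2 * ∑' n : ℕ, g (n + 1) := tsum_int_natAbs_le g
    _ ≤ 1 + 2 * 6 := by
        gcongr
        · simp [hg]
        · rw [tsum_eq_sum (s := Finset.range (4 * K))]
          · calc ∑ n ∈ Finset.range (4 * K), g (n + 1)
                ≤ ∑ n ∈ Finset.range (4 * K), ENNReal.ofReal
                  ((3 / 4 * K) ^ (-(1 / 3) : ℝ) * ((n : ℝ) + 1) ^ (-(2 / 3) : ℝ)) := by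
                  refine Finset.sum_le_sum fun n hn => ?_
                  simp only [hg]
                  split_ifs
                  · refine ENNReal.ofReal_le_ofReal ?_
                    have hn0 : (0 : ℝ) < (n : ℝ) + 1 := by positivity
                    have e : ((n : ℝ) + 1) ^ (-(2 / 3) : ℝ) = (((n : ℝ) + 1) ^ 2) ^ (-(1 / 3) : ℝ) := by
                      rw [← Real.rpow_natCast, ← Real.rpow_mul hn0.le]; norm_num
                    rw [e, ← Real.mul_rpow (by positivity) (by positivity)]
                    push_cast
                    exact Real.rpow_le_rpow_of_nonpos (by positivity) (le_max_right _ _) (by norm_num)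
                  · exact zero_le
              _ = ENNReal.ofReal (∑ n ∈ Finset.range (4 * K),
                  ((3 / 4 * K) ^ (-(1 / 3) : ℝ) * ((n : ℝ) + 1) ^ (-(2 / 3) : ℝ))) := by
                  rw [ENNReal.ofReal_sum_of_nonneg]
                  intro n _; positivity
              _ ≤ ENNReal.ofReal 6 := by
                  refine ENNReal.ofReal_le_ofReal ?_
                  rw [← Finset.mul_sum]
                  have h1 := sum_rpow_neg_two_thirds_le (4 * K)
                  push_cast at h1
                  -- The powers of K cancel because only |j| ≤ 4K contribute; what remains is
                  -- (16/3)^(1/3) ≤ 8^(1/3).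
                  have h2 : (3 / 4 * (K : ℝ)) ^ (-(1 / 3) : ℝ) * (4 * (K : ℝ)) ^ (1 / 3 : ℝ) ≤ 2 := by
                    have e : (3 / 4 * (K : ℝ)) ^ (-(1 / 3) : ℝ) = ((3 / 4 * (K : ℝ))⁻¹) ^ (1 / 3 : ℝ) := by
                      rw [Real.rpow_neg (by positivity), Real.inv_rpow (by positivity)]
                    rw [e, ← Real.mul_rpow (by positivity) (by positivity)]
                    have e2 : (3 / 4 * (K : ℝ))⁻¹ * (4 * K) = 16 / 3 := by field_simp; norm_num
                    rw [e2]
                    calc ((16 : ℝ) / 3) ^ (1 / 3 : ℝ) ≤ ((2 : ℝ) ^ (3 : ℝ)) ^ (1 / 3 : ℝ) := by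
                          gcongr; norm_num
                      _ = 2 := by rw [← Real.rpow_mul (by norm_num)]; norm_num
                  calc _ ≤ (3 / 4 * (K : ℝ)) ^ (-(1 / 3) : ℝ) * (3 * (4 * (K : ℝ)) ^ (1 / 3 : ℝ)) := by
                        gcongr
                    _ ≤ 6 := by linarith
              _ = 6 := by norm_num
          · intro n hn
            have : ¬ (n + 1 ≤ 4 * K) := by simpa using hn
            simp [hg, this]
    _ = 13 := by norm_num

/-- A quadratic polynomial is bounded below by squared distances to at most two points. -/
theorem exists_quadratic_lower_bound {k : ℤ} (hk : k ≠ 0) (c : ℝ) : ∃ ρ₁ ρ₂ : ℝ, ∀ n : ℤ,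
    3 * (k.natAbs : ℝ) * ((n : ℝ) - ρ₁) ^ 2 ≤ |3 * k * n * (n + k) + c| ∨
    3 * (k.natAbs : ℝ) * ((n : ℝ) - ρ₂) ^ 2 ≤ |3 * k * n * (n + k) + c| := by
  have hk' : (k : ℝ) ≠ 0 := by exact_mod_cast hk
  -- Completing the square at m = n + k/2 leaves m² - D. For D ≥ 0 the factor vanishing at the root
  -- on the other side of 0 is at least as large as the factor at the root on the side of m. For D ≤
  -- 0 both centres are -k/2, as `√D = 0`.
  set D : ℝ := k ^ 2 / 4 - c / (3 * k) with hD
  have key : ∀ n : ℤ, |3 * (k : ℝ) * n * (n + k) + c| =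
      3 * (k.natAbs : ℝ) * |((n : ℝ) + k / 2) ^ 2 - D| := fun n => by
    have e : (3 * (k : ℝ) * n * (n + k) + c) = 3 * k * (((n : ℝ) + k / 2) ^ 2 - D) := by
      rw [hD]; field_simp; ring
    rw [e, abs_mul, abs_mul]; simp
  refine ⟨-k / 2 + √D, -k / 2 - √D, fun n => ?_⟩
  rw [key]
  set m : ℝ := (n : ℝ) + k / 2 with hm
  have e1 : (n : ℝ) - (-k / 2 + √D) = m - √D := by rw [hm]; ring
  have e2 : (n : ℝ) - (-k / 2 - √D) = m + √D := by rw [hm]; ring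
  rw [e1, e2]
  have h0 : 0 ≤ √D := Real.sqrt_nonneg D
  rcases le_total 0 D with h | h
  · have hs : √D ^ 2 = D := Real.sq_sqrt h
    have e : m ^ 2 - D = (m - √D) * (m + √D) := by nlinarith
    rw [e, abs_mul]
    rcases le_total 0 m with h1 | h1
    · left
      gcongr
      rw [← sq_abs, sq]
      gcongr ?_ * ?_
      rw [abs_of_nonneg (by positivity : 0 ≤ m + √D)]
      exact abs_le.2 ⟨by linarith, by linarith⟩
    · right
      gcongr
      rw [← sq_abs, sq]
      gcongr ?_ * ?_
      rw [abs_of_nonpos (by linarith : m - √D ≤ 0)]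
      exact abs_le.2 ⟨by linarith, by linarith⟩
  · left
    rw [Real.sqrt_eq_zero_of_nonpos h, sub_zero]
    gcongr
    refine le_trans ?_ (le_abs_self _)
    linarith

/-- Each n is charged to one of two centres, near which the quadratic grows like 3|k|(n - ρ)². The
truncation at |k|³ keeps n within O(|k|) of a centre, and summing (|k|j²)^(-1/3) over that range
gives O(1), uniformly in c. -/
theorem tsum_cubic_resonance_le {k : ℤ} (hk : k ≠ 0) (c : ℝ) :
    ∑' n : ℤ, (if |3 * (k : ℝ) * n * (n + k) + c| ≤ 4 * (k.natAbs : ℝ) ^ 3 then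
      ENNReal.ofReal ((max 1 |3 * (k : ℝ) * n * (n + k) + c|) ^ (-(1 / 3) : ℝ)) else 0) ≤ 26 := by
  obtain ⟨ρ₁, ρ₂, h⟩ := exists_quadratic_lower_bound hk c
  have hK : 1 ≤ k.natAbs := Nat.one_le_iff_ne_zero.2 (by simpa using hk)
  set T : ℝ → ℤ → ℝ≥0∞ := fun ρ n =>
    if 3 * (k.natAbs : ℝ) * ((n : ℝ) - ρ) ^ 2 ≤ 4 * (k.natAbs : ℝ) ^ 3 then
      ENNReal.ofReal ((max 1 (3 * (k.natAbs : ℝ) * ((n : ℝ) - ρ) ^ 2)) ^ (-(1 / 3) : ℝ)) else 0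
    with hT
  calc _ ≤ ∑' n : ℤ, (T ρ₁ n + T ρ₂ n) := by
        refine ENNReal.tsum_le_tsum fun n => ?_
        split_ifs with h1
        · have aux : ∀ ρ, 3 * (k.natAbs : ℝ) * ((n : ℝ) - ρ) ^ 2 ≤ |3 * (k : ℝ) * n * (n + k) + c| →
              ENNReal.ofReal ((max 1 |3 * (k : ℝ) * n * (n + k) + c|) ^ (-(1 / 3) : ℝ)) ≤ T ρ n := by
            intro ρ hρ
            simp only [hT]
            rw [if_pos (hρ.trans h1)]
            refine ENNReal.ofReal_le_ofReal ?_
            exact Real.rpow_le_rpow_of_nonpos (by positivity) (max_le_max_left 1 hρ) (by norm_num)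
          rcases h n with h2 | h2
          · exact (aux _ h2).trans le_self_add
          · exact (aux _ h2).trans le_add_self
        · exact zero_le
    _ ≤ 13 + 13 := by
        rw [ENNReal.tsum_add]
        exact add_le_add (tsum_quadratic_le hK ρ₁) (tsum_quadratic_le hK ρ₂)
    _ = 26 := by norm_num

/-- The number of integers `k` with `|k|³ ≤ R` is at most `3 R^(1/3)` if `R ≥ 1`. -/
theorem tsum_natAbs_cube_le {R : ℝ≥0∞} (hR : 1 ≤ R) (hR' : R ≠ ∞) :
    ∑' k : ℤ, (if (k.natAbs : ℝ≥0∞) ^ 3 ≤ R then (1 : ℝ≥0∞) else 0) ≤ 3 * R ^ (1 / 3 : ℝ) := by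
  lift R to NNReal using hR'
  have hR1 : (1 : NNReal) ≤ R := by exact_mod_cast hR
  set t : NNReal := R ^ (1 / 3 : ℝ) with ht
  have ht1 : 1 ≤ t := NNReal.one_le_rpow hR1 (by norm_num)
  have ht3 : t ^ 3 = R := by
    rw [ht, ← NNReal.rpow_natCast, ← NNReal.rpow_mul]; norm_num
  have hf : ∀ k : ℕ, ((k : ℝ≥0∞) ^ 3 ≤ (R : ℝ≥0∞)) → k ≤ ⌊t⌋₊ := fun k hk => by
    have : (k : NNReal) ^ 3 ≤ t ^ 3 := by rw [ht3]; exact_mod_cast hk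
    exact Nat.le_floor (le_of_pow_le_pow_left₀ (by norm_num) (by positivity) this)
  calc _ ≤ (if ((0 : ℕ) : ℝ≥0∞) ^ 3 ≤ R then (1 : ℝ≥0∞) else 0) +
        2 * ∑' n : ℕ, (if ((n + 1 : ℕ) : ℝ≥0∞) ^ 3 ≤ R then (1 : ℝ≥0∞) else 0) :=
        tsum_int_natAbs_le fun k => if (k : ℝ≥0∞) ^ 3 ≤ R then (1 : ℝ≥0∞) else 0
    _ ≤ 1 + 2 * (t : ℝ≥0∞) := by
        gcongr
        · simp
        · rw [tsum_eq_sum (s := Finset.range ⌊t⌋₊)]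
          · calc _ ≤ ∑ n ∈ Finset.range ⌊t⌋₊, (1 : ℝ≥0∞) :=
                  Finset.sum_le_sum fun n _ => by split_ifs <;> simp
              _ = ((⌊t⌋₊ : NNReal) : ℝ≥0∞) := by simp
              _ ≤ t := by exact_mod_cast Nat.floor_le (zero_le)
          · intro n hn
            rw [if_neg]
            intro h
            have := hf _ h
            simp at hn
            omega
    _ ≤ t + 2 * t := by gcongr; exact_mod_cast ht1
    _ = 3 * (t : ℝ≥0∞) := by ring
    _ = _ := by rw [ht, ENNReal.coe_rpow_of_nonneg _ (by norm_num)]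


/-! ### Phase space, modulations and the resonance identity. -/

/-- The dual group `ℤ × (ℝ / (2π/τ)ℤ)` of discrete space-time. -/
abbrev Phase (τ : ℝ) : Type := ℤ × FreqCircle τ

/-- The product of the counting measure and of the Lebesgue measure. -/
noncomputable abbrev phaseMeasure (τ : ℝ) [Fact (0 < τ)] : Measure (Phase τ) :=
  (Measure.count : Measure ℤ).prod volume

instance isNegInvariant_phaseMeasure (τ : ℝ) [Fact (0 < τ)] :
    (phaseMeasure τ).IsNegInvariant where
  neg_eq_self := by
    have h := ((Measure.measurePreserving_neg (Measure.count : Measure ℤ)).prod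
      (Measure.measurePreserving_neg (volume : Measure (FreqCircle τ)))).map_eq
    exact h

/-- The weight `⟨d_τ(σ + k³)⟩`, with values in `[0, ∞]`. -/
noncomputable def phaseMod (τ : ℝ) (p : Phase τ) : ℝ≥0∞ :=
  modulation τ (p.2 + (((p.1 : ℝ) ^ 3 : ℝ) : FreqCircle τ))

/-- The frequencies `k` with `|k| τ^(1/3) ≤ 1`. -/
def lowFreq (τ : ℝ) : Set ℤ := {k | |(k : ℝ)| ^ 3 * τ ≤ 1}

section Phase

variable {τ : ℝ} [hτ : Fact (0 < τ)]

omit hτ in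
theorem neg_mem_lowFreq {k : ℤ} : -k ∈ lowFreq τ ↔ k ∈ lowFreq τ := by
  simp [lowFreq]

omit hτ in
@[fun_prop]
theorem measurable_phaseMod : Measurable (phaseMod τ) := by
  refine measurable_from_prod_countable_right fun k => ?_
  exact (continuous_modulation.comp (by fun_prop)).measurable

omit hτ in
theorem one_le_phaseMod (p : Phase τ) : 1 ≤ phaseMod τ p := one_le_modulation _

omit hτ in
theorem phaseMod_ne_top (p : Phase τ) : phaseMod τ p ≠ ∞ := modulation_ne_top _

omit hτ in
theorem phaseMod_ne_zero (p : Phase τ) : phaseMod τ p ≠ 0 := modulation_ne_zero _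

omit hτ in
theorem phaseMod_neg (p : Phase τ) : phaseMod τ (-p) = phaseMod τ p := by
  unfold phaseMod
  rw [← modulation_neg]
  congr 1
  have e : (((-p).1 : ℝ) ^ 3 : ℝ) = -((p.1 : ℝ) ^ 3) := by
    simp only [Prod.fst_neg, Int.cast_neg]; ring
  rw [e, Prod.snd_neg, AddCircle.coe_neg, neg_add, neg_neg, neg_neg]

theorem lintegral_phase {f : Phase τ → ℝ≥0∞} (hf : Measurable f) :
    ∫⁻ p, f p ∂phaseMeasure τ = ∑' k : ℤ, ∫⁻ σ, f (k, σ) := by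
  rw [lintegral_prod _ hf.aemeasurable, lintegral_count]

theorem ennreal_add_sq_le (a b : ℝ≥0∞) : (a + b) ^ 2 ≤ 4 * (a ^ 2 + b ^ 2) := by
  have e : ∀ c : ℝ≥0∞, (c + c) ^ 2 = 4 * c ^ 2 := fun c => by ring
  rcases le_total a b with h | h
  · calc (a + b) ^ 2 ≤ (b + b) ^ 2 := by gcongr
      _ = 4 * b ^ 2 := e b
      _ ≤ _ := by gcongr; exact le_add_self
  · calc (a + b) ^ 2 ≤ (a + a) ^ 2 := by gcongr
      _ = 4 * a ^ 2 := e a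
      _ ≤ _ := by gcongr; exact le_self_add

theorem rpow_neg_le_two_mul {a b : ℝ≥0∞} (h : a ≤ 2 * b) {c : ℝ} (hc : 0 < c) (hc1 : c ≤ 1) :
    b ^ (-c) ≤ 2 * a ^ (-c) := by
  rcases eq_or_ne a 0 with rfl | ha
  · simp [ENNReal.zero_rpow_of_neg (neg_lt_zero.2 hc)]
  have h2 : 2⁻¹ * a ≤ b := by
    calc 2⁻¹ * a ≤ 2⁻¹ * (2 * b) := by gcongr
      _ = b := by rw [← mul_assoc, ENNReal.inv_mul_cancel (by simp) (by simp), one_mul]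
  refine (ennreal_rpow_neg_antitone hc.le h2).trans ?_
  dsimp only
  rw [ENNReal.mul_rpow_of_ne_zero (by simp) ha, ENNReal.rpow_neg, ENNReal.inv_rpow, inv_inv]
  gcongr
  calc (2 : ℝ≥0∞) ^ c ≤ 2 ^ (1 : ℝ) := ENNReal.rpow_le_rpow_of_exponent_le (by norm_num) hc1
    _ = 2 := ENNReal.rpow_one 2

/-- If s is the smaller and t the larger of a and b, then max(s, c) ≤ 2t, so t^(-2/3) can be
replaced by max(s, c)^(-2/3) up to a factor 2. -/
theorem doublePower_two_thirds_mul_le {a b c : ℝ≥0∞} (h : c ≤ a + b) :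
    a ^ (-(2 / 3) : ℝ) * b ^ (-(2 / 3) : ℝ) ≤
      2 * (doublePower (2 / 3) (2 / 3) c a + doublePower (2 / 3) (2 / 3) c b) := by
  have aux : ∀ s t : ℝ≥0∞, s ≤ t → c ≤ s + t →
      s ^ (-(2 / 3) : ℝ) * t ^ (-(2 / 3) : ℝ) ≤ 2 * doublePower (2 / 3) (2 / 3) c s := by
    intro s t hst hc
    have h1 : max s c ≤ 2 * t := by
      refine max_le (hst.trans ?_) (hc.trans ?_)
      · rw [two_mul]; exact le_self_add
      · rw [two_mul]; gcongr
    have h3 : t ^ (-(2 / 3) : ℝ) ≤ 2 * (max s c) ^ (-(2 / 3) : ℝ) :=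
      rpow_neg_le_two_mul h1 (by norm_num) (by norm_num)
    calc _ ≤ s ^ (-(2 / 3) : ℝ) * (2 * (max s c) ^ (-(2 / 3) : ℝ)) := by gcongr
      _ = _ := by unfold doublePower; ring
  rcases le_total a b with hab | hab
  · refine (aux a b hab h).trans ?_
    gcongr; exact le_self_add
  · rw [mul_comm]
    refine (aux b a hab (by rwa [add_comm])).trans ?_
    gcongr; exact le_add_self

/-- Subadditivity of the modulation splits the product into two reflected copies of one integrand;
the exponent is 1 - 2/3 - 2/3 = -1/3. -/
theorem exists_lintegral_modulation_conv_le : ∃ C : ℝ≥0∞, C ≠ ∞ ∧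
    ∀ (τ : ℝ) [Fact (0 < τ)] (η : FreqCircle τ),
      ∫⁻ s : FreqCircle τ, modulation τ s ^ (-(2 / 3) : ℝ) * modulation τ (η - s) ^ (-(2 / 3) : ℝ) ≤
        C * modulation τ η ^ (-(1 / 3) : ℝ) := by
  obtain ⟨C, hC, h⟩ := exists_lintegral_modulation_le (a := 2 / 3) (b := 2 / 3)
    (by norm_num) (by norm_num) (by norm_num) (by norm_num)
  refine ⟨4 * C, ENNReal.mul_ne_top (by simp) hC, fun τ _ η => ?_⟩
  have h1 := h τ (modulation τ η) (modulation_ne_zero η) (modulation_ne_top η)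
  have hm : Measurable fun s => doublePower (2 / 3) (2 / 3) (modulation τ η) (modulation τ s) := by
    have := continuous_modulation (τ := τ) |>.measurable
    unfold doublePower; fun_prop
  calc _ ≤ ∫⁻ s : FreqCircle τ, 2 * (doublePower (2 / 3) (2 / 3) (modulation τ η) (modulation τ s) +
        doublePower (2 / 3) (2 / 3) (modulation τ η) (modulation τ (η - s))) := by
        refine lintegral_mono fun s => doublePower_two_thirds_mul_le ?_
        simpa using modulation_add_le s (η - s)
    _ = 4 * ∫⁻ s : FreqCircle τ, doublePower (2 / 3) (2 / 3) (modulation τ η) (modulation τ s) := by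
        rw [lintegral_const_mul' _ _ (by simp), lintegral_add_left hm,
          lintegral_sub_left_eq_self
            (fun s => doublePower (2 / 3) (2 / 3) (modulation τ η) (modulation τ s)) η]
        ring
    _ ≤ 4 * (C * modulation τ η ^ (1 - 2 / 3 - 2 / 3 : ℝ)) := by gcongr
    _ = _ := by rw [mul_assoc]; norm_num

/-- On the region where the modulation is at most R the maximum in `doublePower` equals R, so the
integrand is R^(2/3) times a double power already controlled. -/
theorem exists_lintegral_modulation_le_of_le : ∃ C : ℝ≥0∞, C ≠ ∞ ∧
    ∀ (τ : ℝ) [Fact (0 < τ)] (R : ℝ≥0∞), R ≠ 0 → R ≠ ∞ →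
      ∫⁻ s : FreqCircle τ, (if modulation τ s ≤ R then modulation τ s ^ (-(2 / 3) : ℝ) else 0) ≤
        C * R ^ (1 / 3 : ℝ) := by
  obtain ⟨C, hC, h⟩ := exists_lintegral_modulation_le (a := 2 / 3) (b := 2 / 3)
    (by norm_num) (by norm_num) (by norm_num) (by norm_num)
  refine ⟨C, hC, fun τ _ R hR hR' => ?_⟩
  calc _ ≤ ∫⁻ s : FreqCircle τ, R ^ (2 / 3 : ℝ) * doublePower (2 / 3) (2 / 3) R (modulation τ s) := by
        refine lintegral_mono fun s => ?_
        dsimp only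
        split_ifs with hs
        · unfold doublePower
          rw [max_eq_right hs, mul_comm, mul_assoc, ← ENNReal.rpow_add _ _ hR hR']
          simp
        · exact zero_le
    _ = R ^ (2 / 3 : ℝ) * ∫⁻ s : FreqCircle τ, doublePower (2 / 3) (2 / 3) R (modulation τ s) :=
        lintegral_const_mul' _ _ (ENNReal.rpow_ne_top_of_nonneg (by norm_num) hR')
    _ ≤ R ^ (2 / 3 : ℝ) * (C * R ^ (1 - 2 / 3 - 2 / 3 : ℝ)) := by gcongr; exact h τ R hR hR'
    _ = C * (R ^ (2 / 3 : ℝ) * R ^ (1 - 2 / 3 - 2 / 3 : ℝ)) := by ring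
    _ = _ := by rw [← ENNReal.rpow_add _ _ hR hR']; norm_num

-- The time frequencies cancel, and k₁³ + k₂³ + k₃³ = 3k₁k₂k₃ when k₁ + k₂ + k₃ = 0; here k₂ = -(k₁
-- + k₃).
omit hτ in
theorem resonance_identity (x z : Phase τ) :
    (x.2 + (((x.1 : ℝ) ^ 3 : ℝ) : FreqCircle τ)) +
      ((-x - z).2 + ((((-x - z).1 : ℝ) ^ 3 : ℝ) : FreqCircle τ)) =
    (((-(3 * z.1 * x.1 * (x.1 + z.1)) : ℝ)) : FreqCircle τ) - (z.2 + (((z.1 : ℝ) ^ 3 : ℝ) : FreqCircle τ)) := by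
  have e : ((-(3 * z.1 * x.1 * (x.1 + z.1)) : ℝ)) = (x.1 : ℝ) ^ 3 + (-x.1 - z.1 : ℝ) ^ 3 + (z.1 : ℝ) ^ 3 := by
    ring
  rw [e]
  simp only [Prod.fst_sub, Prod.fst_neg, Prod.snd_sub, Prod.snd_neg, Int.cast_sub, Int.cast_neg,
    AddCircle.coe_add]
  abel

/-- Lower bound for the modulation of a real number in `(-3π/τ, 3π/τ)` in terms of its distance
to the three nearest periods. -/
theorem exists_period_modulation_lower_bound {y : ℝ} (hy : τ * |y| < 3 * π) :
    ∃ j ∈ ({-1, 0, 1} : Finset ℤ),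
      ENNReal.ofReal (max 1 |y - j * (2 * π / τ)|) ≤ 2 * modulation τ (y : FreqCircle τ) ∧
      |y - j * (2 * π / τ)| ≤ π / 2 * ‖dTau τ (y : FreqCircle τ)‖ := by
  have h0 := hτ.out
  have hπ := Real.pi_pos
  -- The period nearest to y. Since |τy/(2π)| < 3/2, rounding gives an integer of absolute value
  -- strictly below 2.
  refine ⟨round ((2 * π / τ)⁻¹ * y), ?_, ?_⟩
  · have h1 : |(2 * π / τ)⁻¹ * y| < 3 / 2 := by
      rw [abs_mul, abs_of_pos (by positivity), inv_div, div_mul_eq_mul_div, div_lt_iff₀ (by positivity)]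
      linarith
    have h2 := abs_sub_round ((2 * π / τ)⁻¹ * y)
    have h3 : |((round ((2 * π / τ)⁻¹ * y) : ℤ) : ℝ)| < 2 := by
      have := abs_sub_abs_le_abs_sub ((round ((2 * π / τ)⁻¹ * y) : ℤ) : ℝ) ((2 * π / τ)⁻¹ * y)
      rw [abs_sub_comm] at this
      linarith
    have h4 : |round ((2 * π / τ)⁻¹ * y)| < 2 := by exact_mod_cast h3
    rw [abs_lt] at h4
    simp only [Finset.mem_insert, Finset.mem_singleton]
    omega
  · have h1 := norm_le_norm_dTau (y : FreqCircle τ)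
    rw [AddCircle.norm_eq] at h1
    set v := |y - (round ((2 * π / τ)⁻¹ * y) : ℝ) * (2 * π / τ)|
    have h2 : v ≤ π / 2 * ‖dTau τ (y : FreqCircle τ)‖ := by
      calc v = π / 2 * (2 / π * v) := by field_simp
        _ ≤ _ := by gcongr
    refine ⟨?_, h2⟩
    have h3 : max 1 v ≤ 2 * jap (dTau τ (y : FreqCircle τ)) := by
      refine max_le ?_ ?_
      · have := one_le_jap (dTau τ (y : FreqCircle τ)); linarith
      · refine h2.trans ?_
        have := norm_le_jap (dTau τ (y : FreqCircle τ))
        have h4 := Real.pi_le_four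
        nlinarith [norm_nonneg (dTau τ (y : FreqCircle τ))]
    calc _ ≤ ENNReal.ofReal (2 * jap (dTau τ (y : FreqCircle τ))) := ENNReal.ofReal_le_ofReal h3
      _ = _ := by rw [ENNReal.ofReal_mul (by norm_num)]; simp [modulation]

end Phase

/-! ### The bilinear L⁴ Strichartz estimate. -/

section Kernels

open Classical in
/-- `⟨d_τ⟩^(-1/3)` in the first two variables, on the triples of low frequencies at which the
condition `P` holds. -/
noncomputable def cutKernel (τ : ℝ) (P : Phase τ → Phase τ → Phase τ → Prop)
    (x y z : Phase τ) : ℝ≥0∞ :=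
  if (x.1 ∈ lowFreq τ ∧ y.1 ∈ lowFreq τ ∧ z.1 ∈ lowFreq τ) ∧ P x y z then
    phaseMod τ x ^ (-(1 / 3) : ℝ) * phaseMod τ y ^ (-(1 / 3) : ℝ) else 0

theorem measurableSet_lowFreq_triple (τ : ℝ) : MeasurableSet {p : Phase τ × Phase τ × Phase τ |
    p.1.1 ∈ lowFreq τ ∧ p.2.1.1 ∈ lowFreq τ ∧ p.2.2.1 ∈ lowFreq τ} := by
  have h : MeasurableSet (lowFreq τ) := MeasurableSet.of_discrete
  exact ((measurable_fst.comp measurable_fst) h).inter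
    (((measurable_fst.comp (measurable_fst.comp measurable_snd)) h).inter
      ((measurable_fst.comp (measurable_snd.comp measurable_snd)) h))

theorem measurable_cutKernel {τ : ℝ} {P : Phase τ → Phase τ → Phase τ → Prop}
    (hP : MeasurableSet {p : Phase τ × Phase τ × Phase τ | P p.1 p.2.1 p.2.2}) :
    Measurable fun p : Phase τ × Phase τ × Phase τ => cutKernel τ P p.1 p.2.1 p.2.2 := by
  unfold cutKernel
  exact Measurable.ite ((measurableSet_lowFreq_triple τ).inter hP) (by fun_prop) measurable_const

/-- The output frequency dominates the modulations of the inputs. -/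
def OutputDominates (τ : ℝ) (x y z : Phase τ) : Prop :=
  phaseMod τ x ≤ (z.1.natAbs : ℝ≥0∞) ^ 3 ∧ phaseMod τ y ≤ (z.1.natAbs : ℝ≥0∞) ^ 3

/-- The modulation of the first input dominates. -/
def InputDominates (τ : ℝ) (x y z : Phase τ) : Prop :=
  (z.1.natAbs : ℝ≥0∞) ^ 3 ≤ phaseMod τ x ∧ phaseMod τ y ≤ phaseMod τ x

theorem measurable_natAbs_cube {τ : ℝ} :
    Measurable fun p : Phase τ => (p.1.natAbs : ℝ≥0∞) ^ 3 :=
  (measurable_from_top (f := fun k : ℤ => (k.natAbs : ℝ≥0∞) ^ 3)).comp measurable_fst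

theorem measurableSet_outputDominates (τ : ℝ) :
    MeasurableSet {p : Phase τ × Phase τ × Phase τ | OutputDominates τ p.1 p.2.1 p.2.2} := by
  have h : Measurable fun p : Phase τ × Phase τ × Phase τ => (p.2.2.1.natAbs : ℝ≥0∞) ^ 3 :=
    measurable_natAbs_cube.comp (measurable_snd.comp measurable_snd)
  exact (measurableSet_le (by fun_prop) h).inter (measurableSet_le (by fun_prop) h)

theorem measurableSet_inputDominates (τ : ℝ) :
    MeasurableSet {p : Phase τ × Phase τ × Phase τ | InputDominates τ p.1 p.2.1 p.2.2} := by
  have h : Measurable fun p : Phase τ × Phase τ × Phase τ => (p.2.2.1.natAbs : ℝ≥0∞) ^ 3 :=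
    measurable_natAbs_cube.comp (measurable_snd.comp measurable_snd)
  have hx : Measurable fun p : Phase τ × Phase τ × Phase τ => phaseMod τ p.1 := by fun_prop
  have hy : Measurable fun p : Phase τ × Phase τ × Phase τ => phaseMod τ p.2.1 := by fun_prop
  exact (measurableSet_le h hx).inter (measurableSet_le hy hx)

theorem cutKernel_sq_le {τ : ℝ} (P : Phase τ → Phase τ → Phase τ → Prop) (x y z : Phase τ) :
    cutKernel τ P x y z ^ 2 ≤ phaseMod τ x ^ (-(2 / 3) : ℝ) * phaseMod τ y ^ (-(2 / 3) : ℝ) := by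
  have e : ∀ a : ℝ≥0∞, (a ^ (-(1 / 3) : ℝ)) ^ 2 = a ^ (-(2 / 3) : ℝ) := fun a => by
    rw [← ENNReal.rpow_natCast, ← ENNReal.rpow_mul]; norm_num
  unfold cutKernel
  split_ifs
  · rw [mul_pow, e, e]
  · simp

theorem three_mul_le_add_cubes {a b c : ℝ} (ha : 0 ≤ a) (hb : 0 ≤ b) (hc : 0 ≤ c) :
    3 * (a * b * c) ≤ a ^ 3 + b ^ 3 + c ^ 3 := by
  have e : a ^ 3 + b ^ 3 + c ^ 3 - 3 * (a * b * c) =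
      (a + b + c) * ((a - b) ^ 2 + (b - c) ^ 2 + (c - a) ^ 2) / 2 := by ring
  have : 0 ≤ (a + b + c) * ((a - b) ^ 2 + (b - c) ^ 2 + (c - a) ^ 2) / 2 := by positivity
  linarith

/-- The arithmetic-geometric mean inequality bounds the product by the sum of the three cubes, each
at most 1/τ by the filter. The bound 3 being less than π is what prevents aliasing. -/
theorem lowFreq_product_le {τ : ℝ} (h0 : 0 < τ) {k n : ℤ} (hk : k ∈ lowFreq τ) (hn : n ∈ lowFreq τ)
    (hm : n + k ∈ lowFreq τ) : τ * |3 * (k : ℝ) * n * (n + k)| ≤ 3 := by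
  simp only [lowFreq, Set.mem_ofPred_eq, Int.cast_add] at hk hn hm
  have h := three_mul_le_add_cubes (abs_nonneg (k : ℝ)) (abs_nonneg (n : ℝ))
    (abs_nonneg ((n : ℝ) + k))
  rw [abs_mul, abs_mul, abs_mul, abs_of_nonneg (by norm_num : (0 : ℝ) ≤ 3)]
  nlinarith

/-- The contribution of one frequency to the sum over resonances, in terms of the three nearest
periods. -/
theorem modulation_resonance_le {τ : ℝ} [Fact (0 < τ)] {y : ℝ} (hy : τ * |y| < 3 * π) (K : ℕ) :
    (if modulation τ (y : FreqCircle τ) ≤ 2 * (K : ℝ≥0∞) ^ 3 then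
      modulation τ (y : FreqCircle τ) ^ (-(1 / 3) : ℝ) else 0) ≤
    2 * ∑ j ∈ ({-1, 0, 1} : Finset ℤ), (if |y - j * (2 * π / τ)| ≤ 4 * (K : ℝ) ^ 3 then
      ENNReal.ofReal ((max 1 |y - j * (2 * π / τ)|) ^ (-(1 / 3) : ℝ)) else 0) := by
  obtain ⟨j, hj, h1, h2⟩ := exists_period_modulation_lower_bound hy
  split_ifs with h
  · have h3 : jap (dTau τ (y : FreqCircle τ)) ≤ 2 * (K : ℝ) ^ 3 := by
      have e : (2 * (K : ℝ≥0∞) ^ 3) = ENNReal.ofReal (2 * (K : ℝ) ^ 3) := by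
        rw [ENNReal.ofReal_mul (by norm_num), ENNReal.ofReal_pow (by positivity)]; simp
      rw [e] at h
      exact (ENNReal.ofReal_le_ofReal_iff (by positivity)).1 h
    have h4 : |y - j * (2 * π / τ)| ≤ 4 * (K : ℝ) ^ 3 := by
      have := norm_le_jap (dTau τ (y : FreqCircle τ))
      have h4 := Real.pi_le_four
      have h5 : (0 : ℝ) ≤ (K : ℝ) ^ 3 := by positivity
      calc _ ≤ π / 2 * ‖dTau τ (y : FreqCircle τ)‖ := h2
        _ ≤ 4 / 2 * (2 * (K : ℝ) ^ 3) := by gcongr; linarith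
        _ = _ := by ring
    have h6 : (0 : ℝ) < max 1 |y - j * (2 * π / τ)| := lt_max_of_lt_left one_pos
    refine (rpow_neg_le_two_mul h1 (by norm_num) (by norm_num)).trans ?_
    rw [ENNReal.ofReal_rpow_of_pos h6]
    gcongr
    refine le_trans ?_ (Finset.single_le_sum (f := fun j : ℤ =>
      if |y - j * (2 * π / τ)| ≤ 4 * (K : ℝ) ^ 3 then
      ENNReal.ofReal ((max 1 |y - j * (2 * π / τ)|) ^ (-(1 / 3) : ℝ)) else 0)
      (fun _ _ => zero_le) hj)
    simp only [if_pos h4, le_refl]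
  · exact zero_le

/-- With z frozen, the σ-integral at frequency n is a convolution of modulation powers, evaluated
where the two inputs' phases add up. Subadditivity puts that total modulation below 2|k|³, which is
the truncation needed for the quadratic sum over n. -/
theorem exists_isSchurKernel_outputDominates : ∃ C : ℝ≥0∞, C ≠ ∞ ∧ ∀ (τ : ℝ) [Fact (0 < τ)],
    IsSchurKernel (phaseMeasure τ) (cutKernel τ (OutputDominates τ)) C := by
  obtain ⟨C, hC, h⟩ := exists_lintegral_modulation_conv_le
  -- 3 periods, each contributing a quadratic sum bounded by 26; the 2 compares the modulation with
  -- the distance to a period.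
  refine ⟨C * (2 * (3 * 26)), ENNReal.mul_ne_top hC
    (ENNReal.mul_ne_top (by simp) (ENNReal.mul_ne_top (by simp) (by simp))), fun τ hτ => ?_⟩
  have hKm := measurable_cutKernel (measurableSet_outputDominates τ)
  refine ⟨hKm, Or.inl fun z => ?_⟩
  have h0 := hτ.out
  have hm : Measurable fun x => cutKernel τ (OutputDominates τ) x (-x - z) z ^ 2 :=
    ((measurable_kernel_shift hKm).comp (measurable_id.prodMk measurable_const)).pow_const 2
  rw [lintegral_phase hm]
  set k := z.1 with hk
  -- At zero output frequency the cutoff would force a modulation, which is at least 1, to be at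
  -- most 0.
  rcases eq_or_ne k 0 with hk0 | hk0
  · have : ∀ x : Phase τ, cutKernel τ (OutputDominates τ) x (-x - z) z = 0 := fun x => by
      unfold cutKernel
      rw [if_neg]
      rintro ⟨-, h1, -⟩
      rw [← hk, hk0] at h1
      simp [phaseMod_ne_zero] at h1
    simp only [this]
    simp
  obtain ⟨t, ht, htz⟩ : ∃ t : ℝ, |t| ≤ π / τ ∧
      (t : FreqCircle τ) = z.2 + (((z.1 : ℝ) ^ 3 : ℝ) : FreqCircle τ) := by
    obtain ⟨x, hx, hx'⟩ := AddCircle.coe_image_Icc_eq (2 * π / τ) (-(π / τ)) ▸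
      Set.mem_univ (z.2 + (((z.1 : ℝ) ^ 3 : ℝ) : FreqCircle τ))
    refine ⟨x, ?_, hx'⟩
    rw [abs_le]; refine ⟨hx.1, hx.2.trans_eq ?_⟩; field_simp; ring
  have htτ : τ * |t| ≤ π := by
    rw [le_div_iff₀ h0] at ht; linarith
  have hfib : ∀ n : ℤ, ∫⁻ σ : FreqCircle τ,
      cutKernel τ (OutputDominates τ) (n, σ) (-(n, σ) - z) z ^ 2 ≤
      C * (2 * ∑ j ∈ ({-1, 0, 1} : Finset ℤ),
        (if |3 * (k : ℝ) * n * (n + k) + (t + j * (2 * π / τ))| ≤ 4 * (k.natAbs : ℝ) ^ 3 then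
        ENNReal.ofReal ((max 1 |3 * (k : ℝ) * n * (n + k) + (t + j * (2 * π / τ))|) ^
          (-(1 / 3) : ℝ)) else 0)) := by
    intro n
    by_cases hS : n ∈ lowFreq τ ∧ -n - k ∈ lowFreq τ ∧ k ∈ lowFreq τ
    swap
    · have : ∀ σ : FreqCircle τ,
          cutKernel τ (OutputDominates τ) (n, σ) (-(n, σ) - z) z = 0 := fun σ => by
        unfold cutKernel
        rw [if_neg]
        exact fun h1 => hS h1.1
      simp only [this]
      simp
    obtain ⟨hn, hnk, hkS⟩ := hS
    have hnk' : n + k ∈ lowFreq τ := by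
      rw [← neg_mem_lowFreq, neg_add]; exact hnk
    -- The real representative of the inputs' total phase. It satisfies τ|y| ≤ 3 + π < 3π, so it may
    -- leave the fundamental domain, but only the periods -1, 0, 1 matter.
    set y : ℝ := -(3 * k * n * (n + k)) - t with hy
    have hyτ : τ * |y| < 3 * π := by
      have h1 := lowFreq_product_le h0 hkS hn hnk'
      have h2 : |y| ≤ |3 * (k : ℝ) * n * (n + k)| + |t| := by
        rw [hy]; exact (abs_sub _ _).trans_eq (by rw [abs_neg])
      have := Real.pi_gt_three
      nlinarith
    have hmody : ∀ σ : FreqCircle τ, (σ + (((n : ℝ) ^ 3 : ℝ) : FreqCircle τ)) +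
        (((-((n, σ) : Phase τ) - z).2 + ((((-((n, σ) : Phase τ) - z).1 : ℝ) ^ 3 : ℝ) : FreqCircle τ))) =
        (y : FreqCircle τ) := fun σ => by
      rw [hy, AddCircle.coe_sub, htz]
      exact resonance_identity ((n, σ) : Phase τ) z
    have hbound : ∫⁻ σ : FreqCircle τ,
        cutKernel τ (OutputDominates τ) (n, σ) (-(n, σ) - z) z ^ 2 ≤
        C * (if modulation τ (y : FreqCircle τ) ≤ 2 * (k.natAbs : ℝ≥0∞) ^ 3 then
          modulation τ (y : FreqCircle τ) ^ (-(1 / 3) : ℝ) else 0) := by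
      split_ifs with hle
      · calc _ ≤ ∫⁻ σ : FreqCircle τ,
              modulation τ (σ + (((n : ℝ) ^ 3 : ℝ) : FreqCircle τ)) ^ (-(2 / 3) : ℝ) *
              modulation τ ((y : FreqCircle τ) - (σ + (((n : ℝ) ^ 3 : ℝ) : FreqCircle τ))) ^
                (-(2 / 3) : ℝ) := by
              refine lintegral_mono fun σ => (cutKernel_sq_le _ _ _ _).trans_eq ?_
              rw [← hmody σ, add_sub_cancel_left]
              rfl
          _ = ∫⁻ s : FreqCircle τ, modulation τ s ^ (-(2 / 3) : ℝ) *
              modulation τ ((y : FreqCircle τ) - s) ^ (-(2 / 3) : ℝ) :=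
              lintegral_add_right_eq_self (fun s : FreqCircle τ => modulation τ s ^ (-(2 / 3) : ℝ) *
                modulation τ ((y : FreqCircle τ) - s) ^ (-(2 / 3) : ℝ)) _
          _ ≤ _ := h τ _
      · have : ∀ σ : FreqCircle τ,
            cutKernel τ (OutputDominates τ) (n, σ) (-(n, σ) - z) z = 0 := fun σ => by
          unfold cutKernel
          rw [if_neg]
          rintro ⟨-, h1, h2⟩
          refine hle ?_
          rw [← hmody σ]
          exact (modulation_add_le _ _).trans ((add_le_add h1 h2).trans_eq (two_mul _).symm)
        simp only [this]
        simp
    refine hbound.trans ?_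
    gcongr
    refine (modulation_resonance_le hyτ k.natAbs).trans_eq ?_
    have e : ∀ j : ℤ, |y - j * (2 * π / τ)| =
        |3 * (k : ℝ) * n * (n + k) + (t + j * (2 * π / τ))| := fun j => by
      rw [← abs_neg, hy]; congr 1; ring
    simp only [e]
  calc _ ≤ ∑' n : ℤ, C * (2 * ∑ j ∈ ({-1, 0, 1} : Finset ℤ),
        (if |3 * (k : ℝ) * n * (n + k) + (t + j * (2 * π / τ))| ≤ 4 * (k.natAbs : ℝ) ^ 3 then
        ENNReal.ofReal ((max 1 |3 * (k : ℝ) * n * (n + k) + (t + j * (2 * π / τ))|) ^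
          (-(1 / 3) : ℝ)) else 0)) := ENNReal.tsum_le_tsum hfib
    _ ≤ C * (2 * ∑ j ∈ ({-1, 0, 1} : Finset ℤ), 26) := by
        rw [ENNReal.tsum_mul_left, ENNReal.tsum_mul_left, Summable.tsum_finsetSum
          fun _ _ => ENNReal.summable]
        gcongr with j hj
        exact tsum_cubic_resonance_le hk0 _
    _ = _ := by simp

/-- With x frozen and R its modulation, the factors are R^(-2/3) from x, R^(1/3) from the σ-integral
over modulations at most R, and R^(1/3) from counting output frequencies with |k|³ ≤ R; the
exponents cancel. -/
theorem exists_isSchurKernel_inputDominates : ∃ C : ℝ≥0∞, C ≠ ∞ ∧ ∀ (τ : ℝ) [Fact (0 < τ)],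
    IsSchurKernel (phaseMeasure τ) (cutKernel τ (InputDominates τ)) C := by
  obtain ⟨C, hC, h⟩ := exists_lintegral_modulation_le_of_le
  refine ⟨3 * C, ENNReal.mul_ne_top (by simp) hC, fun τ hτ => ?_⟩
  have hKm := measurable_cutKernel (measurableSet_inputDominates τ)
  refine ⟨hKm, Or.inr (Or.inl fun x => ?_)⟩
  have hm : Measurable fun z => cutKernel τ (InputDominates τ) x (-z - x) z ^ 2 := by
    have : Measurable fun z : Phase τ => (x, -z - x, z) := by
      simp only [sub_eq_add_neg]; fun_prop
    exact (hKm.comp this).pow_const 2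
  rw [lintegral_phase hm]
  set R := phaseMod τ x with hR
  have hR0 : R ≠ 0 := phaseMod_ne_zero x
  have hR' : R ≠ ∞ := phaseMod_ne_top x
  have hfib : ∀ n : ℤ, ∫⁻ σ : FreqCircle τ,
      cutKernel τ (InputDominates τ) x (-(n, σ) - x) (n, σ) ^ 2 ≤
      (if (n.natAbs : ℝ≥0∞) ^ 3 ≤ R then 1 else 0) * (R ^ (-(2 / 3) : ℝ) * (C * R ^ (1 / 3 : ℝ))) := by
    intro n
    split_ifs with hn
    · rw [one_mul]
      set c : FreqCircle τ := -x.2 + (((-n - x.1 : ℝ) ^ 3 : ℝ) : FreqCircle τ) with hc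
      have e : ∀ σ : FreqCircle τ, phaseMod τ (-((n, σ) : Phase τ) - x) = modulation τ (c - σ) := by
        intro σ
        unfold phaseMod
        congr 1
        simp only [hc, Prod.fst_sub, Prod.fst_neg, Prod.snd_sub, Prod.snd_neg, Int.cast_sub,
          Int.cast_neg]
        abel
      calc _ ≤ ∫⁻ σ : FreqCircle τ, R ^ (-(2 / 3) : ℝ) * (if modulation τ (c - σ) ≤ R then
            modulation τ (c - σ) ^ (-(2 / 3) : ℝ) else 0) := by
            refine lintegral_mono fun σ => ?_
            dsimp only
            split_ifs with h1
            · rw [← e σ]; exact cutKernel_sq_le _ _ _ _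
            · unfold cutKernel
              rw [if_neg]
              · simp
              · rintro ⟨-, -, h2⟩
                rw [e] at h2
                exact h1 h2
        _ = R ^ (-(2 / 3) : ℝ) * ∫⁻ s : FreqCircle τ, (if modulation τ s ≤ R then
            modulation τ s ^ (-(2 / 3) : ℝ) else 0) := by
            rw [lintegral_const_mul']
            · congr 1
              exact lintegral_sub_left_eq_self (fun s : FreqCircle τ => if modulation τ s ≤ R then
                modulation τ s ^ (-(2 / 3) : ℝ) else 0) c
            · exact ENNReal.rpow_ne_top_of_ne_zero hR0 hR'
        _ ≤ _ := by gcongr; exact h τ R hR0 hR'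
    · have : ∀ σ : FreqCircle τ,
          cutKernel τ (InputDominates τ) x (-(n, σ) - x) (n, σ) = 0 := fun σ => by
        unfold cutKernel
        rw [if_neg]
        exact fun h1 => hn h1.2.1
      simp only [this]
      simp
  calc _ ≤ ∑' n : ℤ, (if (n.natAbs : ℝ≥0∞) ^ 3 ≤ R then 1 else 0) *
        (R ^ (-(2 / 3) : ℝ) * (C * R ^ (1 / 3 : ℝ))) := ENNReal.tsum_le_tsum hfib
    _ ≤ 3 * R ^ (1 / 3 : ℝ) * (R ^ (-(2 / 3) : ℝ) * (C * R ^ (1 / 3 : ℝ))) := by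
        rw [ENNReal.tsum_mul_right]
        gcongr
        exact tsum_natAbs_cube_le (one_le_phaseMod x) hR'
    _ = 3 * C * (R ^ (1 / 3 : ℝ) * (R ^ (-(2 / 3) : ℝ) * R ^ (1 / 3 : ℝ))) := by ring
    _ = 3 * C := by
        rw [← ENNReal.rpow_add _ _ hR0 hR', ← ENNReal.rpow_add _ _ hR0 hR']; norm_num

/-- One of |k_z|³, L_x, L_y is the largest. -/
theorem cutKernel_true_le {τ : ℝ} (x y z : Phase τ) :
    cutKernel τ (fun _ _ _ => True) x y z ≤ cutKernel τ (OutputDominates τ) x y z +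
      (cutKernel τ (InputDominates τ) x y z + cutKernel τ (InputDominates τ) y x z) := by
  by_cases hS : x.1 ∈ lowFreq τ ∧ y.1 ∈ lowFreq τ ∧ z.1 ∈ lowFreq τ
  · have hS' : y.1 ∈ lowFreq τ ∧ x.1 ∈ lowFreq τ ∧ z.1 ∈ lowFreq τ := ⟨hS.2.1, hS.1, hS.2.2⟩
    by_cases h1 : OutputDominates τ x y z
    · refine le_trans (le_of_eq ?_) le_self_add
      simp [cutKernel, hS, h1]
    by_cases h2 : InputDominates τ x y z
    · refine le_trans (le_of_eq ?_) (le_self_add.trans le_add_self)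
      simp [cutKernel, hS, h2]
    · have h3 : InputDominates τ y x z := by
        simp only [OutputDominates, InputDominates, not_and_or, not_le] at h1 h2 ⊢
        rcases le_total (phaseMod τ x) (phaseMod τ y) with h | h
        · refine ⟨?_, h⟩
          rcases h1 with h1 | h1
          · exact h1.le.trans h
          · exact h1.le
        · exfalso
          rcases h2 with h2 | h2
          · rcases h1 with h1 | h1
            · exact lt_asymm h1 h2
            · exact lt_asymm h2 (h1.trans_le h)
          · exact absurd h2 (not_lt.2 h)
      refine le_trans (le_of_eq ?_) (le_add_self.trans le_add_self)
      simp [cutKernel, hS, h3, mul_comm]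
  · simp [cutKernel, hS]

theorem trilinearOp_le_of_le_add {τ : ℝ} [Fact (0 < τ)]
    {K K₀ K₁ K₂ : Phase τ → Phase τ → Phase τ → ℝ≥0∞} {C₀ C₁ C₂ : ℝ≥0∞}
    (hK : ∀ x y z, K x y z ≤ K₀ x y z + (K₁ x y z + K₂ x y z))
    (h0 : IsSchurKernel (phaseMeasure τ) K₀ C₀) (h1 : IsSchurKernel (phaseMeasure τ) K₁ C₁)
    (h2 : IsSchurKernel (phaseMeasure τ) K₂ C₂)
    {F H : Phase τ → ℝ≥0∞} (hF : Measurable F) (hH : Measurable H) :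
    ∫⁻ z, trilinearOp (phaseMeasure τ) K F H z ^ 2 ∂phaseMeasure τ ≤ 4 * (C₀ + 4 * (C₁ + C₂)) *
      ((∫⁻ x, F x ^ 2 ∂phaseMeasure τ) * ∫⁻ x, H x ^ 2 ∂phaseMeasure τ) := by
  set μ := phaseMeasure τ
  have m0 := measurable_trilinearOp (μ := μ) h0.1 hF hH
  have m1 := measurable_trilinearOp (μ := μ) h1.1 hF hH
  have m2 := measurable_trilinearOp (μ := μ) h2.1 hF hH
  have key : ∀ z, trilinearOp μ K F H z ≤ trilinearOp μ K₀ F H z +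
      (trilinearOp μ K₁ F H z + trilinearOp μ K₂ F H z) := fun z => by
    unfold trilinearOp
    have hFH : Measurable fun x => F x * H (-x - z) :=
      (measurable_mul_shift hF hH).comp (measurable_id.prodMk measurable_const)
    have k0 : Measurable fun x => K₀ x (-x - z) z :=
      (measurable_kernel_shift h0.1).comp (measurable_id.prodMk measurable_const)
    have k1 : Measurable fun x => K₁ x (-x - z) z :=
      (measurable_kernel_shift h1.1).comp (measurable_id.prodMk measurable_const)
    have k0' : Measurable fun x => F x * H (-x - z) * K₀ x (-x - z) z := hFH.mul k0
    have k1' : Measurable fun x => F x * H (-x - z) * K₁ x (-x - z) z := hFH.mul k1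
    rw [← lintegral_add_left k1', ← lintegral_add_left k0']
    refine lintegral_mono fun x => ?_
    rw [← mul_add, ← mul_add]
    gcongr
    exact hK _ _ _
  calc _ ≤ ∫⁻ z, 4 * (trilinearOp μ K₀ F H z ^ 2 +
        4 * (trilinearOp μ K₁ F H z ^ 2 + trilinearOp μ K₂ F H z ^ 2)) ∂μ := by
        refine lintegral_mono fun z => ?_
        refine (pow_le_pow_left₀ zero_le (key z) 2).trans ((ennreal_add_sq_le _ _).trans ?_)
        gcongr
        exact ennreal_add_sq_le _ _
    _ = 4 * (∫⁻ z, trilinearOp μ K₀ F H z ^ 2 ∂μ +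
        4 * (∫⁻ z, trilinearOp μ K₁ F H z ^ 2 ∂μ + ∫⁻ z, trilinearOp μ K₂ F H z ^ 2 ∂μ)) := by
        rw [lintegral_const_mul' _ _ (by simp), lintegral_add_left (m0.pow_const 2),
          lintegral_const_mul' _ _ (by simp), lintegral_add_left (m1.pow_const 2)]
    _ ≤ 4 * (C₀ * ((∫⁻ x, F x ^ 2 ∂μ) * ∫⁻ x, H x ^ 2 ∂μ) +
        4 * (C₁ * ((∫⁻ x, F x ^ 2 ∂μ) * ∫⁻ x, H x ^ 2 ∂μ) +
          C₂ * ((∫⁻ x, F x ^ 2 ∂μ) * ∫⁻ x, H x ^ 2 ∂μ))) := by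
        gcongr
        · exact h0.lintegral_trilinearOp_sq_le hF hH
        · exact h1.lintegral_trilinearOp_sq_le hF hH
        · exact h2.lintegral_trilinearOp_sq_le hF hH
    _ = _ := by ring

/-- The bilinear form of the `L⁴` Strichartz estimate `X^{0,1/3} ⊂ L⁴`, and its dual. -/
theorem exists_strichartz : ∃ C : ℝ≥0∞, C ≠ ∞ ∧ ∀ (τ : ℝ) [Fact (0 < τ)]
    (F H : Phase τ → ℝ≥0∞), Measurable F → Measurable H →
    ∫⁻ z, trilinearOp (phaseMeasure τ) (cutKernel τ fun _ _ _ => True) F H z ^ 2 ∂phaseMeasure τ ≤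
      C * ((∫⁻ x, F x ^ 2 ∂phaseMeasure τ) * ∫⁻ x, H x ^ 2 ∂phaseMeasure τ) ∧
    ∫⁻ z, trilinearOp (phaseMeasure τ) (fun x y z => cutKernel τ (fun _ _ _ => True) y z x) F H z ^ 2
      ∂phaseMeasure τ ≤
      C * ((∫⁻ x, F x ^ 2 ∂phaseMeasure τ) * ∫⁻ x, H x ^ 2 ∂phaseMeasure τ) := by
  obtain ⟨C₀, hC₀, h0⟩ := exists_isSchurKernel_outputDominates
  obtain ⟨C₁, hC₁, h1⟩ := exists_isSchurKernel_inputDominates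
  refine ⟨4 * (C₀ + 4 * (C₁ + C₁)), ?_, fun τ _ F H hF hH => ⟨?_, ?_⟩⟩
  · exact ENNReal.mul_ne_top (by simp) (ENNReal.add_ne_top.2 ⟨hC₀, ENNReal.mul_ne_top (by simp)
      (ENNReal.add_ne_top.2 ⟨hC₁, hC₁⟩)⟩)
  · exact trilinearOp_le_of_le_add (fun x y z => cutKernel_true_le x y z) (h0 τ) (h1 τ)
      (h1 τ).swap_left hF hH
  · exact trilinearOp_le_of_le_add (fun x y z => cutKernel_true_le y z x)
      (h0 τ).swap_right.swap_left
      (h1 τ).swap_right.swap_left (h1 τ).swap_left.swap_right.swap_left hF hH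

end Kernels

/-! ### Gaining back the derivative from the resonance. -/

section Resonance

/-- `|k|` for a low frequency `k`, and `0` otherwise: the symbol of `∂ₓ Π_τ` in absolute value. -/
noncomputable def derivSymbol (τ : ℝ) (k : ℤ) : ℝ≥0∞ :=
  (lowFreq τ).indicator (fun k : ℤ => (k.natAbs : ℝ≥0∞)) k

/-- Without aliasing the circle norm of q = 3k₁k₂k₃ is |q|, so (2/π)|q| ≤ |d_τ(q)|, while
subadditivity bounds |d_τ(q)| by three times the largest modulation. The 3's cancel and π/2 ≤ 2. -/
theorem resonance_product_le {τ : ℝ} [hτ : Fact (0 < τ)] {x z : Phase τ} (hx : x.1 ∈ lowFreq τ)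
    (hy : (-x - z).1 ∈ lowFreq τ) (hz : z.1 ∈ lowFreq τ) :
    (z.1.natAbs : ℝ≥0∞) * x.1.natAbs * (-x - z).1.natAbs ≤
      2 * max (phaseMod τ x) (max (phaseMod τ (-x - z)) (phaseMod τ z)) := by
  have h0 := hτ.out
  have hπ := Real.pi_pos
  set y := -x - z with hy_def
  have hsum : x.1 + z.1 ∈ lowFreq τ := by
    rw [← neg_mem_lowFreq]
    convert hy using 1
    rw [hy_def, Prod.fst_sub, Prod.fst_neg]; ring
  set q : ℝ := -(3 * z.1 * x.1 * (x.1 + z.1)) with hq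
  have hqa : τ * |q| ≤ 3 := by
    rw [hq, abs_neg]; exact lowFreq_product_le h0 hz hx hsum
  have hnorm : ‖(q : FreqCircle τ)‖ = |q| := by
    have hT : 0 < 2 * π / τ := by positivity
    rw [AddCircle.norm_coe_eq_abs_iff _ hT.ne', abs_of_pos hT]
    have h3 := Real.pi_gt_three
    rw [le_div_iff₀ (by norm_num), le_div_iff₀ h0]
    nlinarith
  have hlow := norm_le_norm_dTau (q : FreqCircle τ)
  rw [hnorm] at hlow
  set hx' : FreqCircle τ := x.2 + (((x.1 : ℝ) ^ 3 : ℝ) : FreqCircle τ)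
  set hy' : FreqCircle τ := y.2 + (((y.1 : ℝ) ^ 3 : ℝ) : FreqCircle τ)
  set hz' : FreqCircle τ := z.2 + (((z.1 : ℝ) ^ 3 : ℝ) : FreqCircle τ)
  have hid : hx' + hy' + hz' = (q : FreqCircle τ) := by
    have h := resonance_identity x z
    rw [eq_sub_iff_add_eq] at h
    exact h
  have hup : ‖dTau τ (q : FreqCircle τ)‖ ≤ ‖dTau τ hx'‖ + ‖dTau τ hy'‖ + ‖dTau τ hz'‖ := by
    rw [← hid]
    exact (norm_dTau_add_le _ _).trans (add_le_add (norm_dTau_add_le _ _) le_rfl)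
  set m := max (jap (dTau τ hx')) (max (jap (dTau τ hy')) (jap (dTau τ hz'))) with hm
  have e1 : ‖dTau τ hx'‖ ≤ m := (norm_le_jap _).trans (le_max_left _ _)
  have e2 : ‖dTau τ hy'‖ ≤ m := (norm_le_jap _).trans ((le_max_left _ _).trans (le_max_right _ _))
  have e3 : ‖dTau τ hz'‖ ≤ m := (norm_le_jap _).trans ((le_max_right _ _).trans (le_max_right _ _))
  have hm0 : 0 < m := (jap_pos _).trans_le (le_max_left _ _)
  have hqe : |q| = 3 * ((z.1.natAbs : ℝ) * x.1.natAbs * y.1.natAbs) := by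
    have : (y.1.natAbs : ℝ) = |(x.1 : ℝ) + z.1| := by
      rw [Nat.cast_natAbs, Int.cast_abs, ← abs_neg, hy_def, Prod.fst_sub, Prod.fst_neg]
      congr 1; push_cast; ring
    rw [this, hq, abs_neg, abs_mul, abs_mul, abs_mul, abs_of_nonneg (by norm_num : (0 : ℝ) ≤ 3),
      Nat.cast_natAbs, Nat.cast_natAbs, Int.cast_abs, Int.cast_abs]
    ring
  have hfin : (z.1.natAbs : ℝ) * x.1.natAbs * y.1.natAbs ≤ 2 * m := by
    have h1 : 2 / π * |q| ≤ 3 * m := by linarith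
    rw [hqe, div_mul_eq_mul_div, div_le_iff₀ hπ] at h1
    have := Real.pi_le_four
    nlinarith
  have := ENNReal.ofReal_le_ofReal hfin
  rw [ENNReal.ofReal_mul (by positivity), ENNReal.ofReal_mul (by positivity),
    ENNReal.ofReal_mul (by norm_num), hm, ENNReal.ofReal_max, ENNReal.ofReal_max] at this
  simp only [ENNReal.ofReal_natCast, ENNReal.ofReal_ofNat] at this
  exact this

/-- For nonzero integers |b| ≤ |a| + |a + b| ≤ 2|a||a + b|. The mean-zero hypothesis is what
supplies the nonvanishing. -/
theorem natAbs_sq_le_product {a b : ℤ} (ha : a ≠ 0) (hab : -a - b ≠ 0) :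
    (b.natAbs : ℝ≥0∞) ^ 2 ≤ 2 * ((b.natAbs : ℝ≥0∞) * a.natAbs * (-a - b).natAbs) := by
  have h1 : b.natAbs ≤ a.natAbs + (-a - b).natAbs := by omega
  have h2 : 1 ≤ a.natAbs := by omega
  have h3 : 1 ≤ (-a - b).natAbs := by omega
  have h4 : b.natAbs ≤ 2 * (a.natAbs * (-a - b).natAbs) := by nlinarith
  have h5 : b.natAbs ^ 2 ≤ 2 * (b.natAbs * a.natAbs * (-a - b).natAbs) := by
    calc b.natAbs ^ 2 = b.natAbs * b.natAbs := sq _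
      _ ≤ b.natAbs * (2 * (a.natAbs * (-a - b).natAbs)) := Nat.mul_le_mul_left _ h4
      _ = _ := by ring
  exact_mod_cast h5

theorem le_two_mul_rpow_half {a b : ℝ≥0∞} (h : a ^ 2 ≤ 4 * b) : a ≤ 2 * b ^ (1 / 2 : ℝ) := by
  have := ENNReal.rpow_le_rpow h (by norm_num : (0 : ℝ) ≤ 1 / 2)
  rw [ENNReal.mul_rpow_of_nonneg _ _ (by norm_num), ← ENNReal.rpow_natCast, ← ENNReal.rpow_mul] at this
  have e : (4 : ℝ≥0∞) ^ (1 / 2 : ℝ) = 2 := by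
    rw [show (4 : ℝ≥0∞) = 2 ^ (2 : ℝ) by norm_num, ← ENNReal.rpow_mul]; norm_num
  rw [e] at this
  simpa using this

/-- The trichotomy of the resonance: either one of the inputs compensates the derivative, or the
modulation of the output is the largest one. -/
theorem derivSymbol_cases {τ : ℝ} [hτ : Fact (0 < τ)] {x z : Phase τ} (hx : x.1 ∈ lowFreq τ)
    (hy : (-x - z).1 ∈ lowFreq τ) (hx0 : x.1 ≠ 0) (hy0 : (-x - z).1 ≠ 0) :
    derivSymbol τ z.1 ≤ 2 * phaseMod τ x ^ (1 / 2 : ℝ) ∨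
    derivSymbol τ z.1 ≤ 2 * phaseMod τ (-x - z) ^ (1 / 2 : ℝ) ∨
    (derivSymbol τ z.1 ≤ 2 * phaseMod τ z ^ (1 / 2 : ℝ) ∧ phaseMod τ x ≤ phaseMod τ z ∧
      phaseMod τ (-x - z) ≤ phaseMod τ z ∧
      (z.1.natAbs : ℝ≥0∞) * x.1.natAbs * (-x - z).1.natAbs ≤ 2 * phaseMod τ z) := by
  by_cases hz : z.1 ∈ lowFreq τ
  · have h := resonance_product_le hx hy hz
    have hd : derivSymbol τ z.1 = (z.1.natAbs : ℝ≥0∞) := by simp [derivSymbol, hz]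
    rw [hd]
    have hsq := natAbs_sq_le_product (a := x.1) (b := z.1) hx0 hy0
    have hM : ∀ L : ℝ≥0∞, (z.1.natAbs : ℝ≥0∞) * x.1.natAbs * (-x - z).1.natAbs ≤ 2 * L →
        (z.1.natAbs : ℝ≥0∞) ≤ 2 * L ^ (1 / 2 : ℝ) := fun L hL => by
      refine le_two_mul_rpow_half (hsq.trans ?_)
      calc _ ≤ 2 * (2 * L) := mul_le_mul' le_rfl hL
        _ = 4 * L := by ring
    -- The cases are decided by which modulation controls the product, not by which is largest: if
    -- neither input's does, the output modulation must exceed both, so the last case carries all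
    -- its side conditions.
    by_cases h1 : (z.1.natAbs : ℝ≥0∞) * x.1.natAbs * (-x - z).1.natAbs ≤ 2 * phaseMod τ x
    · exact Or.inl (hM _ h1)
    by_cases h2 : (z.1.natAbs : ℝ≥0∞) * x.1.natAbs * (-x - z).1.natAbs ≤ 2 * phaseMod τ (-x - z)
    · exact Or.inr (Or.inl (hM _ h2))
    refine Or.inr (Or.inr ?_)
    have h3 : phaseMod τ x ≤ phaseMod τ z := by
      by_contra hc
      rcases le_total (phaseMod τ (-x - z)) (phaseMod τ x) with h4 | h4
      · rw [max_eq_left (max_le h4 (not_le.1 hc).le)] at h; exact h1 h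
      · rw [max_eq_left ((not_le.1 hc).le.trans h4), max_eq_right h4] at h; exact h2 h
    have h4 : phaseMod τ (-x - z) ≤ phaseMod τ z := by
      by_contra hc
      rw [max_eq_left (not_le.1 hc).le, max_eq_right (h3.trans (not_le.1 hc).le)] at h
      exact h2 h
    rw [max_eq_right h4, max_eq_right h3] at h
    exact ⟨hM _ h, h3, h4, h⟩
  · left; simp [derivSymbol, hz]

end Resonance

/-! ### Pointwise splitting for the X^{s,-1/2} norm. -/

section Estimates

variable {τ : ℝ}

/-- The function is supported on the nonzero low frequencies. -/
def IsLowFreq (τ : ℝ) (f : Phase τ → ℝ≥0∞) : Prop := ∀ p, (p.1 = 0 ∨ p.1 ∉ lowFreq τ) → f p = 0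

/-- The convolution of `f` and `g`, at `-z`. -/
noncomputable def phaseConv (τ : ℝ) [Fact (0 < τ)] (f g : Phase τ → ℝ≥0∞) (z : Phase τ) : ℝ≥0∞ :=
  ∫⁻ x, f x * g (-x - z) ∂phaseMeasure τ

/-- The integrand of the convolution, each factor being divided by the square root of the larger
of its modulation and of the resonance. -/
noncomputable def resonantIntegrand (τ : ℝ) (f g : Phase τ → ℝ≥0∞) (x z : Phase τ) : ℝ≥0∞ :=
  (f x * max (phaseMod τ x) ((z.1.natAbs : ℝ≥0∞) * x.1.natAbs * (-x.1 - z.1).natAbs) ^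
      (-(1 / 2) : ℝ)) *
    (g (-x - z) * max (phaseMod τ (-x - z))
      ((z.1.natAbs : ℝ≥0∞) * (-(-x - z).1 - z.1).natAbs * (-x - z).1.natAbs) ^ (-(1 / 2) : ℝ))

/-- The bound for the part of the convolution in which the output modulation is the largest. -/
noncomputable def resonantPart (τ : ℝ) [Fact (0 < τ)] (f g : Phase τ → ℝ≥0∞) (z : Phase τ) : ℝ≥0∞ :=
  ∫⁻ x, resonantIntegrand τ f g x z ∂phaseMeasure τ

/-- The square of the `X^{0,b}` norm. -/
noncomputable def phaseNormSq (τ : ℝ) [Fact (0 < τ)] (b : ℝ) (f : Phase τ → ℝ≥0∞) : ℝ≥0∞ :=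
  ∫⁻ x, (phaseMod τ x ^ b * f x) ^ 2 ∂phaseMeasure τ

theorem phaseNormSq_mono [Fact (0 < τ)] {b c : ℝ} (h : b ≤ c) (f : Phase τ → ℝ≥0∞) :
    phaseNormSq τ b f ≤ phaseNormSq τ c f := by
  unfold phaseNormSq
  gcongr with x
  exact one_le_phaseMod x

theorem rpow_mul_rpow_neg {p : Phase τ} (b : ℝ) : phaseMod τ p ^ b * phaseMod τ p ^ (-b) = 1 := by
  rw [← ENNReal.rpow_add _ _ (phaseMod_ne_zero p) (phaseMod_ne_top p)]; simp

/-- `F^b = ⟨d_τ(σ + k³)⟩^b F`. -/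
noncomputable def liftMod (τ : ℝ) (b : ℝ) (f : Phase τ → ℝ≥0∞) (x : Phase τ) : ℝ≥0∞ :=
  phaseMod τ x ^ b * f x

theorem measurable_liftMod {b : ℝ} {f : Phase τ → ℝ≥0∞} (hf : Measurable f) :
    Measurable (liftMod τ b f) := by
  unfold liftMod; fun_prop

theorem liftMod_mul_inv (b : ℝ) (f : Phase τ → ℝ≥0∞) (x : Phase τ) :
    liftMod τ b f x * phaseMod τ x ^ (-b) = f x := by
  unfold liftMod
  rw [mul_right_comm, rpow_mul_rpow_neg, one_mul]

theorem phaseMod_rpow_le_rpow {b c : ℝ} (h : b ≤ c) (p : Phase τ) :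
    phaseMod τ p ^ b ≤ phaseMod τ p ^ c :=
  ENNReal.rpow_le_rpow_of_exponent_le (one_le_phaseMod p) h

theorem phaseMod_half_split (p : Phase τ) :
    phaseMod τ p ^ (1 / 2 : ℝ) * phaseMod τ p ^ (-(1 / 2) : ℝ) = 1 := rpow_mul_rpow_neg _

/-- The three terms into which the bilinear operator splits. -/
noncomputable def convInputs (τ : ℝ) [Fact (0 < τ)] (f g : Phase τ → ℝ≥0∞) (z : Phase τ) : ℝ≥0∞ :=
  trilinearOp (phaseMeasure τ) (cutKernel τ fun _ _ _ => True) (liftMod τ (1 / 3) f)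
    (liftMod τ (1 / 3) g) z

noncomputable def convOutput (τ : ℝ) [Fact (0 < τ)] (f g : Phase τ → ℝ≥0∞) (z : Phase τ) : ℝ≥0∞ :=
  trilinearOp (phaseMeasure τ) (fun x y z => cutKernel τ (fun _ _ _ => True) y z x)
    (liftMod τ (1 / 2) f) (liftMod τ (1 / 3) g) z

theorem convOutput_swap [Fact (0 < τ)] (f g : Phase τ → ℝ≥0∞) (z : Phase τ) :
    convOutput τ g f z = ∫⁻ x, liftMod τ (1 / 3) f x * liftMod τ (1 / 2) g (-x - z) *
      cutKernel τ (fun _ _ _ => True) x z (-x - z) ∂phaseMeasure τ := by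
  unfold convOutput
  rw [← trilinearOp_swap]
  rfl

theorem cutKernel_true_eq {x y z : Phase τ} (hx : x.1 ∈ lowFreq τ) (hy : y.1 ∈ lowFreq τ)
    (hz : z.1 ∈ lowFreq τ) : cutKernel τ (fun _ _ _ => True) x y z =
      phaseMod τ x ^ (-(1 / 3) : ℝ) * phaseMod τ y ^ (-(1 / 3) : ℝ) := by
  simp [cutKernel, hx, hy, hz]

theorem measurable_shift {F H : Phase τ → ℝ≥0∞} (hF : Measurable F) (hH : Measurable H)
    (z : Phase τ) : Measurable fun x => F x * H (-x - z) :=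
  (measurable_mul_shift hF hH).comp (measurable_id.prodMk measurable_const)

theorem measurable_shift_cut {F H : Phase τ → ℝ≥0∞} (hF : Measurable F) (hH : Measurable H)
    (z : Phase τ) {K : Phase τ → Phase τ → Phase τ → ℝ≥0∞}
    (hK : Measurable fun p : Phase τ × Phase τ × Phase τ => K p.1 p.2.1 p.2.2) :
    Measurable fun x => F x * H (-x - z) * K x (-x - z) z :=
  (measurable_shift hF hH z).mul
    ((measurable_kernel_shift hK).comp (measurable_id.prodMk measurable_const))

theorem measurable_cutKernel_true : Measurable fun p : Phase τ × Phase τ × Phase τ =>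
    cutKernel τ (fun _ _ _ => True) p.1 p.2.1 p.2.2 :=
  measurable_cutKernel (by simp)

theorem measurable_cutKernel_true_rot : Measurable fun p : Phase τ × Phase τ × Phase τ =>
    cutKernel τ (fun _ _ _ => True) p.2.1 p.2.2 p.1 :=
  measurable_cutKernel_true.comp (f := fun p : Phase τ × Phase τ × Phase τ => (p.2.1, p.2.2, p.1))
    (by fun_prop)

theorem measurable_convOutput [Fact (0 < τ)] {f g : Phase τ → ℝ≥0∞} (hf : Measurable f) (hg : Measurable g) :
    Measurable (convOutput τ f g) :=
  measurable_trilinearOp measurable_cutKernel_true_rot (measurable_liftMod hf)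
    (measurable_liftMod hg)

theorem measurable_convInputs [Fact (0 < τ)] {f g : Phase τ → ℝ≥0∞} (hf : Measurable f) (hg : Measurable g) :
    Measurable (convInputs τ f g) :=
  measurable_trilinearOp measurable_cutKernel_true (measurable_liftMod hf) (measurable_liftMod hg)

theorem derivSymbol_of_notMem {k : ℤ} (hk : k ∉ lowFreq τ) : derivSymbol τ k = 0 := by
  simp [derivSymbol, hk]

theorem derivSymbol_ne_top (k : ℤ) : derivSymbol τ k ≠ ∞ := by
  unfold derivSymbol
  by_cases h : k ∈ lowFreq τ <;> simp [h]

/-- Contribution of the triples on which the first input compensates the derivative. -/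
theorem mul_le_of_input_dominates {f g : Phase τ → ℝ≥0∞} {x z : Phase τ}
    (hx : x.1 ∈ lowFreq τ) (hy : (-x - z).1 ∈ lowFreq τ) (hz : z.1 ∈ lowFreq τ) {D : ℝ≥0∞}
    (hD : D ≤ 2 * phaseMod τ x ^ (1 / 2 : ℝ)) :
    f x * g (-x - z) * D * phaseMod τ z ^ (-(1 / 3) : ℝ) ≤
      2 * (liftMod τ (1 / 2) f x * liftMod τ (1 / 3) g (-x - z) *
        cutKernel τ (fun _ _ _ => True) (-x - z) z x) := by
  rw [cutKernel_true_eq hy hz hx]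
  have e := liftMod_mul_inv (1 / 3) g (-x - z)
  calc f x * g (-x - z) * D * phaseMod τ z ^ (-(1 / 3) : ℝ)
      ≤ f x * g (-x - z) * (2 * phaseMod τ x ^ (1 / 2 : ℝ)) * phaseMod τ z ^ (-(1 / 3) : ℝ) := by
        gcongr
    _ = 2 * ((phaseMod τ x ^ (1 / 2 : ℝ) * f x) * (liftMod τ (1 / 3) g (-x - z) *
        phaseMod τ (-x - z) ^ (-(1 / 3) : ℝ)) * phaseMod τ z ^ (-(1 / 3) : ℝ)) := by
        rw [e]; ring
    _ = _ := by unfold liftMod; ring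

theorem mul_le_of_snd_input_dominates {f g : Phase τ → ℝ≥0∞} {x z : Phase τ}
    (hx : x.1 ∈ lowFreq τ) (hy : (-x - z).1 ∈ lowFreq τ) (hz : z.1 ∈ lowFreq τ) {D : ℝ≥0∞}
    (hD : D ≤ 2 * phaseMod τ (-x - z) ^ (1 / 2 : ℝ)) :
    f x * g (-x - z) * D * phaseMod τ z ^ (-(1 / 3) : ℝ) ≤
      2 * (liftMod τ (1 / 3) f x * liftMod τ (1 / 2) g (-x - z) *
        cutKernel τ (fun _ _ _ => True) x z (-x - z)) := by
  rw [cutKernel_true_eq hx hz hy]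
  have e := liftMod_mul_inv (1 / 3) f x
  calc f x * g (-x - z) * D * phaseMod τ z ^ (-(1 / 3) : ℝ)
      ≤ f x * g (-x - z) * (2 * phaseMod τ (-x - z) ^ (1 / 2 : ℝ)) *
        phaseMod τ z ^ (-(1 / 3) : ℝ) := by
        gcongr
    _ = 2 * ((liftMod τ (1 / 3) f x * phaseMod τ x ^ (-(1 / 3) : ℝ)) *
        (phaseMod τ (-x - z) ^ (1 / 2 : ℝ) * g (-x - z)) * phaseMod τ z ^ (-(1 / 3) : ℝ)) := by
        rw [e]; ring
    _ = _ := by unfold liftMod; ring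

/-- When an input pays, L_z^(-1/2) is weakened to the L_z^(-1/3) of the dual kernel. When the output
pays, L_z^(1/2) cancels the weight exactly and the bare product f·g is left for the direct kernel.
-/
theorem derivSymbol_mul_phaseConv_le [Fact (0 < τ)] {f g : Phase τ → ℝ≥0∞} (hf : Measurable f) (hg : Measurable g)
    (hfs : IsLowFreq τ f) (hgs : IsLowFreq τ g) (z : Phase τ) :
    derivSymbol τ z.1 * phaseMod τ z ^ (-(1 / 2) : ℝ) * phaseConv τ f g z ≤
      2 * (convInputs τ f g z + (convOutput τ f g z + convOutput τ g f z)) := by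
  by_cases hz : z.1 ∈ lowFreq τ
  swap
  · simp [derivSymbol_of_notMem hz]
  have hwt : derivSymbol τ z.1 * phaseMod τ z ^ (-(1 / 2) : ℝ) ≠ ∞ :=
    ENNReal.mul_ne_top (derivSymbol_ne_top _)
      (ENNReal.rpow_ne_top_of_ne_zero (phaseMod_ne_zero z) (phaseMod_ne_top z))
  rw [convOutput_swap f g]
  unfold convInputs convOutput trilinearOp phaseConv
  dsimp only
  have m1 := measurable_shift_cut (measurable_liftMod (b := 1 / 3) hf)
    (measurable_liftMod (b := 1 / 3) hg) z measurable_cutKernel_true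
  have m2 := measurable_shift_cut (measurable_liftMod (b := 1 / 2) hf)
    (measurable_liftMod (b := 1 / 3) hg) z
    (K := fun x y z => cutKernel τ (fun _ _ _ => True) y z x) measurable_cutKernel_true_rot
  rw [← lintegral_add_left m2, ← lintegral_add_left m1, ← lintegral_const_mul' _ _ hwt,
    ← lintegral_const_mul' _ _ (by simp)]
  refine lintegral_mono fun x => ?_
  dsimp only
  by_cases hxs : x.1 = 0 ∨ x.1 ∉ lowFreq τ
  · simp [hfs x hxs]
  by_cases hys : (-x - z).1 = 0 ∨ (-x - z).1 ∉ lowFreq τ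
  · simp [hgs _ hys]
  push Not at hxs hys
  have hhalf : phaseMod τ z ^ (-(1 / 2) : ℝ) ≤ phaseMod τ z ^ (-(1 / 3) : ℝ) :=
    phaseMod_rpow_le_rpow (by norm_num) z
  rcases derivSymbol_cases hxs.2 hys.2 hxs.1 hys.1 with h | h | h
  · calc _ ≤ f x * g (-x - z) * derivSymbol τ z.1 * phaseMod τ z ^ (-(1 / 3) : ℝ) := by
          rw [mul_comm, ← mul_assoc]; gcongr
      _ ≤ _ := mul_le_of_input_dominates hxs.2 hys.2 hz h
      _ ≤ _ := by gcongr; exact le_self_add.trans le_add_self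
  · calc _ ≤ f x * g (-x - z) * derivSymbol τ z.1 * phaseMod τ z ^ (-(1 / 3) : ℝ) := by
          rw [mul_comm, ← mul_assoc]; gcongr
      _ ≤ _ := mul_le_of_snd_input_dominates hxs.2 hys.2 hz h
      _ ≤ _ := by gcongr; exact le_add_self.trans le_add_self
  · rw [cutKernel_true_eq hxs.2 hys.2 hz]
    calc _ ≤ (2 * phaseMod τ z ^ (1 / 2 : ℝ)) * phaseMod τ z ^ (-(1 / 2) : ℝ) *
          (f x * g (-x - z)) := by gcongr; exact h.1
      _ = 2 * (f x * g (-x - z)) := by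
          rw [mul_assoc 2, phaseMod_half_split]; ring
      _ = 2 * ((liftMod τ (1 / 3) f x * phaseMod τ x ^ (-(1 / 3) : ℝ)) *
          (liftMod τ (1 / 3) g (-x - z) * phaseMod τ (-x - z) ^ (-(1 / 3) : ℝ))) := by
          rw [liftMod_mul_inv, liftMod_mul_inv]
      _ = 2 * (liftMod τ (1 / 3) f x * liftMod τ (1 / 3) g (-x - z) *
          (phaseMod τ x ^ (-(1 / 3) : ℝ) * phaseMod τ (-x - z) ^ (-(1 / 3) : ℝ))) := by ring
      _ ≤ _ := by gcongr; exact le_self_add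

end Estimates

/-! ### The l²L¹ norm when the output modulation is largest. -/

section ResonantPart

variable {τ : ℝ}

theorem measurable_resonantIntegrand {f g : Phase τ → ℝ≥0∞} (hf : Measurable f)
    (hg : Measurable g) :
    Measurable fun p : Phase τ × Phase τ => resonantIntegrand τ f g p.1 p.2 := by
  have h1 : Measurable fun p : Phase τ × Phase τ => -p.1 - p.2 := by
    simp only [sub_eq_add_neg]; fun_prop
  have hM : ∀ F : ℤ → ℤ → ℝ≥0∞, Measurable fun p : Phase τ × Phase τ => F p.1.1 p.2.1 := fun F => by
    have : Measurable (Function.uncurry F) := measurable_from_prod_countable_right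
      fun _ => measurable_from_top
    exact this.comp (f := fun p : Phase τ × Phase τ => (p.1.1, p.2.1)) (by fun_prop)
  have h2 := hM fun a b => (b.natAbs : ℝ≥0∞) * a.natAbs * (-a - b).natAbs
  have h3 := hM fun a b => (b.natAbs : ℝ≥0∞) * (-(-a - b) - b).natAbs * (-a - b).natAbs
  have h4 : Measurable fun p : Phase τ × Phase τ => phaseMod τ (-p.1 - p.2) :=
    measurable_phaseMod.comp h1
  have h5 : Measurable fun p : Phase τ × Phase τ => phaseMod τ p.1 :=
    measurable_phaseMod.comp measurable_fst
  exact ((hf.comp measurable_fst).mul ((h5.max h2).pow_const _)).mul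
    ((hg.comp h1).mul ((h4.max h3).pow_const _))

/-- When an input pays, L_z^(-2/3) is kept outside for a later Cauchy-Schwarz in σ. When the output
dominates, 2L_z exceeds both input modulations and the product of frequencies, so each half of
L_z^(-1) goes to one input; this costs the factor 4 = 2·2. -/
theorem derivSymbol_mul_phaseConv_le_resonant [Fact (0 < τ)] {f g : Phase τ → ℝ≥0∞} (hf : Measurable f)
    (hg : Measurable g) (hfs : IsLowFreq τ f) (hgs : IsLowFreq τ g) (z : Phase τ) :
    derivSymbol τ z.1 * phaseMod τ z ^ (-1 : ℝ) * phaseConv τ f g z ≤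
      2 * (phaseMod τ z ^ (-(2 / 3) : ℝ) * (convOutput τ f g z + convOutput τ g f z)) +
      4 * (derivSymbol τ z.1 * resonantPart τ f g z) := by
  by_cases hz : z.1 ∈ lowFreq τ
  swap
  · simp [derivSymbol_of_notMem hz]
  have hL : ∀ c : ℝ, phaseMod τ z ^ c ≠ ∞ := fun c =>
    ENNReal.rpow_ne_top_of_ne_zero (phaseMod_ne_zero z) (phaseMod_ne_top z)
  rw [convOutput_swap f g]
  unfold convOutput trilinearOp phaseConv resonantPart
  dsimp only
  have m2 := measurable_shift_cut (measurable_liftMod (b := 1 / 2) hf)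
    (measurable_liftMod (b := 1 / 3) hg) z
    (K := fun x y z => cutKernel τ (fun _ _ _ => True) y z x) measurable_cutKernel_true_rot
  have m3 : Measurable fun x => 4 * (derivSymbol τ z.1 * resonantIntegrand τ f g x z) :=
    (((measurable_resonantIntegrand hf hg).comp
      (measurable_id.prodMk measurable_const)).const_mul _).const_mul _
  rw [← lintegral_const_mul' _ _ (ENNReal.mul_ne_top (derivSymbol_ne_top _) (hL _)),
    ← lintegral_add_left m2, ← lintegral_const_mul' _ _ (hL _), ← lintegral_const_mul' _ _ (by simp),
    ← lintegral_const_mul' _ _ (derivSymbol_ne_top _), ← lintegral_const_mul' _ _ (by simp),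
    ← lintegral_add_right _ m3]
  refine lintegral_mono fun x => ?_
  dsimp only
  by_cases hxs : x.1 = 0 ∨ x.1 ∉ lowFreq τ
  · simp [hfs x hxs]
  by_cases hys : (-x - z).1 = 0 ∨ (-x - z).1 ∉ lowFreq τ
  · simp [hgs _ hys]
  push Not at hxs hys
  have hsplit : phaseMod τ z ^ (-1 : ℝ) =
      phaseMod τ z ^ (-(2 / 3) : ℝ) * phaseMod τ z ^ (-(1 / 3) : ℝ) := by
    rw [← ENNReal.rpow_add _ _ (phaseMod_ne_zero z) (phaseMod_ne_top z)]; norm_num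
  have hsplit' : phaseMod τ z ^ (-1 : ℝ) =
      phaseMod τ z ^ (-(1 / 2) : ℝ) * phaseMod τ z ^ (-(1 / 2) : ℝ) := by
    rw [← ENNReal.rpow_add _ _ (phaseMod_ne_zero z) (phaseMod_ne_top z)]; norm_num
  set A := liftMod τ (1 / 2) f x * liftMod τ (1 / 3) g (-x - z) *
    cutKernel τ (fun _ _ _ => True) (-x - z) z x
  set B := liftMod τ (1 / 3) f x * liftMod τ (1 / 2) g (-x - z) *
    cutKernel τ (fun _ _ _ => True) x z (-x - z)
  have hAB : ∀ E : ℝ≥0∞, E ≤ A + B →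
      f x * g (-x - z) * derivSymbol τ z.1 * phaseMod τ z ^ (-(1 / 3) : ℝ) ≤ 2 * E →
      derivSymbol τ z.1 * phaseMod τ z ^ (-1 : ℝ) * (f x * g (-x - z)) ≤
        2 * (phaseMod τ z ^ (-(2 / 3) : ℝ) * (A + B)) := fun E hE h => by
    calc _ = phaseMod τ z ^ (-(2 / 3) : ℝ) * (f x * g (-x - z) * derivSymbol τ z.1 *
          phaseMod τ z ^ (-(1 / 3) : ℝ)) := by rw [hsplit]; ring
      _ ≤ phaseMod τ z ^ (-(2 / 3) : ℝ) * (2 * E) := mul_le_mul' le_rfl h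
      _ ≤ phaseMod τ z ^ (-(2 / 3) : ℝ) * (2 * (A + B)) := by gcongr
      _ = _ := by ring
  rcases derivSymbol_cases hxs.2 hys.2 hxs.1 hys.1 with h | h | h
  · exact (hAB A le_self_add (mul_le_of_input_dominates hxs.2 hys.2 hz h)).trans le_self_add
  · exact (hAB B le_add_self (mul_le_of_snd_input_dominates hxs.2 hys.2 hz h)).trans le_self_add
  · refine le_trans ?_ le_add_self
    have hxe : -(-x - z).1 - z.1 = x.1 := by simp
    have hz2 : phaseMod τ z ≤ 2 * phaseMod τ z := by rw [two_mul]; exact le_self_add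
    have h1 : phaseMod τ z ^ (-(1 / 2) : ℝ) ≤ 2 * max (phaseMod τ x)
        ((z.1.natAbs : ℝ≥0∞) * x.1.natAbs * (-x.1 - z.1).natAbs) ^ (-(1 / 2) : ℝ) :=
      rpow_neg_le_two_mul (max_le (h.2.1.trans hz2) h.2.2.2) (by norm_num) (by norm_num)
    have h2 : phaseMod τ z ^ (-(1 / 2) : ℝ) ≤ 2 * max (phaseMod τ (-x - z))
        ((z.1.natAbs : ℝ≥0∞) * (-(-x - z).1 - z.1).natAbs * (-x - z).1.natAbs) ^
          (-(1 / 2) : ℝ) := by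
      rw [hxe]
      exact rpow_neg_le_two_mul (max_le (h.2.2.1.trans hz2) h.2.2.2) (by norm_num) (by norm_num)
    rw [hsplit']
    unfold resonantIntegrand
    refine (mul_le_mul' (mul_le_mul' le_rfl (mul_le_mul' h1 h2)) le_rfl).trans_eq ?_
    ring

/-- Cauchy-Schwarz against L^(-1/3) max(L, M)^(-1/2), whose square integrates to order M^(1 - 2/3 -
1). -/
theorem lintegral_modulated_sq_le : ∃ C : ℝ≥0∞, C ≠ ∞ ∧ ∀ (τ : ℝ) [Fact (0 < τ)]
    (f : Phase τ → ℝ≥0∞) (_ : Measurable f) (n : ℤ) (M : ℝ≥0∞), M ≠ 0 → M ≠ ∞ →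
    (∫⁻ σ, f (n, σ) * max (phaseMod τ (n, σ)) M ^ (-(1 / 2) : ℝ)) ^ 2 ≤
      (∫⁻ σ, liftMod τ (1 / 3) f (n, σ) ^ 2) * (C * M ^ (-(2 / 3) : ℝ)) := by
  obtain ⟨C, hC, h⟩ := exists_lintegral_modulation_le (a := 2 / 3) (b := 1)
    (by norm_num) (by norm_num) (by norm_num) (by norm_num)
  refine ⟨C, hC, fun τ _ f hf n M hM hM' => ?_⟩
  have hpair : Measurable fun σ : FreqCircle τ => ((n, σ) : Phase τ) := by fun_prop
  have m1 : Measurable fun σ : FreqCircle τ => liftMod τ (1 / 3) f (n, σ) :=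
    (measurable_liftMod hf).comp hpair
  have m0 : Measurable fun σ : FreqCircle τ => phaseMod τ (n, σ) := measurable_phaseMod.comp hpair
  have m2 : Measurable fun σ : FreqCircle τ => phaseMod τ (n, σ) ^ (-(1 / 3) : ℝ) *
      max (phaseMod τ (n, σ)) M ^ (-(1 / 2) : ℝ) := by fun_prop
  calc _ = (∫⁻ σ, liftMod τ (1 / 3) f (n, σ) * (phaseMod τ (n, σ) ^ (-(1 / 3) : ℝ) *
        max (phaseMod τ (n, σ)) M ^ (-(1 / 2) : ℝ))) ^ 2 := by
        congr 1
        refine lintegral_congr fun σ => ?_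
        rw [← mul_assoc, liftMod_mul_inv]
    _ ≤ _ := lintegral_mul_sq_le m1.aemeasurable m2.aemeasurable
    _ ≤ _ := by
        gcongr
        have e : ∀ σ : FreqCircle τ, (phaseMod τ (n, σ) ^ (-(1 / 3) : ℝ) *
            max (phaseMod τ (n, σ)) M ^ (-(1 / 2) : ℝ)) ^ 2 =
            doublePower (2 / 3) 1 M (modulation τ (σ + (((n : ℝ) ^ 3 : ℝ) : FreqCircle τ))) := by
          intro σ
          unfold doublePower
          rw [mul_pow, ← ENNReal.rpow_natCast, ← ENNReal.rpow_mul, ← ENNReal.rpow_natCast,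
            ← ENNReal.rpow_mul]
          norm_num [phaseMod]
        simp_rw [e]
        rw [lintegral_add_right_eq_self (fun s => doublePower (2 / 3) 1 M (modulation τ s))]
        refine (h τ M hM hM').trans_eq ?_
        norm_num

theorem tsum_sq_le_of_sq_le {ι : Type*} {t p q : ι → ℝ≥0∞} (h : ∀ i, t i ^ 2 ≤ p i * q i) :
    (∑' i, t i) ^ 2 ≤ (∑' i, p i) * ∑' i, q i := by
  have e : ∀ a : ℝ≥0∞, (a ^ (1 / 2 : ℝ)) ^ 2 = a := fun a => by
    rw [← ENNReal.rpow_natCast, ← ENNReal.rpow_mul]; norm_num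
  have h1 : ∀ i, t i ≤ p i ^ (1 / 2 : ℝ) * q i ^ (1 / 2 : ℝ) := fun i => by
    rw [← ENNReal.mul_rpow_of_nonneg _ _ (by norm_num)]
    refine le_of_eq_of_le ?_ (ENNReal.rpow_le_rpow (h i) (by norm_num))
    rw [← ENNReal.rpow_natCast, ← ENNReal.rpow_mul]; norm_num
  calc (∑' i, t i) ^ 2 ≤ (∑' i, p i ^ (1 / 2 : ℝ) * q i ^ (1 / 2 : ℝ)) ^ 2 := by
        gcongr with i; exact h1 i
    _ ≤ _ := tsum_mul_sq_le _ _
    _ = _ := by simp only [e]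

/-- The larger of N and M is at least K/2 and at least 1, so K^(2/3) times its power -4/3 is at most
2; only the smaller one's power remains. -/
theorem rpow_frequency_le {K N M : ℝ} (hK : 0 < K) (hN : 1 ≤ N) (hM : 1 ≤ M) (h : K ≤ N + M) :
    K ^ 2 * (K * N * M) ^ (-(4 / 3) : ℝ) ≤ 2 * (N ^ (-(4 / 3) : ℝ) + M ^ (-(4 / 3) : ℝ)) := by
  have aux : ∀ N M : ℝ, 1 ≤ N → 1 ≤ M → N ≤ M → K ≤ N + M →
      K ^ 2 * (K * N * M) ^ (-(4 / 3) : ℝ) ≤ 2 * N ^ (-(4 / 3) : ℝ) := by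
    intro N M hN hM hNM h
    have hN0 : 0 < N := by linarith
    have hM0 : 0 < M := by linarith
    have e : K ^ 2 * (K * N * M) ^ (-(4 / 3) : ℝ) =
        K ^ (2 / 3 : ℝ) * M ^ (-(4 / 3) : ℝ) * N ^ (-(4 / 3) : ℝ) := by
      rw [Real.mul_rpow (by positivity) hM0.le, Real.mul_rpow hK.le hN0.le]
      have : K ^ (2 / 3 : ℝ) = K ^ 2 * K ^ (-(4 / 3) : ℝ) := by
        rw [← Real.rpow_natCast, ← Real.rpow_add hK]; norm_num
      rw [this]; ring
    rw [e]
    gcongr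
    have hK2 : K / M ≤ 2 := by rw [div_le_iff₀ hM0]; linarith
    calc K ^ (2 / 3 : ℝ) * M ^ (-(4 / 3) : ℝ)
        = (K / M) ^ (2 / 3 : ℝ) * M ^ (-(2 / 3) : ℝ) := by
          rw [Real.div_rpow hK.le hM0.le, div_eq_mul_inv (K ^ (2 / 3 : ℝ)),
            ← Real.rpow_neg hM0.le, mul_assoc, ← Real.rpow_add hM0]
          norm_num
      _ ≤ 2 * 1 := by
          gcongr
          · calc (K / M) ^ (2 / 3 : ℝ) ≤ 2 ^ (2 / 3 : ℝ) := by gcongr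
              _ ≤ 2 ^ (1 : ℝ) := Real.rpow_le_rpow_of_exponent_le (by norm_num) (by norm_num)
              _ = 2 := Real.rpow_one 2
          · exact Real.rpow_le_one_of_one_le_of_nonpos hM (by norm_num)
      _ = 2 := by norm_num
  have hN' : 0 ≤ N ^ (-(4 / 3) : ℝ) := by positivity
  have hM' : 0 ≤ M ^ (-(4 / 3) : ℝ) := by positivity
  rcases le_total N M with hNM | hNM
  · have := aux N M hN hM hNM h
    linarith
  · have := aux M N hM hN hNM (by linarith)
    rw [mul_right_comm K M N] at this
    linarith

/-- The `|n|^(-4/3)` weight on the frequencies. -/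
noncomputable def freqWeight (n : ℤ) : ℝ≥0∞ := ENNReal.ofReal (|(n : ℝ)| ^ (-(4 / 3) : ℝ))

theorem tsum_freqWeight_ne_top : ∑' n : ℤ, freqWeight n ≠ ∞ :=
  (Real.summable_abs_int_rpow (by norm_num : (1 : ℝ) < 4 / 3)).tsum_ofReal_ne_top

theorem natAbs_sq_mul_rpow_le {k n m : ℤ} (hk : k ≠ 0) (hn : n ≠ 0) (hm : m ≠ 0)
    (h : k.natAbs ≤ n.natAbs + m.natAbs) :
    (k.natAbs : ℝ≥0∞) ^ 2 * ((k.natAbs : ℝ≥0∞) * n.natAbs * m.natAbs) ^ (-(4 / 3) : ℝ) ≤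
      2 * (freqWeight n + freqWeight m) := by
  have hk' : (0 : ℝ) < k.natAbs := by exact_mod_cast Int.natAbs_pos.2 hk
  have hn' : (1 : ℝ) ≤ n.natAbs := by exact_mod_cast Int.natAbs_pos.2 hn
  have hm' : (1 : ℝ) ≤ m.natAbs := by exact_mod_cast Int.natAbs_pos.2 hm
  have h' : (k.natAbs : ℝ) ≤ n.natAbs + m.natAbs := by exact_mod_cast h
  have key := ENNReal.ofReal_le_ofReal (rpow_frequency_le hk' hn' hm' h')
  have hpos : (0 : ℝ) < (k.natAbs : ℝ) * n.natAbs * m.natAbs := by positivity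
  rw [ENNReal.ofReal_mul (by positivity), ENNReal.ofReal_pow (by positivity),
    ← ENNReal.ofReal_rpow_of_pos hpos, ENNReal.ofReal_mul (by positivity),
    ENNReal.ofReal_mul (by positivity), ENNReal.ofReal_mul (by norm_num),
    ENNReal.ofReal_add (by positivity) (by positivity)] at key
  have e : ∀ j : ℤ, freqWeight j = ENNReal.ofReal ((j.natAbs : ℝ) ^ (-(4 / 3) : ℝ)) := fun j => by
    unfold freqWeight; rw [Nat.cast_natAbs, Int.cast_abs]
  rw [e, e]
  simp only [ENNReal.ofReal_natCast, ENNReal.ofReal_ofNat] at key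
  exact key

/-- For fixed frequencies each factor depends on its own σ only, so the integral over the output σ
decouples the convolution into a product. -/
theorem lintegral_resonantPart [Fact (0 < τ)] {f g : Phase τ → ℝ≥0∞} (hf : Measurable f)
    (hg : Measurable g) (k : ℤ) :
    ∫⁻ σ, resonantPart τ f g (k, σ) = ∑' n : ℤ,
      (∫⁻ σ, f (n, σ) * max (phaseMod τ (n, σ))
        ((k.natAbs : ℝ≥0∞) * n.natAbs * (-n - k).natAbs) ^ (-(1 / 2) : ℝ)) *
      ∫⁻ σ, g (-n - k, σ) * max (phaseMod τ (-n - k, σ))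
        ((k.natAbs : ℝ≥0∞) * n.natAbs * (-n - k).natAbs) ^ (-(1 / 2) : ℝ) := by
  have hm := measurable_resonantIntegrand hf hg
  have hm' : Measurable fun p : FreqCircle τ × Phase τ => (p.2, ((k, p.1) : Phase τ)) := by fun_prop
  have hm2 : Measurable (Function.uncurry fun (σ : FreqCircle τ) (x : Phase τ) =>
      resonantIntegrand τ f g x (k, σ)) := hm.comp hm'
  unfold resonantPart
  rw [lintegral_lintegral_swap hm2.aemeasurable, lintegral_phase hm2.lintegral_prod_left]
  refine tsum_congr fun n => ?_
  have hA : Measurable fun σ : FreqCircle τ => f (n, σ) * max (phaseMod τ (n, σ))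
      ((k.natAbs : ℝ≥0∞) * n.natAbs * (-n - k).natAbs) ^ (-(1 / 2) : ℝ) := by
    have hpair : Measurable fun σ : FreqCircle τ => ((n, σ) : Phase τ) := by fun_prop
    exact (hf.comp hpair).mul (((measurable_phaseMod.comp hpair).max measurable_const).pow_const _)
  rw [← lintegral_mul_const _ hA]
  refine lintegral_congr fun s => ?_
  have hB : Measurable fun σ : FreqCircle τ => g (-n - k, σ) * max (phaseMod τ (-n - k, σ))
      ((k.natAbs : ℝ≥0∞) * n.natAbs * (-n - k).natAbs) ^ (-(1 / 2) : ℝ) := by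
    have hpair : Measurable fun σ : FreqCircle τ => ((-n - k, σ) : Phase τ) := by fun_prop
    exact (hg.comp hpair).mul (((measurable_phaseMod.comp hpair).max measurable_const).pow_const _)
  have hsub : Measurable fun σ : FreqCircle τ => -s - σ := by simp only [sub_eq_add_neg]; fun_prop
  have hBs : Measurable fun σ : FreqCircle τ => g (-n - k, -s - σ) *
      max (phaseMod τ (-n - k, -s - σ))
        ((k.natAbs : ℝ≥0∞) * n.natAbs * (-n - k).natAbs) ^ (-(1 / 2) : ℝ) := hB.comp hsub
  rw [← lintegral_sub_left_eq_self (μ := (volume : Measure (FreqCircle τ)))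
    (fun σ => g (-n - k, σ) * max (phaseMod τ (-n - k, σ))
      ((k.natAbs : ℝ≥0∞) * n.natAbs * (-n - k).natAbs) ^ (-(1 / 2) : ℝ)) (-s),
    ← lintegral_const_mul _ hBs]
  refine lintegral_congr fun σ => ?_
  have e : -(-n - k) - k = n := by ring
  have e2 : (-((n, s) : Phase τ) - (k, σ)) = (-n - k, -s - σ) := rfl
  simp only [resonantIntegrand, e2, e]

theorem tsum_tsum_shift_mul (a b : ℤ → ℝ≥0∞) :
    ∑' k : ℤ, ∑' n : ℤ, a n * b (-n - k) = (∑' n, a n) * ∑' n, b n := by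
  rw [ENNReal.tsum_comm, ← ENNReal.tsum_mul_right]
  refine tsum_congr fun n => ?_
  rw [ENNReal.tsum_mul_left]
  congr 1
  exact (Equiv.subLeft (-n)).tsum_eq b

theorem phaseNormSq_eq_tsum [Fact (0 < τ)] {b : ℝ} {f : Phase τ → ℝ≥0∞} (hf : Measurable f) :
    phaseNormSq τ b f = ∑' n : ℤ, ∫⁻ σ, liftMod τ b f (n, σ) ^ 2 :=
  lintegral_phase ((measurable_liftMod hf).pow_const 2)

/-- Each input contributes M^(-2/3) to the square of the n-th term, where M = |k n (n + k)|. Then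
k²M^(-4/3) is dominated by weights summable in n, and Cauchy-Schwarz in n closes the sum. -/
theorem exists_tsum_resonantPart_sq_le : ∃ C : ℝ≥0∞, C ≠ ∞ ∧ ∀ (τ : ℝ) [Fact (0 < τ)]
    (f g : Phase τ → ℝ≥0∞), Measurable f → Measurable g → IsLowFreq τ f → IsLowFreq τ g →
    ∑' k : ℤ, (derivSymbol τ k * ∫⁻ σ, resonantPart τ f g (k, σ)) ^ 2 ≤
      C * (phaseNormSq τ (1 / 3) f * phaseNormSq τ (1 / 3) g) := by
  obtain ⟨C, hC, h⟩ := lintegral_modulated_sq_le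
  set Z := ∑' n : ℤ, freqWeight n with hZ
  refine ⟨C ^ 2 * 2 * (Z + Z), ENNReal.mul_ne_top (ENNReal.mul_ne_top (ENNReal.pow_ne_top hC)
    (by simp)) (ENNReal.add_ne_top.2 ⟨tsum_freqWeight_ne_top, tsum_freqWeight_ne_top⟩),
    fun τ _ f g hf hg hfs hgs => ?_⟩
  set a : ℤ → ℝ≥0∞ := fun n => ∫⁻ σ, liftMod τ (1 / 3) f (n, σ) ^ 2
  set b : ℤ → ℝ≥0∞ := fun n => ∫⁻ σ, liftMod τ (1 / 3) g (n, σ) ^ 2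
  have key : ∀ k : ℤ, (derivSymbol τ k * ∫⁻ σ, resonantPart τ f g (k, σ)) ^ 2 ≤
      (∑' n : ℤ, C ^ 2 * 2 * (a n * b (-n - k))) * (Z + Z) := fun k => by
    have hZZ : Z + Z = ∑' n : ℤ, (freqWeight n + freqWeight (-n - k)) := by
      rw [ENNReal.tsum_add]
      congr 1
      rw [← (Equiv.subRight k).tsum_eq, ← (Equiv.neg ℤ).tsum_eq] at hZ
      exact hZ
    rw [hZZ, lintegral_resonantPart hf hg, ← ENNReal.tsum_mul_left]
    refine tsum_sq_le_of_sq_le fun n => ?_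
    rcases eq_or_ne n 0 with hn | hn
    · simp [hn, hfs (0, _) (Or.inl rfl)]
    rcases eq_or_ne (-n - k) 0 with hm | hm
    · simp [hm, hgs (0, _) (Or.inl rfl)]
    rcases eq_or_ne k 0 with hk | hk
    · have h0 : derivSymbol τ 0 = 0 := Set.indicator_apply_eq_zero.2 fun _ => by simp
      simp [hk, h0]
    have hd : derivSymbol τ k ≤ (k.natAbs : ℝ≥0∞) := Set.indicator_le_self _ _ _
    set M : ℝ≥0∞ := (k.natAbs : ℝ≥0∞) * n.natAbs * (-n - k).natAbs with hM
    have hM0 : M ≠ 0 := by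
      simp only [hM, ne_eq, mul_eq_zero, Nat.cast_eq_zero, Int.natAbs_eq_zero]; tauto
    have hM' : M ≠ ∞ := by
      simp only [hM]
      exact ENNReal.mul_ne_top (ENNReal.mul_ne_top (by simp) (by simp)) (by simp)
    have hfreq := natAbs_sq_mul_rpow_le hk hn hm (by omega)
    have hMM : M ^ (-(2 / 3) : ℝ) * M ^ (-(2 / 3) : ℝ) = M ^ (-(4 / 3) : ℝ) := by
      rw [← ENNReal.rpow_add _ _ hM0 hM']; norm_num
    calc _ = derivSymbol τ k ^ 2 * ((∫⁻ σ, f (n, σ) * max (phaseMod τ (n, σ)) M ^ (-(1 / 2) : ℝ)) ^ 2 *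
          (∫⁻ σ, g (-n - k, σ) * max (phaseMod τ (-n - k, σ)) M ^ (-(1 / 2) : ℝ)) ^ 2) := by ring
      _ ≤ (k.natAbs : ℝ≥0∞) ^ 2 * ((a n * (C * M ^ (-(2 / 3) : ℝ))) *
          (b (-n - k) * (C * M ^ (-(2 / 3) : ℝ)))) := by
          gcongr
          · exact h τ f hf n M hM0 hM'
          · exact h τ g hg (-n - k) M hM0 hM'
      _ = C ^ 2 * (a n * b (-n - k)) *
          ((k.natAbs : ℝ≥0∞) ^ 2 * (M ^ (-(2 / 3) : ℝ) * M ^ (-(2 / 3) : ℝ))) := by ring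
      _ ≤ C ^ 2 * (a n * b (-n - k)) * (2 * (freqWeight n + freqWeight (-n - k))) := by
          rw [hMM]; gcongr
      _ = _ := by ring
  calc _ ≤ ∑' k : ℤ, (∑' n : ℤ, C ^ 2 * 2 * (a n * b (-n - k))) * (Z + Z) :=
        ENNReal.tsum_le_tsum key
    _ = _ := by
        rw [ENNReal.tsum_mul_right]
        simp_rw [ENNReal.tsum_mul_left]
        rw [tsum_tsum_shift_mul, phaseNormSq_eq_tsum hf, phaseNormSq_eq_tsum hg]
        ring

end ResonantPart

/-! ### The two bilinear estimates for nonnegative amplitudes. -/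

section Bilinear

theorem measurable_phaseConv {τ : ℝ} [Fact (0 < τ)] {f g : Phase τ → ℝ≥0∞} (hf : Measurable f)
    (hg : Measurable g) : Measurable (phaseConv τ f g) :=
  (measurable_mul_shift hf hg).lintegral_prod_left'

theorem measurable_derivSymbol {τ : ℝ} : Measurable fun z : Phase τ => derivSymbol τ z.1 :=
  (measurable_from_top (f := derivSymbol τ)).comp measurable_fst

/-- The right-hand side of the bilinear estimate (squared). -/
noncomputable def bilinearBound (τ : ℝ) [Fact (0 < τ)] (f g : Phase τ → ℝ≥0∞) : ℝ≥0∞ :=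
  phaseNormSq τ (1 / 2) f * phaseNormSq τ (1 / 3) g +
    phaseNormSq τ (1 / 2) g * phaseNormSq τ (1 / 3) f

theorem phaseNormSq_third_mul_le {τ : ℝ} [Fact (0 < τ)] (f g : Phase τ → ℝ≥0∞) :
    phaseNormSq τ (1 / 3) f * phaseNormSq τ (1 / 3) g ≤ bilinearBound τ f g :=
  (mul_le_mul' (phaseNormSq_mono (by norm_num) f) le_rfl).trans le_self_add

theorem exists_lintegral_convOutput_le : ∃ C : ℝ≥0∞, C ≠ ∞ ∧ ∀ (τ : ℝ) [Fact (0 < τ)]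
    (f g : Phase τ → ℝ≥0∞), Measurable f → Measurable g →
    ∫⁻ z, convInputs τ f g z ^ 2 ∂phaseMeasure τ ≤ C * bilinearBound τ f g ∧
    ∫⁻ z, (convOutput τ f g z + convOutput τ g f z) ^ 2 ∂phaseMeasure τ ≤ C * bilinearBound τ f g := by
  obtain ⟨C, hC, h⟩ := exists_strichartz
  refine ⟨4 * C, ENNReal.mul_ne_top (by simp) hC, fun τ _ f g hf hg => ⟨?_, ?_⟩⟩
  · calc _ ≤ C * (phaseNormSq τ (1 / 3) f * phaseNormSq τ (1 / 3) g) :=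
          (h τ _ _ (measurable_liftMod hf) (measurable_liftMod hg)).1
      _ ≤ C * bilinearBound τ f g := mul_le_mul' le_rfl (phaseNormSq_third_mul_le f g)
      _ ≤ 4 * C * bilinearBound τ f g := by
          gcongr
          exact le_mul_of_one_le_left zero_le (by norm_num)
  · have h1 : ∫⁻ z, convOutput τ f g z ^ 2 ∂phaseMeasure τ ≤
        C * (phaseNormSq τ (1 / 2) f * phaseNormSq τ (1 / 3) g) :=
      (h τ _ _ (measurable_liftMod hf) (measurable_liftMod hg)).2
    have h2 : ∫⁻ z, convOutput τ g f z ^ 2 ∂phaseMeasure τ ≤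
        C * (phaseNormSq τ (1 / 2) g * phaseNormSq τ (1 / 3) f) :=
      (h τ _ _ (measurable_liftMod hg) (measurable_liftMod hf)).2
    calc _ ≤ ∫⁻ z, 4 * (convOutput τ f g z ^ 2 + convOutput τ g f z ^ 2) ∂phaseMeasure τ :=
          lintegral_mono fun z => ennreal_add_sq_le _ _
      _ = 4 * (∫⁻ z, convOutput τ f g z ^ 2 ∂phaseMeasure τ +
          ∫⁻ z, convOutput τ g f z ^ 2 ∂phaseMeasure τ) := by
          rw [lintegral_const_mul' _ _ (by simp),
            lintegral_add_left ((measurable_convOutput hf hg).pow_const 2)]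
      _ ≤ 4 * (C * (phaseNormSq τ (1 / 2) f * phaseNormSq τ (1 / 3) g) +
          C * (phaseNormSq τ (1 / 2) g * phaseNormSq τ (1 / 3) f)) := by gcongr
      _ = _ := by unfold bilinearBound; ring

theorem exists_bilinear_l2_le : ∃ C : ℝ≥0∞, C ≠ ∞ ∧ ∀ (τ : ℝ) [Fact (0 < τ)]
    (f g : Phase τ → ℝ≥0∞), Measurable f → Measurable g → IsLowFreq τ f → IsLowFreq τ g →
    ∫⁻ z, (derivSymbol τ z.1 * phaseMod τ z ^ (-(1 / 2) : ℝ) * phaseConv τ f g z) ^ 2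
      ∂phaseMeasure τ ≤ C * bilinearBound τ f g := by
  obtain ⟨C, hC, h⟩ := exists_lintegral_convOutput_le
  refine ⟨32 * C, ENNReal.mul_ne_top (by simp) hC, fun τ _ f g hf hg hfs hgs => ?_⟩
  obtain ⟨h1, h2⟩ := h τ f g hf hg
  calc _ ≤ ∫⁻ z, 16 * (convInputs τ f g z ^ 2 +
        (convOutput τ f g z + convOutput τ g f z) ^ 2) ∂phaseMeasure τ := by
        refine lintegral_mono fun z => ?_
        refine (pow_le_pow_left₀ zero_le (derivSymbol_mul_phaseConv_le hf hg hfs hgs z) 2).trans ?_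
        rw [mul_pow]
        refine (mul_le_mul' le_rfl (ennreal_add_sq_le _ _)).trans_eq ?_
        ring
    _ = 16 * (∫⁻ z, convInputs τ f g z ^ 2 ∂phaseMeasure τ +
        ∫⁻ z, (convOutput τ f g z + convOutput τ g f z) ^ 2 ∂phaseMeasure τ) := by
        rw [lintegral_const_mul' _ _ (by simp),
          lintegral_add_left ((measurable_convInputs hf hg).pow_const 2)]
    _ ≤ 16 * (C * bilinearBound τ f g + C * bilinearBound τ f g) := by gcongr
    _ = _ := by ring

/-- The square L^(-4/3) is integrable over the circle uniformly in τ. It is the double power with R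
= 1, because L ≥ 1. -/
theorem exists_tsum_weighted_sq_le : ∃ C : ℝ≥0∞, C ≠ ∞ ∧ ∀ (τ : ℝ) [Fact (0 < τ)]
    (F : Phase τ → ℝ≥0∞), Measurable F →
    ∑' k : ℤ, (∫⁻ σ, phaseMod τ (k, σ) ^ (-(2 / 3) : ℝ) * F (k, σ)) ^ 2 ≤
      C * ∫⁻ z, F z ^ 2 ∂phaseMeasure τ := by
  obtain ⟨C, hC, h⟩ := exists_lintegral_modulation_le (a := 2 / 3) (b := 2 / 3)
    (by norm_num) (by norm_num) (by norm_num) (by norm_num)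
  refine ⟨C, hC, fun τ _ F hF => ?_⟩
  rw [lintegral_phase (hF.pow_const 2), ← ENNReal.tsum_mul_left]
  refine ENNReal.tsum_le_tsum fun k => ?_
  have hpair : Measurable fun σ : FreqCircle τ => ((k, σ) : Phase τ) := by fun_prop
  have m0 : Measurable fun σ : FreqCircle τ => phaseMod τ (k, σ) ^ (-(2 / 3) : ℝ) :=
    (measurable_phaseMod.comp hpair).pow_const _
  refine (lintegral_mul_sq_le m0.aemeasurable (hF.comp hpair).aemeasurable).trans ?_
  refine mul_le_mul' ?_ le_rfl
  have e : ∀ σ : FreqCircle τ, (phaseMod τ (k, σ) ^ (-(2 / 3) : ℝ)) ^ 2 =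
      doublePower (2 / 3) (2 / 3) 1 (modulation τ (σ + (((k : ℝ) ^ 3 : ℝ) : FreqCircle τ))) := by
    intro σ
    unfold doublePower phaseMod
    rw [max_eq_left (one_le_modulation _), sq]
  simp_rw [e]
  rw [lintegral_add_right_eq_self (fun s => doublePower (2 / 3) (2 / 3) 1 (modulation τ s))]
  simpa using h τ 1 one_ne_zero ENNReal.one_ne_top

theorem exists_bilinear_l1_le : ∃ C : ℝ≥0∞, C ≠ ∞ ∧ ∀ (τ : ℝ) [Fact (0 < τ)]
    (f g : Phase τ → ℝ≥0∞), Measurable f → Measurable g → IsLowFreq τ f → IsLowFreq τ g →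
    ∑' k : ℤ, (∫⁻ σ, derivSymbol τ k * phaseMod τ (k, σ) ^ (-1 : ℝ) * phaseConv τ f g (k, σ)) ^ 2 ≤
      C * bilinearBound τ f g := by
  obtain ⟨C₁, hC₁, h1⟩ := exists_lintegral_convOutput_le
  obtain ⟨C₂, hC₂, h2⟩ := exists_tsum_weighted_sq_le
  obtain ⟨C₃, hC₃, h3⟩ := exists_tsum_resonantPart_sq_le
  refine ⟨16 * (C₂ * C₁) + 64 * C₃, ENNReal.add_ne_top.2 ⟨ENNReal.mul_ne_top (by simp)
    (ENNReal.mul_ne_top hC₂ hC₁), ENNReal.mul_ne_top (by simp) hC₃⟩, fun τ _ f g hf hg hfs hgs => ?_⟩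
  set T : Phase τ → ℝ≥0∞ := fun z => convOutput τ f g z + convOutput τ g f z with hT
  have hTm : Measurable T := (measurable_convOutput hf hg).add (measurable_convOutput hg hf)
  have key : ∀ k : ℤ,
      (∫⁻ σ, derivSymbol τ k * phaseMod τ (k, σ) ^ (-1 : ℝ) * phaseConv τ f g (k, σ)) ^ 2 ≤
      16 * (∫⁻ σ, phaseMod τ (k, σ) ^ (-(2 / 3) : ℝ) * T (k, σ)) ^ 2 +
        64 * (derivSymbol τ k * ∫⁻ σ, resonantPart τ f g (k, σ)) ^ 2 := fun k => by
    have hpair : Measurable fun σ : FreqCircle τ => ((k, σ) : Phase τ) := by fun_prop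
    have hm : Measurable fun σ => 2 * (phaseMod τ (k, σ) ^ (-(2 / 3) : ℝ) * T (k, σ)) :=
      (((measurable_phaseMod.comp hpair).pow_const _).mul (hTm.comp hpair)).const_mul 2
    calc _ ≤ (∫⁻ σ, (2 * (phaseMod τ (k, σ) ^ (-(2 / 3) : ℝ) * T (k, σ)) +
          4 * (derivSymbol τ k * resonantPart τ f g (k, σ)))) ^ 2 := by
          gcongr with σ
          exact derivSymbol_mul_phaseConv_le_resonant hf hg hfs hgs (k, σ)
      _ = (2 * (∫⁻ σ, phaseMod τ (k, σ) ^ (-(2 / 3) : ℝ) * T (k, σ)) +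
          4 * (derivSymbol τ k * ∫⁻ σ, resonantPart τ f g (k, σ))) ^ 2 := by
          rw [lintegral_add_left hm, lintegral_const_mul' _ _ (by simp),
            lintegral_const_mul' _ _ (by simp), lintegral_const_mul' _ _ (derivSymbol_ne_top _)]
      _ ≤ _ := ennreal_add_sq_le _ _
      _ = _ := by ring
  calc _ ≤ ∑' k : ℤ, (16 * (∫⁻ σ, phaseMod τ (k, σ) ^ (-(2 / 3) : ℝ) * T (k, σ)) ^ 2 +
        64 * (derivSymbol τ k * ∫⁻ σ, resonantPart τ f g (k, σ)) ^ 2) := ENNReal.tsum_le_tsum key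
    _ ≤ 16 * (C₂ * ∫⁻ z, T z ^ 2 ∂phaseMeasure τ) +
        64 * (C₃ * (phaseNormSq τ (1 / 3) f * phaseNormSq τ (1 / 3) g)) := by
        rw [ENNReal.tsum_add, ENNReal.tsum_mul_left, ENNReal.tsum_mul_left]
        gcongr
        · exact h2 τ T hTm
        · exact h3 τ f g hf hg hfs hgs
    _ ≤ 16 * (C₂ * (C₁ * bilinearBound τ f g)) + 64 * (C₃ * bilinearBound τ f g) := by
        gcongr
        · exact (h1 τ f g hf hg).2
        · exact phaseNormSq_third_mul_le f g
    _ = _ := by ring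

end Bilinear

/-! ### Fourier coefficients of trigonometric polynomials. -/

section TrigPoly

/-- The trigonometric polynomial `∑ c(k) exp (i k x)`, `k ∈ S`. -/
noncomputable def trigPoly (S : Finset ℤ) (c : ℤ → ℂ) (x : Torus) : ℂ := ∑ k ∈ S, c k * fourier k x

theorem continuous_trigPoly (S : Finset ℤ) (c : ℤ → ℂ) : Continuous (trigPoly S c) := by
  unfold trigPoly
  fun_prop

theorem integrable_continuous {f : Torus → ℂ} (hf : Continuous f) : Integrable f haarAddCircle :=
  hf.integrable_of_hasCompactSupport (HasCompactSupport.of_compactSpace f)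

theorem fourierCoeff_trigPoly (S : Finset ℤ) (c : ℤ → ℂ) (k : ℤ) :
    fourierCoeff (trigPoly S c) k = if k ∈ S then c k else 0 := by
  have e' : trigPoly S c = ∑ n ∈ S, fun x => c n * fourier n x := by
    ext x; simp [trigPoly]
  rw [e', fourierCoeff.sum _ _ (fun n _ => integrable_continuous (by fun_prop)), Finset.sum_apply]
  simp_rw [fourierCoeff.const_mul, fourierCoeff_fourier]
  simp [Pi.single_apply]

/-- The coefficients of the product of two trigonometric polynomials. -/
noncomputable def convCoeff (S : Finset ℤ) (a b : ℤ → ℂ) (k : ℤ) : ℂ :=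
  ∑ n ∈ S, if k - n ∈ S then a n * b (k - n) else 0

theorem fourierCoeff_trigPoly_mul (S : Finset ℤ) (a b : ℤ → ℂ) (k : ℤ) :
    fourierCoeff (fun x => trigPoly S a x * trigPoly S b x) k = convCoeff S a b k := by
  have e : (fun x => trigPoly S a x * trigPoly S b x) =
      ∑ n ∈ S, fun x => a n * (fourier n x * trigPoly S b x) := by
    ext x
    simp [trigPoly, Finset.sum_mul, mul_assoc]
  have hc := continuous_trigPoly S b
  rw [e, fourierCoeff.sum _ _ (fun n _ => integrable_continuous (by fun_prop)), Finset.sum_apply]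
  unfold convCoeff
  refine Finset.sum_congr rfl fun n _ => ?_
  rw [fourierCoeff.const_mul]
  have e2 : fourierCoeff (fun x => fourier n x * trigPoly S b x) k =
      fourierCoeff (trigPoly S b) (k - n) := by
    unfold fourierCoeff
    congr 1; ext x
    rw [smul_eq_mul, smul_eq_mul, ← mul_assoc, ← fourier_add]
    congr 2; ring_nf
  rw [e2, fourierCoeff_trigPoly]
  split_ifs <;> simp

theorem dx_trigPoly (S : Finset ℤ) (c : ℤ → ℂ) :
    dx (trigPoly S c) = trigPoly S fun k => Complex.I * k * c k := by
  ext x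
  induction x using QuotientAddGroup.induction_on with
  | H y =>
  unfold dx trigPoly
  refine HasDerivAt.deriv ?_
  refine HasDerivAt.fun_sum fun k _ => ?_
  have h := hasDerivAt_fourier (2 * π) k (y + 0)
  have h2 := (h.comp_const_add y 0).const_mul (c k)
  refine h2.congr_deriv ?_
  have : (π : ℂ) ≠ 0 := by exact_mod_cast Real.pi_ne_zero
  rw [add_zero]
  push_cast
  field_simp

end TrigPoly

/-! ### The filter as a finite Fourier truncation. -/

section Filter

variable (τ : ℝ) [hτ : Fact (0 < τ)]

theorem finite_lowFreq : (lowFreq τ).Finite := by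
  obtain ⟨N, hN⟩ := exists_nat_ge (1 / τ)
  refine (Set.finite_Icc (-(N : ℤ)) N).subset fun k hk => ?_
  have h0 := hτ.out
  have hk' : |(k : ℝ)| ^ 3 * τ ≤ 1 := hk
  rw [← le_div_iff₀ h0] at hk'
  have h2 : (k.natAbs : ℝ) ^ 3 ≤ N := by
    rw [Nat.cast_natAbs, Int.cast_abs]; linarith
  have h3 : k.natAbs ^ 3 ≤ N := by exact_mod_cast h2
  have h4 : k.natAbs ≤ N := (Nat.le_self_pow (by norm_num) _).trans h3
  rw [Set.mem_Icc]; omega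

/-- The finite set of low frequencies. -/
noncomputable def lowFreqs : Finset ℤ := (finite_lowFreq τ).toFinset

theorem mem_lowFreqs {k : ℤ} : k ∈ lowFreqs τ ↔ k ∈ lowFreq τ := by simp [lowFreqs]

theorem abs_mul_rpow_le_one_iff {k : ℤ} : |(k : ℝ) * τ ^ (1 / 3 : ℝ)| ≤ 1 ↔ k ∈ lowFreqs τ := by
  have h0 := hτ.out
  rw [mem_lowFreqs, lowFreq, Set.mem_ofPred_eq, abs_mul, abs_of_pos (Real.rpow_pos_of_pos h0 _)]
  have e : |(k : ℝ)| ^ 3 * τ = (|(k : ℝ)| * τ ^ (1 / 3 : ℝ)) ^ 3 := by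
    rw [mul_pow, ← Real.rpow_natCast (τ ^ (1 / 3 : ℝ)), ← Real.rpow_mul h0.le]
    norm_num
  rw [e]
  exact (pow_le_one_iff_of_nonneg (by positivity) (by norm_num)).symm

theorem filterPi_eq_trigPoly (f : Torus → ℂ) :
    filterPi τ f = trigPoly (lowFreqs τ) (fourierCoeff f) := by
  ext x
  unfold filterPi trigPoly
  simp_rw [abs_mul_rpow_le_one_iff]
  rw [tsum_eq_sum (s := lowFreqs τ) (fun k hk => if_neg hk)]
  exact Finset.sum_congr rfl fun k hk => if_pos hk

theorem bilin_eq_trigPoly (u v : ℤ → Torus → ℂ) (n : ℤ) :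
    bilin τ u v n = trigPoly (lowFreqs τ) fun k => Complex.I * k *
      convCoeff (lowFreqs τ) (fourierCoeff (u n)) (fourierCoeff (v n)) k := by
  unfold bilin
  rw [filterPi_eq_trigPoly, dx_trigPoly, filterPi_eq_trigPoly, filterPi_eq_trigPoly]
  simp_rw [fourierCoeff_trigPoly_mul]

end Filter


/-! ### Products of Fourier coefficients as convolutions. -/

section Convolution

variable {T : ℝ} [hT : Fact (0 < T)]

theorem memLp_conj_reflect (G : Lp ℂ 2 (haarAddCircle (T := T))) (σ : AddCircle T) :
    MemLp (fun t => star (G (σ - t))) 2 (haarAddCircle (T := T)) :=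
  ((Lp.memLp G).comp_measurePreserving
    (Measure.measurePreserving_sub_left (haarAddCircle (T := T)) σ)).star

/-- Parseval's identity, in the form of a convolution. -/
theorem hasSum_fourierCoeff_mul (F G : Lp ℂ 2 (haarAddCircle (T := T))) (σ : AddCircle T) :
    HasSum (fun m => fourierCoeff F m * fourierCoeff G m * fourier m σ)
      (∫ t, F t * G (σ - t) ∂haarAddCircle) := by
  -- Pairing F with the conjugate reflection of G makes the inner product equal to the convolution
  -- at σ, so Parseval for the Fourier basis applies.
  set x : Lp ℂ 2 (haarAddCircle (T := T)) := (memLp_conj_reflect G σ).toLp _ with hx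
  have hxe := (memLp_conj_reflect G σ).coeFn_toLp
  have h := fourierBasis.hasSum_inner_mul_inner x F
  have hterm : (fun m => fourierCoeff F m * fourierCoeff G m * fourier m σ) =
      fun m => inner ℂ x (fourierBasis m) * inner ℂ (fourierBasis m) F := by
    ext m
    rw [← fourierBasis.repr_apply_apply, fourierBasis_repr, coe_fourierBasis, L2.inner_def]
    have e : ∫ t, inner ℂ (x t) ((fourierLp 2 m : Lp ℂ 2 (haarAddCircle (T := T))) t) ∂haarAddCircle =
        ∫ t, G (σ - t) * fourier m t ∂haarAddCircle := by
      refine integral_congr_ae ?_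
      filter_upwards [hxe, coeFn_fourierLp 2 m] with t h1 h2
      rw [hx, h1, h2, RCLike.inner_apply']
      simp
    rw [e]
    have e2 : ∫ t, G (σ - t) * fourier m t ∂haarAddCircle =
        ∫ t, G t * fourier m (σ - t) ∂haarAddCircle := by
      rw [← integral_sub_left_eq_self _ haarAddCircle σ]
      simp
    rw [e2]
    have e3 : ∫ t, G t * fourier m (σ - t) ∂haarAddCircle =
        fourier m σ * fourierCoeff G m := by
      unfold fourierCoeff
      rw [← integral_const_mul]
      congr 1; ext t
      have : fourier m (σ - t) = fourier m σ * fourier (-m) t := by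
        simp [fourier_apply, sub_eq_add_neg, AddCircle.toCircle_add]
      rw [this, smul_eq_mul]; ring
    rw [e3]; ring
  have hval : ∫ t, F t * G (σ - t) ∂haarAddCircle = inner ℂ x F := by
    rw [L2.inner_def]
    refine integral_congr_ae ?_
    filter_upwards [hxe] with t h1
    rw [hx, h1, RCLike.inner_apply']
    simp [mul_comm]
  rw [hterm, hval]
  exact h

/-- The product of two l² sequences is l¹, so the series converges uniformly. Its continuous sum has
the Parseval value at every point, and mapping into L² keeps convergence. -/
theorem exists_hasSum_fourierLp_mul (F G : Lp ℂ 2 (haarAddCircle (T := T))) :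
    ∃ W : Lp ℂ 2 (haarAddCircle (T := T)),
      HasSum (fun m => (fourierCoeff F m * fourierCoeff G m) •
        (fourierLp 2 m : Lp ℂ 2 (haarAddCircle (T := T)))) W ∧
      ∀ᵐ σ ∂(haarAddCircle (T := T)), W σ = ∫ t, F t * G (σ - t) ∂haarAddCircle := by
  have hs : Summable fun m => fourierCoeff F m * fourierCoeff G m := by
    simpa using (hasSum_fourierCoeff_mul F G 0).summable
  have hs' : Summable fun m => (fourierCoeff F m * fourierCoeff G m) • (fourier m : C(AddCircle T, ℂ)) := by
    refine .of_norm ?_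
    simp_rw [norm_smul, fourier_norm, mul_one]
    exact hs.norm
  set h := ∑' m, (fourierCoeff F m * fourierCoeff G m) • (fourier m : C(AddCircle T, ℂ)) with hh
  refine ⟨ContinuousMap.toLp 2 haarAddCircle ℂ h, ?_, ?_⟩
  · have := hs'.hasSum.mapL (ContinuousMap.toLp (E := ℂ) 2 (haarAddCircle (T := T)) ℂ)
    simpa [fourierLp] using this
  · filter_upwards [ContinuousMap.coeFn_toLp (p := 2) (𝕜 := ℂ) haarAddCircle h] with σ hσ
    rw [hσ, ← (hasSum_fourierCoeff_mul F G σ).tsum_eq]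
    have := (ContinuousMap.evalCLM ℂ σ).map_tsum hs'
    rw [← hh] at this
    simpa using this

end Convolution

/-! ### Recovering coefficients from an L² Fourier series. -/

section SquareSummable

variable {T : ℝ} [hT : Fact (0 < T)]

theorem hasSum_fourierLp {a : ℤ → ℂ} (ha : Summable fun m => ‖a m‖ ^ 2) :
    ∃ F : Lp ℂ 2 (haarAddCircle (T := T)),
      HasSum (fun m => a m • (fourierLp 2 m : Lp ℂ 2 (haarAddCircle (T := T)))) F ∧
      ∀ m, fourierCoeff F m = a m := by
  have hm : Memℓp a 2 := memℓp_gen (by simpa using ha)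
  refine ⟨fourierBasis.repr.symm ⟨a, hm⟩, ?_, fun m => ?_⟩
  · have := (fourierBasis (T := T)).hasSum_repr_symm ⟨a, hm⟩
    rwa [coe_fourierBasis] at this
  · rw [← fourierBasis_repr, LinearIsometryEquiv.apply_symm_apply]

theorem fourierCoeff_tsum {a : ℤ → ℂ} (ha : Summable fun m => ‖a m‖ ^ 2) (m : ℤ) :
    fourierCoeff (∑' m, a m • fourierLp 2 m : Lp ℂ 2 (haarAddCircle (T := T))) m = a m := by
  obtain ⟨F, h1, h2⟩ := hasSum_fourierLp (T := T) ha
  rw [h1.tsum_eq]; exact h2 m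

end SquareSummable

/-! ### The space-time transform of the bilinear term. -/

section SpaceTime

theorem haarAddCircle_le_volume :
    (haarAddCircle (T := 2 * π)) ≤ (volume : Measure Torus) := by
  rw [volume_eq_smul_haarAddCircle]
  have h1 : (1 : ℝ≥0∞) ≤ ENNReal.ofReal (2 * π) := by
    rw [ENNReal.one_le_ofReal]; linarith [Real.pi_gt_three]
  intro s
  rw [Measure.smul_apply, smul_eq_mul]
  exact le_mul_of_one_le_left' h1

theorem ae_volume_iff_haarAddCircle {T : ℝ} [hT : Fact (0 < T)] {p : AddCircle T → Prop} :
    (∀ᵐ x, p x) ↔ ∀ᵐ x ∂(haarAddCircle (T := T)), p x := by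
  rw [volume_eq_smul_haarAddCircle]
  exact Measure.ae_ennreal_smul_measure_iff (by simpa using hT.out)

theorem lintegral_haarAddCircle {T : ℝ} [hT : Fact (0 < T)] (f : AddCircle T → ℝ≥0∞) :
    ∫⁻ x, f x ∂haarAddCircle = ENNReal.ofReal T⁻¹ * ∫⁻ x, f x := by
  rw [volume_eq_smul_haarAddCircle, lintegral_smul_measure, smul_eq_mul, ← mul_assoc,
    ← ENNReal.ofReal_mul (inv_nonneg.2 hT.out.le), inv_mul_cancel₀ hT.out.ne', ENNReal.ofReal_one,
    one_mul]

theorem enorm_fourierCoeff_sq_le {f : Torus → ℂ} (hf : AEStronglyMeasurable f volume) (k : ℤ) :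
    ‖fourierCoeff f k‖ₑ ^ 2 ≤ ∫⁻ x : Torus, ‖f x‖ₑ ^ 2 := by
  have h1 : ‖fourierCoeff f k‖ₑ ≤ ∫⁻ x : Torus, ‖f x‖ₑ * 1 ∂haarAddCircle := by
    refine (enorm_integral_le_lintegral_enorm _).trans (lintegral_mono fun x => ?_)
    rw [enorm_smul, ← ofReal_norm, norm_fourier_apply]
    simp
  have hf' : AEMeasurable (fun x => ‖f x‖ₑ) (haarAddCircle (T := 2 * π)) :=
    (hf.mono_measure haarAddCircle_le_volume).enorm
  calc ‖fourierCoeff f k‖ₑ ^ 2 ≤ (∫⁻ x : Torus, ‖f x‖ₑ * 1 ∂haarAddCircle) ^ 2 := by gcongr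
    _ ≤ (∫⁻ x : Torus, ‖f x‖ₑ ^ 2 ∂haarAddCircle) * ∫⁻ x : Torus, 1 ^ 2 ∂haarAddCircle :=
        lintegral_mul_sq_le hf' aemeasurable_const
    _ = ∫⁻ x : Torus, ‖f x‖ₑ ^ 2 ∂haarAddCircle := by simp
    _ ≤ _ := lintegral_mono' haarAddCircle_le_volume le_rfl

variable {τ : ℝ} [hτ : Fact (0 < τ)] {u v : ℤ → Torus → ℂ}

theorem IsL2MeanZero.tsum_energy_ne_top (hu : IsL2MeanZero τ u) :
    ∑' n : ℤ, ∫⁻ x : Torus, ‖u n x‖ₑ ^ 2 ≠ ∞ := by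
  have h := hu.l2_finite
  intro h2
  rw [h2, ENNReal.mul_top (by simpa using hτ.out)] at h
  exact lt_irrefl _ h

omit hτ in
theorem IsL2MeanZero.fourierCoeff_zero (hu : IsL2MeanZero τ u) (m : ℤ) :
    fourierCoeff (u m) 0 = 0 := by
  unfold fourierCoeff
  simp [integral_haarAddCircle, hu.mean_zero m]

theorem IsL2MeanZero.summable_fourierCoeff (hu : IsL2MeanZero τ u) (k : ℤ) :
    Summable fun m => ‖(τ : ℂ) * fourierCoeff (u m) k‖ ^ 2 := by
  have h : ∑' m, ‖fourierCoeff (u m) k‖ₑ ^ 2 ≠ ∞ := ne_top_of_le_ne_top hu.tsum_energy_ne_top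
    (ENNReal.tsum_le_tsum fun m => enorm_fourierCoeff_sq_le (hu.aestronglyMeasurable m) k)
  have h2 := ENNReal.summable_toReal h
  simp only [ENNReal.toReal_pow, toReal_enorm] at h2
  simp_rw [norm_mul, mul_pow]
  exact h2.mul_left _

theorem IsL2MeanZero.fourierCoeff_spaceTimeFourier (hu : IsL2MeanZero τ u) (k m : ℤ) :
    fourierCoeff (spaceTimeFourier τ u k) m = (τ : ℂ) * fourierCoeff (u m) k :=
  fourierCoeff_tsum (hu.summable_fourierCoeff k) m

/-- The amplitude `|ũ(σ, k)|`, cut off to the non-zero low frequencies. -/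
noncomputable def lowAmp (τ : ℝ) [Fact (0 < τ)] (u : ℤ → Torus → ℂ) (p : Phase τ) : ℝ≥0∞ :=
  {k : ℤ | k ∈ lowFreq τ ∧ k ≠ 0}.indicator (fun k => ‖spaceTimeFourier τ u k p.2‖ₑ) p.1

theorem measurable_lowAmp : Measurable (lowAmp τ u) := by
  refine measurable_from_prod_countable_right fun k => ?_
  unfold lowAmp
  by_cases hk : k ∈ {k : ℤ | k ∈ lowFreq τ ∧ k ≠ 0}
  · simp only [Set.indicator_of_mem hk]
    exact (Lp.stronglyMeasurable _).measurable.enorm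
  · simp only [Set.indicator_of_notMem hk]
    exact measurable_const

theorem isLowFreq_lowAmp : IsLowFreq τ (lowAmp τ u) := by
  rintro p h
  refine Set.indicator_of_notMem ?_ _
  rintro ⟨h1, h2⟩
  exact h.elim h2 fun h3 => h3 h1

theorem lowAmp_le (p : Phase τ) : lowAmp τ u p ≤ ‖spaceTimeFourier τ u p.1 p.2‖ₑ :=
  Set.indicator_le_self' (fun _ _ => zero_le) _

/-- Mean zero kills the mode k = 0, so excluding that frequency from the amplitude loses nothing. -/
theorem IsL2MeanZero.enorm_spaceTimeFourier_eq (hu : IsL2MeanZero τ u) {k : ℤ}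
    (hk : k ∈ lowFreq τ) :
    ∀ᵐ t ∂(haarAddCircle (T := 2 * π / τ)), ‖spaceTimeFourier τ u k t‖ₑ = lowAmp τ u (k, t) := by
  rcases eq_or_ne k 0 with rfl | h0
  · have e : spaceTimeFourier τ u 0 = 0 := by
      unfold spaceTimeFourier
      simp [hu.fourierCoeff_zero]
    rw [e]
    filter_upwards [Lp.coeFn_zero ℂ 2 (haarAddCircle (T := 2 * π / τ))] with t ht
    rw [ht, isLowFreq_lowAmp (0, t) (Or.inl rfl)]
    simp
  · refine Filter.Eventually.of_forall fun t => ?_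
    unfold lowAmp
    rw [Set.indicator_of_mem]
    exact ⟨hk, h0⟩

theorem phaseConv_neg {f g : Phase τ → ℝ≥0∞} (hf : Measurable f) (hg : Measurable g) (k : ℤ)
    (σ : FreqCircle τ) :
    phaseConv τ f g (-(k, σ)) = ∑' n : ℤ, ∫⁻ t, f (n, t) * g (k - n, σ - t) := by
  unfold phaseConv
  have e : ∀ x : Phase τ, -x - -(k, σ) = (k, σ) - x := fun x => by abel
  simp_rw [e]
  have : Measurable fun x : Phase τ => (k, σ) - x := by fun_prop
  exact lintegral_phase (f := fun x => f x * g ((k, σ) - x)) (hf.mul (hg.comp this))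

/-- Two transforms carry τ² and one carries τ, hence a factor 1/τ; the normalised Haar measure
contributes τ/(2π), leaving 1/(2π). -/
theorem IsL2MeanZero.exists_hasSum_product (hu : IsL2MeanZero τ u) (hv : IsL2MeanZero τ v)
    {n j : ℤ} (hn : n ∈ lowFreq τ) (hj : j ∈ lowFreq τ) :
    ∃ W : Lp ℂ 2 (haarAddCircle (T := 2 * π / τ)),
      HasSum (fun m => ((τ : ℂ) * (fourierCoeff (u m) n * fourierCoeff (v m) j)) •
        (fourierLp 2 m : Lp ℂ 2 (haarAddCircle (T := 2 * π / τ)))) W ∧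
      ∀ᵐ σ ∂(haarAddCircle (T := 2 * π / τ)), ‖W σ‖ₑ ≤ ENNReal.ofReal (1 / (2 * π)) *
        ∫⁻ t, lowAmp τ u (n, t) * lowAmp τ v (j, σ - t) := by
  have h0 := hτ.out
  have h0' : (τ : ℂ) ≠ 0 := by exact_mod_cast h0.ne'
  obtain ⟨W, h1, h2⟩ := exists_hasSum_fourierLp_mul (spaceTimeFourier τ u n) (spaceTimeFourier τ v j)
  refine ⟨(τ : ℂ)⁻¹ • W, ?_, ?_⟩
  · convert h1.const_smul (τ : ℂ)⁻¹ using 2 with m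
    rw [hu.fourierCoeff_spaceTimeFourier, hv.fourierCoeff_spaceTimeFourier, smul_smul]
    congr 1
    field_simp
  · filter_upwards [h2, Lp.coeFn_smul (τ : ℂ)⁻¹ W] with σ hσ hs
    rw [hs, Pi.smul_apply, hσ, enorm_smul]
    have hp : MeasurePreserving (fun t => σ - t) (haarAddCircle (T := 2 * π / τ)) haarAddCircle :=
      Measure.measurePreserving_sub_left _ σ
    have hae : ∀ᵐ t ∂(haarAddCircle (T := 2 * π / τ)),
        ‖spaceTimeFourier τ v j (σ - t)‖ₑ = lowAmp τ v (j, σ - t) :=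
      hp.quasiMeasurePreserving.ae (p := fun t => ‖spaceTimeFourier τ v j t‖ₑ = lowAmp τ v (j, t))
        (hv.enorm_spaceTimeFourier_eq hj)
    have hle : ‖∫ t, spaceTimeFourier τ u n t * spaceTimeFourier τ v j (σ - t) ∂haarAddCircle‖ₑ ≤
        ∫⁻ t, lowAmp τ u (n, t) * lowAmp τ v (j, σ - t) ∂haarAddCircle := by
      refine (enorm_integral_le_lintegral_enorm _).trans (lintegral_mono_ae ?_)
      filter_upwards [hae, hu.enorm_spaceTimeFourier_eq hn] with t ht1 ht2
      rw [enorm_mul, ht1, ht2]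
    have hc : ‖(τ : ℂ)⁻¹‖ₑ = ENNReal.ofReal τ⁻¹ := by
      rw [← ofReal_norm, norm_inv, Complex.norm_real, Real.norm_of_nonneg h0.le]
    calc _ ≤ ENNReal.ofReal τ⁻¹ *
          ∫⁻ t, lowAmp τ u (n, t) * lowAmp τ v (j, σ - t) ∂haarAddCircle := by
          rw [hc]; gcongr
      _ = _ := by
          rw [lintegral_haarAddCircle, ← mul_assoc, ← ENNReal.ofReal_mul (inv_nonneg.2 h0.le)]
          congr 2
          have := Real.pi_pos
          field_simp

theorem fourierCoeff_bilin (n k : ℤ) :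
    fourierCoeff (bilin τ u v n) k = if k ∈ lowFreqs τ then Complex.I * k *
      convCoeff (lowFreqs τ) (fourierCoeff (u n)) (fourierCoeff (v n)) k else 0 := by
  rw [bilin_eq_trigPoly, fourierCoeff_trigPoly]

omit hτ in
theorem derivSymbol_of_mem {k : ℤ} (hk : k ∈ lowFreq τ) : derivSymbol τ k = ‖(k : ℂ)‖ₑ := by
  rw [derivSymbol, Set.indicator_of_mem hk, ← ofReal_norm, Complex.norm_intCast, ← Int.cast_abs,
    ← Nat.cast_natAbs, ENNReal.ofReal_natCast]

/-- At fixed k the product has finitely many frequency pairs, so the transform is a finite sum of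
σ-convolutions, bounded term by term; the derivative contributes |k|. -/
theorem IsL2MeanZero.enorm_spaceTimeFourier_bilin_le (hu : IsL2MeanZero τ u)
    (hv : IsL2MeanZero τ v) (k : ℤ) :
    ∀ᵐ σ : FreqCircle τ, ‖spaceTimeFourier τ (bilin τ u v) k σ‖ₑ ≤
      ENNReal.ofReal (1 / (2 * π)) *
        (derivSymbol τ k * phaseConv τ (lowAmp τ u) (lowAmp τ v) (-(k, σ))) := by
  rw [ae_volume_iff_haarAddCircle]
  by_cases hk : k ∈ lowFreqs τ
  swap
  · have e : spaceTimeFourier τ (bilin τ u v) k = 0 := by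
      unfold spaceTimeFourier
      simp [fourierCoeff_bilin, hk]
    rw [e]
    filter_upwards [Lp.coeFn_zero ℂ 2 (haarAddCircle (T := 2 * π / τ))] with t ht
    rw [ht]
    simp
  have hW : ∀ n : ℤ, ∃ W : Lp ℂ 2 (haarAddCircle (T := 2 * π / τ)),
      HasSum (fun m => ((τ : ℂ) * if n ∈ lowFreqs τ ∧ k - n ∈ lowFreqs τ then
          fourierCoeff (u m) n * fourierCoeff (v m) (k - n) else 0) •
        (fourierLp 2 m : Lp ℂ 2 (haarAddCircle (T := 2 * π / τ)))) W ∧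
      ∀ᵐ σ ∂(haarAddCircle (T := 2 * π / τ)), ‖W σ‖ₑ ≤ ENNReal.ofReal (1 / (2 * π)) *
        ∫⁻ t, lowAmp τ u (n, t) * lowAmp τ v (k - n, σ - t) := by
    intro n
    by_cases hn : n ∈ lowFreqs τ ∧ k - n ∈ lowFreqs τ
    · simp only [hn, and_self, if_true]
      exact hu.exists_hasSum_product hv ((mem_lowFreqs τ).1 hn.1) ((mem_lowFreqs τ).1 hn.2)
    · refine ⟨0, by simp [hn], ?_⟩
      filter_upwards [Lp.coeFn_zero ℂ 2 (haarAddCircle (T := 2 * π / τ))] with t ht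
      rw [ht]
      simp
  choose W hW1 hW2 using hW
  have hsum : spaceTimeFourier τ (bilin τ u v) k =
      (Complex.I * k) • ∑ n ∈ lowFreqs τ, W n := by
    have h := (hasSum_sum (s := lowFreqs τ) fun n _ => hW1 n).const_smul (Complex.I * (k : ℂ))
    rw [← h.tsum_eq]
    unfold spaceTimeFourier
    refine tsum_congr fun m => ?_
    rw [fourierCoeff_bilin, if_pos hk, ← Finset.sum_smul, smul_smul]
    congr 1
    rw [← Finset.mul_sum, convCoeff]
    have : ∀ n ∈ lowFreqs τ, (if k - n ∈ lowFreqs τ then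
          fourierCoeff (u m) n * fourierCoeff (v m) (k - n) else 0) =
        if n ∈ lowFreqs τ ∧ k - n ∈ lowFreqs τ then
          fourierCoeff (u m) n * fourierCoeff (v m) (k - n) else 0 := fun n hn => by simp [hn]
    rw [Finset.sum_congr rfl this]
    ring
  rw [hsum]
  filter_upwards [Lp.coeFn_smul (Complex.I * (k : ℂ)) (∑ n ∈ lowFreqs τ, W n),
    Lp.coeFn_finsetSum (lowFreqs τ) W, ae_all_iff.2 hW2] with σ h1 h2 h3
  rw [h1, Pi.smul_apply, h2, Finset.sum_apply, enorm_smul,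
    phaseConv_neg measurable_lowAmp measurable_lowAmp, derivSymbol_of_mem ((mem_lowFreqs τ).1 hk)]
  have hI : ‖Complex.I * (k : ℂ)‖ₑ = ‖(k : ℂ)‖ₑ := by
    rw [enorm_mul, ← ofReal_norm Complex.I, Complex.norm_I, ENNReal.ofReal_one, one_mul]
  rw [hI, mul_left_comm]
  refine mul_le_mul' le_rfl ?_
  rw [← ENNReal.tsum_mul_left]
  refine (enorm_sum_le _ _).trans ?_
  exact (Finset.sum_le_sum fun n _ => h3 n).trans (ENNReal.sum_le_tsum _)

end SpaceTime

/-! ### Membership of the bilinear term in the base space. -/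

section MeanZero

theorem enorm_trigPoly_le (S : Finset ℤ) (c : ℤ → ℂ) (x : Torus) :
    ‖trigPoly S c x‖ₑ ≤ ∑ k ∈ S, ‖c k‖ₑ := by
  refine (enorm_sum_le _ _).trans (Finset.sum_le_sum fun k _ => ?_)
  rw [enorm_mul, ← ofReal_norm (fourier k x), norm_fourier_apply, ENNReal.ofReal_one, mul_one]

theorem enorm_convCoeff_le {S : Finset ℤ} {a b : ℤ → ℂ} {A B : ℝ≥0∞} (ha : ∀ k, ‖a k‖ₑ ≤ A)
    (hb : ∀ k, ‖b k‖ₑ ≤ B) (k : ℤ) : ‖convCoeff S a b k‖ₑ ≤ S.card * (A * B) := by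
  calc ‖convCoeff S a b k‖ₑ ≤ ∑ _n ∈ S, A * B := by
        refine (enorm_sum_le _ _).trans (Finset.sum_le_sum fun n _ => ?_)
        split_ifs
        · rw [enorm_mul]
          exact mul_le_mul' (ha _) (hb _)
        · simp
    _ = _ := by simp

theorem enorm_fourierCoeff_le {f : Torus → ℂ} (hf : AEStronglyMeasurable f volume) (k : ℤ) :
    ‖fourierCoeff f k‖ₑ ≤ (∫⁻ x : Torus, ‖f x‖ₑ ^ 2) ^ (1 / 2 : ℝ) := by
  have h := ENNReal.rpow_le_rpow (enorm_fourierCoeff_sq_le hf k) (by norm_num : (0 : ℝ) ≤ 1 / 2)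
  rwa [← ENNReal.rpow_natCast, ← ENNReal.rpow_mul, Nat.cast_ofNat,
    mul_one_div_cancel two_ne_zero, ENNReal.rpow_one] at h

variable {τ : ℝ} [hτ : Fact (0 < τ)] {u v : ℤ → Torus → ℂ}

/-- The constant depends on τ through the number of low frequencies, which is harmless: it serves
only to show finiteness of the l²L² norm. -/
theorem exists_enorm_bilin_sq_le (τ : ℝ) [Fact (0 < τ)] : ∃ K : ℝ≥0∞, K ≠ ∞ ∧
    ∀ u v : ℤ → Torus → ℂ, IsL2MeanZero τ u → IsL2MeanZero τ v → ∀ (n : ℤ) (x : Torus),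
      ‖bilin τ u v n x‖ₑ ^ 2 ≤
        K * ((∫⁻ x : Torus, ‖u n x‖ₑ ^ 2) * ∫⁻ x : Torus, ‖v n x‖ₑ ^ 2) := by
  set S := lowFreqs τ
  refine ⟨((∑ k ∈ S, ‖Complex.I * (k : ℂ)‖ₑ) * S.card) ^ 2,
    ENNReal.pow_ne_top (ENNReal.mul_ne_top
      (ENNReal.sum_ne_top.2 fun k _ => enorm_ne_top) (by simp)), fun u v hu hv n x => ?_⟩
  set E := ∫⁻ x : Torus, ‖u n x‖ₑ ^ 2
  set F := ∫⁻ x : Torus, ‖v n x‖ₑ ^ 2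
  have h : ‖bilin τ u v n x‖ₑ ≤
      (∑ k ∈ S, ‖Complex.I * (k : ℂ)‖ₑ) * S.card * (E ^ (1 / 2 : ℝ) * F ^ (1 / 2 : ℝ)) := by
    rw [bilin_eq_trigPoly]
    refine (enorm_trigPoly_le _ _ _).trans ?_
    rw [mul_assoc, Finset.sum_mul]
    refine Finset.sum_le_sum fun k _ => ?_
    rw [enorm_mul]
    exact mul_le_mul' le_rfl (enorm_convCoeff_le
      (enorm_fourierCoeff_le (hu.aestronglyMeasurable n))
      (enorm_fourierCoeff_le (hv.aestronglyMeasurable n)) k)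
  have e : ∀ c : ℝ≥0∞, (c ^ (1 / 2 : ℝ)) ^ 2 = c := fun c => by
    rw [← ENNReal.rpow_natCast, ← ENNReal.rpow_mul]; norm_num
  refine (pow_le_pow_left' h 2).trans_eq ?_
  rw [mul_pow, mul_pow (E ^ (1 / 2 : ℝ)), e, e]

theorem IsL2MeanZero.bilin (hu : IsL2MeanZero τ u) (hv : IsL2MeanZero τ v) :
    IsL2MeanZero τ (bilin τ u v) where
  aestronglyMeasurable n := by
    rw [bilin_eq_trigPoly]
    exact (continuous_trigPoly _ _).aestronglyMeasurable
  l2_finite := by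
    obtain ⟨K, hK, h⟩ := exists_enorm_bilin_sq_le τ
    refine ENNReal.mul_lt_top ENNReal.ofReal_lt_top (lt_top_iff_ne_top.2 ?_)
    refine ne_top_of_le_ne_top (ENNReal.mul_ne_top (ENNReal.mul_ne_top hK (ENNReal.mul_ne_top
      hu.tsum_energy_ne_top hv.tsum_energy_ne_top))
      (measure_ne_top (volume : Measure Torus) Set.univ)) ?_
    calc ∑' n, ∫⁻ x : Torus, ‖DiscreteKdV.bilin τ u v n x‖ₑ ^ 2
        ≤ ∑' n, K * ((∑' n, ∫⁻ x : Torus, ‖u n x‖ₑ ^ 2) * ∫⁻ x : Torus, ‖v n x‖ₑ ^ 2) *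
            volume (Set.univ : Set Torus) := by
          refine ENNReal.tsum_le_tsum fun n => ?_
          rw [← lintegral_const]
          refine lintegral_mono fun x => (h u v hu hv n x).trans ?_
          exact mul_le_mul' le_rfl (mul_le_mul' (ENNReal.le_tsum n) le_rfl)
      _ = _ := by rw [ENNReal.tsum_mul_right, ENNReal.tsum_mul_left, ENNReal.tsum_mul_left]
  mean_zero n := by
    have h : fourierCoeff (DiscreteKdV.bilin τ u v n) 0 = 0 := by simp [fourierCoeff_bilin]
    have e : fourierCoeff (DiscreteKdV.bilin τ u v n) 0 =
        (2 * π)⁻¹ • ∫ x : Torus, DiscreteKdV.bilin τ u v n x := by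
      unfold fourierCoeff
      rw [← integral_haarAddCircle]
      simp
    rw [e, smul_eq_zero] at h
    exact h.resolve_left (inv_ne_zero Real.two_pi_pos.ne')

end MeanZero

/-! ### Sobolev weights and the two halves of the Y norm. -/

section Weights

theorem jap_intCast_add_le (n m : ℤ) :
    jap ((n + m : ℤ) : ℂ) ≤ 2 * (jap (n : ℂ) * jap (m : ℂ)) := by
  have h : jap ((n + m : ℤ) : ℂ) ≤ jap (n : ℂ) + jap (m : ℂ) := by
    refine jap_le_add ?_
    push_cast
    exact norm_add_le _ _
  nlinarith [one_le_jap (n : ℂ), one_le_jap (m : ℂ),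
    mul_nonneg (sub_nonneg.2 (one_le_jap (n : ℂ))) (sub_nonneg.2 (one_le_jap (m : ℂ)))]

/-- The weight `⟨k⟩^s`, with values in `[0, ∞]`. -/
noncomputable def sobolevWeight (s : ℝ) (k : ℤ) : ℝ≥0∞ := ENNReal.ofReal (jap (k : ℂ) ^ s)

theorem sobolevWeight_le {s : ℝ} (hs : 0 ≤ s) (k n : ℤ) :
    sobolevWeight s k ≤
      ENNReal.ofReal (2 ^ s) * (sobolevWeight s n * sobolevWeight s (k - n)) := by
  unfold sobolevWeight
  have h1 := (jap_pos (n : ℂ)).le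
  have h2 := (jap_pos ((k - n : ℤ) : ℂ)).le
  rw [← ENNReal.ofReal_mul (by positivity), ← ENNReal.ofReal_mul (by positivity),
    ← Real.mul_rpow h1 h2, ← Real.mul_rpow (by norm_num) (by positivity)]
  refine ENNReal.ofReal_le_ofReal (Real.rpow_le_rpow (jap_pos _).le ?_ hs)
  simpa using jap_intCast_add_le n (k - n)

theorem ofReal_weight (τ s b : ℝ) (k : ℤ) (σ : FreqCircle τ) :
    ENNReal.ofReal (weight τ s b k σ) = sobolevWeight s k * phaseMod τ (k, σ) ^ b := by
  unfold weight sobolevWeight phaseMod modulation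
  rw [ENNReal.ofReal_mul (Real.rpow_nonneg (jap_pos _).le _),
    ENNReal.ofReal_rpow_of_pos (jap_pos _)]

/-- The amplitude `⟨k⟩^s |ũ(σ, k)|`, cut off to the non-zero low frequencies. -/
noncomputable def sobolevAmp (τ : ℝ) [Fact (0 < τ)] (s : ℝ) (u : ℤ → Torus → ℂ) (p : Phase τ) :
    ℝ≥0∞ := sobolevWeight s p.1 * lowAmp τ u p

variable {τ : ℝ} [hτ : Fact (0 < τ)] {u v : ℤ → Torus → ℂ}

theorem measurable_sobolevAmp {s : ℝ} : Measurable (sobolevAmp τ s u) := by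
  have : Measurable fun p : Phase τ => sobolevWeight s p.1 :=
    (measurable_of_countable (sobolevWeight s)).comp measurable_fst
  exact this.mul measurable_lowAmp

theorem isLowFreq_sobolevAmp {s : ℝ} : IsLowFreq τ (sobolevAmp τ s u) := fun p hp => by
  rw [sobolevAmp, isLowFreq_lowAmp p hp, mul_zero]

theorem sobolevWeight_mul_phaseConv_le {s : ℝ} (hs : 0 ≤ s) (k : ℤ) (σ : FreqCircle τ) :
    sobolevWeight s k * phaseConv τ (lowAmp τ u) (lowAmp τ v) (-(k, σ)) ≤
      ENNReal.ofReal (2 ^ s) * phaseConv τ (sobolevAmp τ s u) (sobolevAmp τ s v) (-(k, σ)) := by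
  rw [phaseConv_neg measurable_lowAmp measurable_lowAmp,
    phaseConv_neg measurable_sobolevAmp measurable_sobolevAmp, ← ENNReal.tsum_mul_left,
    ← ENNReal.tsum_mul_left]
  refine ENNReal.tsum_le_tsum fun n => ?_
  rw [← lintegral_const_mul' (ENNReal.ofReal (2 ^ s)) _ ENNReal.ofReal_ne_top,
    ← lintegral_const_mul' (sobolevWeight s k) _ ENNReal.ofReal_ne_top]
  refine lintegral_mono fun t => ?_
  calc sobolevWeight s k * (lowAmp τ u (n, t) * lowAmp τ v (k - n, σ - t))
      ≤ ENNReal.ofReal (2 ^ s) * (sobolevWeight s n * sobolevWeight s (k - n)) *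
          (lowAmp τ u (n, t) * lowAmp τ v (k - n, σ - t)) :=
        mul_le_mul' (sobolevWeight_le hs k n) le_rfl
    _ = _ := by unfold sobolevAmp; ring

theorem rpow_half_sq (c : ℝ≥0∞) : (c ^ (1 / 2 : ℝ)) ^ 2 = c := by
  rw [← ENNReal.rpow_natCast, ← ENNReal.rpow_mul]; norm_num

theorem sq_rpow_half (c : ℝ≥0∞) : (c ^ 2) ^ (1 / 2 : ℝ) = c := by
  rw [← ENNReal.rpow_natCast, ← ENNReal.rpow_mul]; norm_num

theorem phaseNormSq_sobolevAmp_le (s b : ℝ) :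
    phaseNormSq τ b (sobolevAmp τ s u) ≤ normXsb τ s b u ^ 2 := by
  rw [phaseNormSq_eq_tsum measurable_sobolevAmp, normXsb, rpow_half_sq]
  refine ENNReal.tsum_le_tsum fun k => lintegral_mono fun σ => ?_
  refine pow_le_pow_left' ?_ 2
  rw [ofReal_weight]
  calc phaseMod τ (k, σ) ^ b * sobolevAmp τ s u (k, σ)
      = phaseMod τ (k, σ) ^ b * (sobolevWeight s k * lowAmp τ u (k, σ)) := rfl
    _ = sobolevWeight s k * phaseMod τ (k, σ) ^ b * lowAmp τ u (k, σ) := by ring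
    _ ≤ _ := mul_le_mul' le_rfl (lowAmp_le _)

omit hτ in
theorem derivSymbol_neg (k : ℤ) : derivSymbol τ (-k) = derivSymbol τ k := by
  unfold derivSymbol
  by_cases hk : k ∈ lowFreq τ
  · rw [Set.indicator_of_mem hk, Set.indicator_of_mem (neg_mem_lowFreq.2 hk), Int.natAbs_neg]
  · rw [Set.indicator_of_notMem hk, Set.indicator_of_notMem (mt neg_mem_lowFreq.1 hk)]

/-- The weighted amplitude of the product, up to a constant. -/
theorem ae_weight_mul_enorm_le {s : ℝ} (hs : 0 ≤ s) (b : ℝ) (hu : IsL2MeanZero τ u)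
    (hv : IsL2MeanZero τ v) (k : ℤ) :
    ∀ᵐ σ : FreqCircle τ,
      ENNReal.ofReal (weight τ s b k σ) * ‖spaceTimeFourier τ (bilin τ u v) k σ‖ₑ ≤
        ENNReal.ofReal (2 ^ s) * (derivSymbol τ (-k) * phaseMod τ (-k, -σ) ^ b *
          phaseConv τ (sobolevAmp τ s u) (sobolevAmp τ s v) (-k, -σ)) := by
  filter_upwards [hu.enorm_spaceTimeFourier_bilin_le hv k] with σ h
  -- The normalisation constant is simply dropped.
  have hπ : ENNReal.ofReal (1 / (2 * π)) ≤ 1 := by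
    rw [ENNReal.ofReal_le_one, div_le_one Real.two_pi_pos]
    linarith [Real.pi_gt_three]
  have h1 := phaseMod_neg (τ := τ) (k, σ)
  rw [Prod.neg_mk] at h1
  rw [ofReal_weight, h1, derivSymbol_neg]
  have h2 := sobolevWeight_mul_phaseConv_le (u := u) (v := v) hs k σ
  rw [Prod.neg_mk] at h h2
  set P := phaseMod τ (k, σ) ^ b
  set D := derivSymbol τ k
  set A := phaseConv τ (lowAmp τ u) (lowAmp τ v) (-k, -σ)
  set J := sobolevWeight s k
  calc _ ≤ J * P * (1 * (D * A)) :=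
        mul_le_mul' le_rfl (h.trans (mul_le_mul' hπ le_rfl))
    _ = D * P * (J * A) := by ring
    _ ≤ D * P * (ENNReal.ofReal (2 ^ s) * _) := mul_le_mul' le_rfl h2
    _ = _ := by ring

theorem bilinearBound_rpow_half_le (s : ℝ) :
    bilinearBound τ (sobolevAmp τ s u) (sobolevAmp τ s v) ^ (1 / 2 : ℝ) ≤
      normXsb τ s (1 / 2) u * normXsb τ s (1 / 3) v +
        normXsb τ s (1 / 2) v * normXsb τ s (1 / 3) u := by
  rw [← sq_rpow_half (normXsb τ s (1 / 2) u * normXsb τ s (1 / 3) v + _)]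
  refine ENNReal.rpow_le_rpow ?_ (by norm_num)
  unfold bilinearBound
  calc _ ≤ normXsb τ s (1 / 2) u ^ 2 * normXsb τ s (1 / 3) v ^ 2 +
        normXsb τ s (1 / 2) v ^ 2 * normXsb τ s (1 / 3) u ^ 2 :=
        add_le_add (mul_le_mul' (phaseNormSq_sobolevAmp_le _ _) (phaseNormSq_sobolevAmp_le _ _))
          (mul_le_mul' (phaseNormSq_sobolevAmp_le _ _) (phaseNormSq_sobolevAmp_le _ _))
    _ ≤ _ := by
        rw [← mul_pow, ← mul_pow, add_sq]
        exact add_le_add le_self_add le_rfl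

theorem exists_normXsb_bilin_le {s : ℝ} (hs : 0 ≤ s) : ∃ C : ℝ≥0∞, C ≠ ∞ ∧
    ∀ (τ : ℝ) [Fact (0 < τ)] (u v : ℤ → Torus → ℂ), IsL2MeanZero τ u → IsL2MeanZero τ v →
      normXsb τ s (-(1 / 2)) (bilin τ u v) ≤ C *
        (normXsb τ s (1 / 2) u * normXsb τ s (1 / 3) v +
          normXsb τ s (1 / 2) v * normXsb τ s (1 / 3) u) := by
  obtain ⟨C, hC, h⟩ := exists_bilinear_l2_le
  refine ⟨ENNReal.ofReal (2 ^ s) * C ^ (1 / 2 : ℝ), ENNReal.mul_ne_top ENNReal.ofReal_ne_top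
    (ENNReal.rpow_ne_top_of_nonneg (by norm_num) hC), fun τ _ u v hu hv => ?_⟩
  set f := sobolevAmp τ s u
  set g := sobolevAmp τ s v
  have hf : Measurable f := measurable_sobolevAmp
  have hg : Measurable g := measurable_sobolevAmp
  set G : Phase τ → ℝ≥0∞ := fun z =>
    (derivSymbol τ z.1 * phaseMod τ z ^ (-(1 / 2) : ℝ) * phaseConv τ f g z) ^ 2 with hG
  have hGm : Measurable G := (((measurable_derivSymbol (τ := τ)).mul
    (measurable_phaseMod.pow_const _)).mul (measurable_phaseConv hf hg)).pow_const 2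
  have h1 : (∑' k : ℤ, ∫⁻ σ : FreqCircle τ, (ENNReal.ofReal (weight τ s (-(1 / 2)) k σ) *
      ‖spaceTimeFourier τ (bilin τ u v) k σ‖ₑ) ^ 2) ≤
      ENNReal.ofReal (2 ^ s) ^ 2 * (C * bilinearBound τ f g) := by
    calc _ ≤ ∑' k : ℤ, ∫⁻ σ : FreqCircle τ, ENNReal.ofReal (2 ^ s) ^ 2 * G (-(k, σ)) := by
          refine ENNReal.tsum_le_tsum fun k => lintegral_mono_ae ?_
          filter_upwards [ae_weight_mul_enorm_le hs (-(1 / 2)) hu hv k] with σ hσ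
          refine (pow_le_pow_left' hσ 2).trans_eq ?_
          rw [mul_pow]
          rfl
      _ = ENNReal.ofReal (2 ^ s) ^ 2 * ∑' k : ℤ, ∫⁻ σ : FreqCircle τ, G (-(k, σ)) := by
          rw [← ENNReal.tsum_mul_left]
          refine tsum_congr fun k => ?_
          rw [lintegral_const_mul' _ _ (ENNReal.pow_ne_top ENNReal.ofReal_ne_top)]
      -- The reflection z ↦ -z introduced by the symmetric convention is removed by invariance of
      -- the measure.
      _ = ENNReal.ofReal (2 ^ s) ^ 2 * ∫⁻ z, G z ∂phaseMeasure τ := by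
          rw [← lintegral_phase (f := fun z => G (-z)) (hGm.comp measurable_neg),
            lintegral_neg_eq_self]
      _ ≤ _ := mul_le_mul' le_rfl (h τ f g hf hg isLowFreq_sobolevAmp isLowFreq_sobolevAmp)
  refine (ENNReal.rpow_le_rpow h1 (by norm_num : (0 : ℝ) ≤ 1 / 2)).trans ?_
  rw [ENNReal.mul_rpow_of_nonneg _ _ (by norm_num), ENNReal.mul_rpow_of_nonneg _ _ (by norm_num),
    sq_rpow_half, ← mul_assoc]
  exact mul_le_mul' le_rfl (bilinearBound_rpow_half_le s)

theorem exists_normL2L1_bilin_le {s : ℝ} (hs : 0 ≤ s) : ∃ C : ℝ≥0∞, C ≠ ∞ ∧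
    ∀ (τ : ℝ) [Fact (0 < τ)] (u v : ℤ → Torus → ℂ), IsL2MeanZero τ u → IsL2MeanZero τ v →
      normL2L1 τ s (-1) (bilin τ u v) ≤ C *
        (normXsb τ s (1 / 2) u * normXsb τ s (1 / 3) v +
          normXsb τ s (1 / 2) v * normXsb τ s (1 / 3) u) := by
  obtain ⟨C, hC, h⟩ := exists_bilinear_l1_le
  refine ⟨ENNReal.ofReal (2 ^ s) * C ^ (1 / 2 : ℝ), ENNReal.mul_ne_top ENNReal.ofReal_ne_top
    (ENNReal.rpow_ne_top_of_nonneg (by norm_num) hC), fun τ _ u v hu hv => ?_⟩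
  set f := sobolevAmp τ s u
  set g := sobolevAmp τ s v
  have hf : Measurable f := measurable_sobolevAmp
  have hg : Measurable g := measurable_sobolevAmp
  set G : ℤ → FreqCircle τ → ℝ≥0∞ := fun k σ =>
    derivSymbol τ k * phaseMod τ (k, σ) ^ (-1 : ℝ) * phaseConv τ f g (k, σ) with hG
  have h1 : (∑' k : ℤ, (∫⁻ σ : FreqCircle τ, ENNReal.ofReal (weight τ s (-1) k σ) *
      ‖spaceTimeFourier τ (bilin τ u v) k σ‖ₑ) ^ 2) ≤
      ENNReal.ofReal (2 ^ s) ^ 2 * (C * bilinearBound τ f g) := by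
    calc _ ≤ ∑' k : ℤ, (ENNReal.ofReal (2 ^ s) * ∫⁻ σ, G (-k) σ) ^ 2 := by
          refine ENNReal.tsum_le_tsum fun k => pow_le_pow_left' ?_ 2
          rw [← lintegral_neg_eq_self (G (-k)), ← lintegral_const_mul' _ _ ENNReal.ofReal_ne_top]
          exact lintegral_mono_ae (ae_weight_mul_enorm_le hs (-1) hu hv k)
      _ = ENNReal.ofReal (2 ^ s) ^ 2 * ∑' k : ℤ, (∫⁻ σ, G k σ) ^ 2 := by
          simp_rw [mul_pow]
          rw [ENNReal.tsum_mul_left, ← (Equiv.neg ℤ).tsum_eq fun k => (∫⁻ σ, G k σ) ^ 2]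
          rfl
      _ ≤ _ := mul_le_mul' le_rfl (h τ f g hf hg isLowFreq_sobolevAmp isLowFreq_sobolevAmp)
  refine (ENNReal.rpow_le_rpow h1 (by norm_num : (0 : ℝ) ≤ 1 / 2)).trans ?_
  rw [ENNReal.mul_rpow_of_nonneg _ _ (by norm_num), ENNReal.mul_rpow_of_nonneg _ _ (by norm_num),
    sq_rpow_half, ← mul_assoc]
  exact mul_le_mul' le_rfl (bilinearBound_rpow_half_le s)

theorem normXsb_mono {s b c : ℝ} (h : b ≤ c) (u : ℤ → Torus → ℂ) :
    normXsb τ s b u ≤ normXsb τ s c u := by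
  unfold normXsb
  refine ENNReal.rpow_le_rpow ?_ (by norm_num)
  refine ENNReal.tsum_le_tsum fun k => lintegral_mono fun σ => pow_le_pow_left' ?_ 2
  rw [ofReal_weight, ofReal_weight]
  exact mul_le_mul' (mul_le_mul' le_rfl (phaseMod_rpow_le_rpow h _)) le_rfl

theorem MemX.normXsb_half_ne_top {s : ℝ} (hu : MemX τ s u) : normXsb τ s (1 / 2) u ≠ ∞ :=
  ne_top_of_le_ne_top hu.2.ne le_self_add

theorem MemX.normXsb_third_ne_top {s : ℝ} (hu : MemX τ s u) : normXsb τ s (1 / 3) u ≠ ∞ :=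
  ne_top_of_le_ne_top hu.normXsb_half_ne_top (normXsb_mono (by norm_num) u)

end Weights
end DiscreteKdV

theorem lemma3p3 (s : ℝ) (hs : 0 ≤ s) :
    ∃ C : ℝ, 0 < C ∧ ∀ (τ : ℝ) [Fact (0 < τ)], τ ≤ 1 →
      ∀ u v : ℤ → DiscreteKdV.Torus → ℂ, DiscreteKdV.MemX τ s u → DiscreteKdV.MemX τ s v →
        DiscreteKdV.MemY τ s (DiscreteKdV.bilin τ u v) ∧
        DiscreteKdV.normY τ s (DiscreteKdV.bilin τ u v) ≤
          ENNReal.ofReal C *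
            (DiscreteKdV.normXsb τ s (1 / 2) u * DiscreteKdV.normXsb τ s (1 / 3) v +
              DiscreteKdV.normXsb τ s (1 / 2) v * DiscreteKdV.normXsb τ s (1 / 3) u) := by
  obtain ⟨C₁, hC₁, h1⟩ := DiscreteKdV.exists_normXsb_bilin_le hs
  obtain ⟨C₂, hC₂, h2⟩ := DiscreteKdV.exists_normL2L1_bilin_le hs
  -- The added 1 only makes the constant strictly positive.
  refine ⟨(C₁ + C₂).toReal + 1, by positivity, fun τ _ _ u v hu hv => ?_⟩
  set B := DiscreteKdV.normXsb τ s (1 / 2) u * DiscreteKdV.normXsb τ s (1 / 3) v +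
    DiscreteKdV.normXsb τ s (1 / 2) v * DiscreteKdV.normXsb τ s (1 / 3) u
  have hB : B ≠ ∞ := ENNReal.add_ne_top.2
    ⟨ENNReal.mul_ne_top hu.normXsb_half_ne_top hv.normXsb_third_ne_top,
      ENNReal.mul_ne_top hv.normXsb_half_ne_top hu.normXsb_third_ne_top⟩
  have hle : DiscreteKdV.normY τ s (DiscreteKdV.bilin τ u v) ≤
      ENNReal.ofReal ((C₁ + C₂).toReal + 1) * B := by
    calc _ ≤ C₁ * B + C₂ * B := add_le_add (h1 τ u v hu.1 hv.1) (h2 τ u v hu.1 hv.1)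
      _ = (C₁ + C₂) * B := (add_mul _ _ _).symm
      _ ≤ _ := by
          refine mul_le_mul' ?_ le_rfl
          rw [← ENNReal.ofReal_toReal (ENNReal.add_ne_top.2 ⟨hC₁, hC₂⟩)]
          exact ENNReal.ofReal_le_ofReal (by rw [ENNReal.toReal_ofReal (by positivity)]; linarith)
  exact ⟨⟨hu.1.bilin hv.1, hle.trans_lt (ENNReal.mul_lt_top ENNReal.ofReal_lt_top hB.lt_top)⟩, hle⟩
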